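/- Let $\mathfrak g=\mathfrak{osp}(3|2)=\mathfrak g_{\bar 0}\oplus\mathfrak g_{\bar 1}$ be the complex Lie superalgebra of endomorphisms of $\mathbb C^{3|2}$ preserving (in the super sense) the even non-degenerate bilinear form which is symmetric on $\mathbb C^3$ and skew-symmetric on $\mathbb C^2$, so that $\mathfrak g_{\bar 0}=\mathfrak{so}(3)\oplus\mathfrak{sp}(2)$. Let $U(\mathfrak g)$ be its enveloping algebra with counit $\varepsilon$. Let $C=\sum_i b_i b^i\in U(\mathfrak g)$ be the quadratic Casimir element, where $(b_i)$ is a homogeneous basis of $\mathfrak g$ and $(b^i)$ is the dual basis, $\tfrac12\operatorname{str}(b^i b_j)=\delta_{ij}$ (supertrace on $\mathbb C^{3|2}$), and put $$z=C(C-2)(C+6).$$ (1) $z\notin U(\mathfrak g)\mathfrak g_{\bar 0}$, and $z+U(\mathfrak g)\mathfrak g_{\bar 0}$ is a non-zero invariant of the left $U(\mathfrak g)$-module $W=U(\mathfrak g)/U(\mathfrak g)\mathfrak g_{\bar 0}$, that is, $x\,(z+U(\mathfrak g)\mathfrak g_{\bar 0})=\varepsilon(x)\,(z+U(\mathfrak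 g)\mathfrak g_{\bar 0})$ for all $x\in U(\mathfrak g)$. (2) For a superalgebra $A$ let $A^\circ$ denote its finite dual, i.e. the space of linear forms on $A$ vanishing on a two-sided ideal of finite codimension, with the coproduct $\Delta$ dual to the product of $A$: $a(xy)=\sum(-1)^{[a_{(2)}][x]}a_{(1)}(x)\,a_{(2)}(y)$. For $A=U(\mathfrak g)$ or $A=U(\mathfrak g_{\bar 0})$ the unit element $1$ of the Hopf superalgebra $A^\circ$ is the counit of $A$, and a linear form $s$ on $A^\circ$ is called a left (right) integral if $\sum a_{(1)}s(a_{(2)})=s(a)1$ (respectively $\sum s(a_{(1)})a_{(2)}=s(a)1$) for all $a\in A^\circ$. Let $\mathcal P:U(\mathfrak g)^\circ\to U(\mathfrak g_{\bar 0})^\circ$ be the restriction map, let $\nu(x)$, for $x\in U(\mathfrak g)$, be the linear form $a\mapsto(-1)^{[x][a]}a(x)$ on $U(\mathfrak g)^\circ$, and let $\cdot$ be the product $(\alpha\cdot\beta)(a)=\sum(-1)^{[\beta][a_{(1)}]}\alpha(a_{(1)})\beta(a_{(2)})$ of linear forms on $U(\mathfrak g)^\circ$. There exists a left integral $\int_0$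 on $U(\mathfrak g_{\bar 0})^\circ$ with $\int_0 1=1$, and for every such $\int_0$ the linear form $$\int=\nu(z)\cdot\int_0\mathcal P$$ is a non-zero left and right integral on $U(\mathfrak g)^\circ$. -/

import Mathlib

open scoped TensorProduct

attribute [local instance] LieRing.ofAssociativeRing

noncomputable section

/-! ### Super vector spaces and super duality

A complex super vector space `V = V₀ ⊕ V₁` is given by its parity involution
`v ↦ (-1)^[v] v`; the homogeneous elements are the eigenvectors for `1` and `-1`. -/

/-- A complex super vector space. -/
class SuperSpace (V : Type*) [AddCommGroup V] [Module ℂ V] where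
  parity : V →ₗ[ℂ] V
  parity_parity : ∀ v, parity (parity v) = v

namespace SuperSpace

variable {V : Type*} [AddCommGroup V] [Module ℂ V] [SuperSpace V]

variable (V) in
/-- The projection `v ↦ v₀` onto the even part. -/
def evenPart : V →ₗ[ℂ] V := (2⁻¹ : ℂ) • (LinearMap.id + parity)

variable (V) in
/-- The projection `v ↦ v₁` onto the odd part. -/
def oddPart : V →ₗ[ℂ] V := (2⁻¹ : ℂ) • (LinearMap.id - parity)

/-- The dual superspace: a linear form is even (odd) if it vanishes on `V₁` (on `V₀`). -/
instance : SuperSpace (Module.Dual ℂ V) where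
  parity := Module.Dual.transpose parity
  parity_parity f := by
    ext v
    simp [Module.Dual.transpose, parity_parity]

theorem parity_dual_apply (f : Module.Dual ℂ V) (v : V) : parity f v = f (parity v) := rfl

/-- The graded tensor product of linear forms,
`(f ⊗ g)(v ⊗ w) = (-1)^([g][v]) f(v) g(w)`. For `v` even there is no sign, and for `v` odd the
sign `(-1)^[g]` is absorbed in `(-1)^[g] g = parity g`. -/
def superTensor (f g : Module.Dual ℂ V) : Module.Dual ℂ (V ⊗[ℂ] V) :=
  LinearMap.mul' ℂ ℂ ∘ₗ
    (TensorProduct.map (f ∘ₗ evenPart V) g + TensorProduct.map (f ∘ₗ oddPart V) (parity g))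

theorem superTensor_tmul (f g : Module.Dual ℂ V) (v w : V) :
    superTensor f g (v ⊗ₜ w) =
      f (evenPart V v) * g w + f (oddPart V v) * (parity g) w := by
  simp [superTensor]

end SuperSpace

open SuperSpace

/-- A complex (associative, unital) superalgebra: the parity involution is multiplicative, that is,
`A_i A_j ⊆ A_{i+j}`. -/
class SuperAlgebra (A : Type*) [Ring A] [Algebra ℂ A] extends SuperSpace A where
  parity_one : parity (1 : A) = 1
  parity_mul : ∀ a b : A, parity (a * b) = parity a * parity b

/-- The parity involution of a superalgebra as an algebra homomorphism. -/
def SuperAlgebra.parityHom (A : Type*) [Ring A] [Algebra ℂ A] [SuperAlgebra A] : A →ₐ[ℂ] A :=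
  AlgHom.ofLinearMap SuperSpace.parity SuperAlgebra.parity_one SuperAlgebra.parity_mul

/-! ### The finite dual as a supercoalgebra -/

section FiniteDual

variable (A : Type*) [Ring A] [Algebra ℂ A]

/-- The finite dual `A°`: the linear forms on `A` that vanish on some two-sided ideal of finite
codimension. -/
def finiteDual : Submodule ℂ (Module.Dual ℂ A) where
  carrier := {f | ∃ I : Ideal A, I.IsTwoSided ∧ FiniteDimensional ℂ (A ⧸ I) ∧ ∀ x ∈ I, f x = 0}
  zero_mem' := by
    refine ⟨⊤, inferInstance, ?_, fun _ _ => rfl⟩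
    have : Subsingleton (A ⧸ (⊤ : Ideal A)) := Submodule.Quotient.subsingleton_iff.2 rfl
    infer_instance
  add_mem' := by
    rintro f g ⟨I, hI, hIf, hf⟩ ⟨J, hJ, hJf, hg⟩
    refine ⟨I ⊓ J, ⟨fun b ha => ⟨hI.mul_mem_of_left b ha.1, hJ.mul_mem_of_left b ha.2⟩⟩, ?_,
      fun x hx => by simp [hf x hx.1, hg x hx.2]⟩
    let e : (A ⧸ (I ⊓ J)) →ₗ[ℂ] (A ⧸ I) × (A ⧸ J) :=
      (((I ⊓ J).liftQ (Submodule.mkQ I) (by simp)).restrictScalars ℂ).prod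
        (((I ⊓ J).liftQ (Submodule.mkQ J) (by simp)).restrictScalars ℂ)
    refine FiniteDimensional.of_injective e ((injective_iff_map_eq_zero e).2 fun x hx => ?_)
    obtain ⟨x, rfl⟩ := Submodule.Quotient.mk_surjective _ x
    obtain ⟨h1, h2⟩ := Prod.mk.inj hx
    exact (Submodule.Quotient.mk_eq_zero _).2
      ⟨(Submodule.Quotient.mk_eq_zero I).1 h1, (Submodule.Quotient.mk_eq_zero J).1 h2⟩
  smul_mem' := by
    rintro c f ⟨I, hI, hIf, hf⟩
    exact ⟨I, hI, hIf, fun x hx => by simp [hf x hx]⟩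

variable {A}

/-- The algebra homomorphism `φ : B → A` induces `φ* : A° → B°`. -/
theorem dualMap_mem_finiteDual {B : Type*} [Ring B] [Algebra ℂ B] (φ : B →ₐ[ℂ] A)
    {f : Module.Dual ℂ A} (hf : f ∈ finiteDual A) : f ∘ₗ φ.toLinearMap ∈ finiteDual B := by
  obtain ⟨I, hI, hIf, hf⟩ := hf
  refine ⟨I.comap φ, inferInstance, ?_, fun x hx => hf _ hx⟩
  let ψ : B →ₗ[ℂ] A ⧸ I := (Submodule.mkQ I).restrictScalars ℂ ∘ₗ φ.toLinearMap
  have hk : LinearMap.ker ψ = (I.comap φ).restrictScalars ℂ := by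
    ext x
    exact Submodule.Quotient.mk_eq_zero I
  have : FiniteDimensional ℂ (B ⧸ LinearMap.ker ψ) :=
    FiniteDimensional.of_injective ((LinearMap.ker ψ).liftQ ψ le_rfl)
      (LinearMap.ker_eq_bot.1 (Submodule.ker_liftQ_eq_bot _ _ _ le_rfl))
  rw [hk] at this
  exact Module.Finite.equiv (Submodule.Quotient.restrictScalarsEquiv ℂ (I.comap φ))

/-- The map `φ* : A° → B°` dual to an algebra homomorphism `φ : B → A`. -/
def finiteDual.map {B : Type*} [Ring B] [Algebra ℂ B] (φ : B →ₐ[ℂ] A) :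
    finiteDual A →ₗ[ℂ] finiteDual B :=
  (Module.Dual.transpose φ.toLinearMap).restrict fun _ hf => dualMap_mem_finiteDual φ hf

/-- An algebra homomorphism `A → ℂ`, regarded as an element of `A°`. -/
def finiteDual.ofChar (χ : A →ₐ[ℂ] ℂ) : finiteDual A :=
  ⟨χ.toLinearMap, by
    have : (LinearMap.id : ℂ →ₗ[ℂ] ℂ) ∈ finiteDual ℂ :=
      ⟨⊥, inferInstance, Module.Finite.of_surjective
        ((Submodule.mkQ (⊥ : Ideal ℂ)).restrictScalars ℂ) (Submodule.mkQ_surjective _),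
        fun x hx => by simpa using hx⟩
    exact dualMap_mem_finiteDual χ this⟩

end FiniteDual

section Coproduct

variable (A : Type*) [Ring A] [Algebra ℂ A]

/-- The non-graded pairing `⟨f ⊗ g, x ⊗ y⟩ = f(x) g(y)` of `A° ⊗ A°` with `A ⊗ A`. -/
def finiteDual.pairing :
    finiteDual A ⊗[ℂ] finiteDual A →ₗ[ℂ] Module.Dual ℂ (A ⊗[ℂ] A) :=
  TensorProduct.dualDistrib ℂ A A ∘ₗ
    TensorProduct.map (finiteDual A).subtype (finiteDual A).subtype

theorem finiteDual.pairing_injective : Function.Injective (finiteDual.pairing A) := by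
  classical
  refine (injective_iff_map_eq_zero _).2 fun t ht => ?_
  let b := Module.Basis.ofVectorSpace ℂ (finiteDual A)
  let e := TensorProduct.equivFinsuppOfBasisLeft (N := finiteDual A) b
  have h1 : ∀ x y, ((e t).sum fun i g => (b i : Module.Dual ℂ A) x * (g : Module.Dual ℂ A) y) = 0 := by
    intro x y
    have := LinearMap.congr_fun ht (x ⊗ₜ y)
    rw [← e.symm_apply_apply t] at this
    rw [show e.symm (e t) = _ from TensorProduct.equivFinsuppOfBasisLeft_symm_apply b (e t)] at this
    simpa [finiteDual.pairing, Finsupp.sum, LinearMap.sum_apply] using this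
  have h2 : e t = 0 := by
    ext i y
    have h3 : ∑ j ∈ (e t).support, ((e t j : Module.Dual ℂ A) y) • b j = 0 := by
      ext x
      simpa [Finsupp.sum, LinearMap.sum_apply, mul_comm] using h1 x y
    by_cases hi : i ∈ (e t).support
    · simpa using linearIndependent_iff'.1 b.linearIndependent _ _ h3 i hi
    · simp [Finsupp.notMem_support_iff.1 hi]
  simpa using h2

variable {A}

theorem finiteDual.exists_coproduct (f : finiteDual A) :
    ∃ t : finiteDual A ⊗[ℂ] finiteDual A, ∀ x y : A,
      finiteDual.pairing A t (x ⊗ₜ y) = (f : Module.Dual ℂ A) (x * y) := by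
  obtain ⟨f, I, hI, hIf, hf⟩ := f
  let π : A →ₗ[ℂ] A ⧸ I := (Submodule.mkQ I).restrictScalars ℂ
  let b := Module.finBasis ℂ (A ⧸ I)
  have hs : ∀ i, ∃ a : A, π a = b i := fun i => Submodule.mkQ_surjective I (b i)
  choose a ha using hs
  let u : Fin (Module.finrank ℂ (A ⧸ I)) → finiteDual A := fun i =>
    ⟨b.coord i ∘ₗ π, I, hI, hIf, fun x hx => by
      have : π x = 0 := (Submodule.Quotient.mk_eq_zero I).2 hx
      simp [this]⟩
  let v : Fin (Module.finrank ℂ (A ⧸ I)) → finiteDual A := fun i =>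
    ⟨f ∘ₗ LinearMap.mulLeft ℂ (a i), I, hI, hIf, fun x hx => hf _ (I.mul_mem_left _ hx)⟩
  refine ⟨∑ i, u i ⊗ₜ v i, fun x y => ?_⟩
  have hx : x - ∑ i, b.coord i (π x) • a i ∈ I := by
    refine (Submodule.Quotient.mk_eq_zero I).1 ?_
    change π _ = 0
    rw [map_sub, map_sum, sub_eq_zero]
    conv_lhs => rw [← b.sum_repr (π x)]
    exact Finset.sum_congr rfl fun i _ => by simp [ha]
  have h := hf _ (hI.mul_mem_of_left y hx)
  rw [sub_mul, map_sub, sub_eq_zero] at h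
  change _ = f (x * y)
  rw [h, Finset.sum_mul, map_sum, map_sum, LinearMap.sum_apply]
  refine Finset.sum_congr rfl fun i _ => ?_
  simp [finiteDual.pairing, u, v]

variable (A) in
/-- The non-graded coproduct of `A°`, `f(xy) = ∑ f₁(x) f₂(y)`. -/
def finiteDual.comulAux : finiteDual A →ₗ[ℂ] finiteDual A ⊗[ℂ] finiteDual A where
  toFun f := (finiteDual.exists_coproduct f).choose
  map_add' f g := by
    refine finiteDual.pairing_injective A (TensorProduct.ext' fun x y => ?_)
    rw [map_add, LinearMap.add_apply, (finiteDual.exists_coproduct f).choose_spec,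
      (finiteDual.exists_coproduct g).choose_spec, (finiteDual.exists_coproduct (f + g)).choose_spec]
    rfl
  map_smul' c f := by
    refine finiteDual.pairing_injective A (TensorProduct.ext' fun x y => ?_)
    rw [map_smul, LinearMap.smul_apply, (finiteDual.exists_coproduct f).choose_spec,
      (finiteDual.exists_coproduct (c • f)).choose_spec]
    rfl

variable [SuperAlgebra A]

/-- `A°` is a graded subspace of the dual of `A`. -/
instance : SuperSpace (finiteDual A) where
  parity := finiteDual.map (SuperAlgebra.parityHom A)
  parity_parity f := by
    ext x
    exact congrArg (f : Module.Dual ℂ A) (SuperSpace.parity_parity x)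

theorem finiteDual.parity_apply (f : finiteDual A) (x : A) :
    (parity f : finiteDual A).1 x = f.1 (parity x) := rfl

variable (A) in
/-- The coproduct `Δ` of the supercoalgebra `A°`. It is dual to the product of `A` with respect to
the graded pairing, see `finiteDual.comul_spec`, and is obtained from the non-graded coproduct by
inserting the sign `(-1)^([f₁][f₂])`. -/
def finiteDual.comul : finiteDual A →ₗ[ℂ] finiteDual A ⊗[ℂ] finiteDual A :=
  (TensorProduct.map (evenPart (finiteDual A)) LinearMap.id +
    TensorProduct.map (oddPart (finiteDual A)) parity) ∘ₗ finiteDual.comulAux A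

variable (A) in
/-- The graded pairing `⟨f ⊗ g, x ⊗ y⟩ = (-1)^([g][x]) f(x) g(y)` of `A° ⊗ A°` with `A ⊗ A`. -/
def finiteDual.superPairing :
    finiteDual A ⊗[ℂ] finiteDual A →ₗ[ℂ] Module.Dual ℂ (A ⊗[ℂ] A) :=
  TensorProduct.lift <| LinearMap.mk₂ ℂ (fun f g => superTensor f.1 g.1)
    (fun f f' g => by
      refine TensorProduct.ext' fun x y => ?_
      simp only [superTensor_tmul, LinearMap.add_apply, Submodule.coe_add]; ring)
    (fun c f g => by
      refine TensorProduct.ext' fun x y => ?_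
      simp only [superTensor_tmul, LinearMap.smul_apply, Submodule.coe_smul, smul_eq_mul]; ring)
    (fun f g g' => by
      refine TensorProduct.ext' fun x y => ?_
      simp only [superTensor_tmul, LinearMap.add_apply, Submodule.coe_add, map_add]; ring)
    (fun c f g => by
      refine TensorProduct.ext' fun x y => ?_
      simp only [superTensor_tmul, LinearMap.smul_apply, Submodule.coe_smul, map_smul,
        smul_eq_mul]; ring)

/-- The defining property of the coproduct of `A°`: `⟨Δ f, x ⊗ y⟩ = ⟨f, x y⟩`. -/
theorem finiteDual.comul_spec (f : finiteDual A) (x y : A) :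
    finiteDual.superPairing A (finiteDual.comul A f) (x ⊗ₜ y) = f.1 (x * y) := by
  rw [← (finiteDual.exists_coproduct f).choose_spec x y]
  change finiteDual.superPairing A (((TensorProduct.map (evenPart (finiteDual A)) LinearMap.id +
    TensorProduct.map (oddPart (finiteDual A)) parity :
      finiteDual A ⊗[ℂ] finiteDual A →ₗ[ℂ] finiteDual A ⊗[ℂ] finiteDual A))
    (finiteDual.exists_coproduct f).choose) _ = _
  generalize (finiteDual.exists_coproduct f).choose = t
  induction t with
  | zero => simp
  | add s t hs ht => rw [map_add, map_add, LinearMap.add_apply, hs, ht, map_add, LinearMap.add_apply]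
  | tmul g h =>
    simp only [finiteDual.superPairing, finiteDual.pairing, LinearMap.add_apply,
      TensorProduct.map_tmul, map_add, TensorProduct.lift.tmul, LinearMap.mk₂_apply,
      superTensor_tmul, evenPart, oddPart, LinearMap.smul_apply, LinearMap.sub_apply,
      LinearMap.id_apply, LinearMap.comp_apply, TensorProduct.dualDistrib_apply, Submodule.subtype_apply,
      parity_dual_apply, finiteDual.parity_apply, map_smul, map_sub, smul_eq_mul,
      SuperSpace.parity_parity]
    ring

/-- Left integrals on the supercoalgebra `A°` with unit element `e`:
`(id ⊗ s) Δ(a) = ∑ a₁ s(a₂) = s(a) e` for all `a`. -/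
def IsLeftIntegral (e : finiteDual A) (s : Module.Dual ℂ (finiteDual A)) : Prop :=
  ∀ a : finiteDual A,
    TensorProduct.rid ℂ _ (TensorProduct.map LinearMap.id s (finiteDual.comul A a)) = s a • e

/-- Right integrals on the supercoalgebra `A°` with unit element `e`:
`(s ⊗ id) Δ(a) = ∑ s(a₁) a₂ = s(a) e` for all `a`. -/
def IsRightIntegral (e : finiteDual A) (s : Module.Dual ℂ (finiteDual A)) : Prop :=
  ∀ a : finiteDual A,
    TensorProduct.lid ℂ _ (TensorProduct.map s LinearMap.id (finiteDual.comul A a)) = s a • e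

/-- The product `α · β` on the dual of `A°` deduced from `Δ`. -/
def dualMul (α β : Module.Dual ℂ (finiteDual A)) : Module.Dual ℂ (finiteDual A) :=
  superTensor α β ∘ₗ finiteDual.comul A

variable (A) in
/-- The natural map `ν` from `A` to the dual of `A°`, `⟨ν(x), a⟩ = (-1)^([x][a]) ⟨a, x⟩`. For `x`
even there is no sign, and for `x` odd the sign is absorbed in `(-1)^[a] a = parity a`. -/
def toBidual : A →ₗ[ℂ] Module.Dual ℂ (finiteDual A) :=
  LinearMap.mk₂ ℂ (fun x a => a.1 (evenPart A x) + (parity a).1 (oddPart A x))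
    (fun x y a => by simp only [map_add]; ring)
    (fun c x a => by simp only [map_smul, smul_eq_mul]; ring)
    (fun x a b => by simp only [map_add, Submodule.coe_add, LinearMap.add_apply]; ring)
    (fun c x a => by
      simp only [map_smul, Submodule.coe_smul, LinearMap.smul_apply, smul_eq_mul]; ring)

end Coproduct

/-! ### Lie superalgebras and their enveloping algebras -/

/-- A complex Lie superalgebra `L = L₀ ⊕ L₁`, given by the Lie algebra `L₀`, the `L₀`-module `L₁` and
the symmetric bracket `L₁ × L₁ → L₀`, subject to the super Jacobi identity. -/
class LieSuperalgebra (L₀ L₁ : Type*) [LieRing L₀] [LieAlgebra ℂ L₀] [AddCommGroup L₁]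
    [Module ℂ L₁] [LieRingModule L₀ L₁] [LieModule ℂ L₀ L₁] where
  oddBracket : L₁ →ₗ[ℂ] L₁ →ₗ[ℂ] L₀
  oddBracket_comm : ∀ x y, oddBracket x y = oddBracket y x
  lie_oddBracket : ∀ (a : L₀) (x y : L₁),
    ⁅a, oddBracket x y⁆ = oddBracket ⁅a, x⁆ y + oddBracket x ⁅a, y⁆
  jacobi : ∀ x y z : L₁, ⁅oddBracket x y, z⁆ + ⁅oddBracket y z, x⁆ + ⁅oddBracket z x, y⁆ = 0

section Enveloping

variable (L₀ L₁ : Type*) [LieRing L₀] [LieAlgebra ℂ L₀] [AddCommGroup L₁]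
    [Module ℂ L₁] [LieRingModule L₀ L₁] [LieModule ℂ L₀ L₁] [LieSuperalgebra L₀ L₁]

open LieSuperalgebra

/-- The relations `x y - (-1)^([x][y]) y x = [x, y]` of the enveloping algebra, for homogeneous
`x` and `y` in `L₀ ⊕ L₁`. -/
inductive SuperEnveloping.Rel : TensorAlgebra ℂ (L₀ × L₁) → TensorAlgebra ℂ (L₀ × L₁) → Prop
  | even_even (a b : L₀) : Rel
      (TensorAlgebra.ι ℂ (a, 0) * TensorAlgebra.ι ℂ (b, 0) -
        TensorAlgebra.ι ℂ (b, 0) * TensorAlgebra.ι ℂ (a, 0)) (TensorAlgebra.ι ℂ (⁅a, b⁆, 0))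
  | even_odd (a : L₀) (x : L₁) : Rel
      (TensorAlgebra.ι ℂ (a, 0) * TensorAlgebra.ι ℂ (0, x) -
        TensorAlgebra.ι ℂ (0, x) * TensorAlgebra.ι ℂ (a, 0)) (TensorAlgebra.ι ℂ (0, ⁅a, x⁆))
  | odd_odd (x y : L₁) : Rel
      (TensorAlgebra.ι ℂ (0, x) * TensorAlgebra.ι ℂ (0, y) +
        TensorAlgebra.ι ℂ (0, y) * TensorAlgebra.ι ℂ (0, x)) (TensorAlgebra.ι ℂ (oddBracket x y, 0))

/-- The enveloping algebra `U(L)` of the Lie superalgebra `L = L₀ ⊕ L₁`. -/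
def SuperEnveloping : Type _ := RingQuot (SuperEnveloping.Rel L₀ L₁)

namespace SuperEnveloping

instance : Ring (SuperEnveloping L₀ L₁) := inferInstanceAs (Ring (RingQuot _))

instance : Algebra ℂ (SuperEnveloping L₀ L₁) := inferInstanceAs (Algebra ℂ (RingQuot _))

/-- The canonical map `L₀ ⊕ L₁ → U(L)`. -/
def ι : L₀ × L₁ →ₗ[ℂ] SuperEnveloping L₀ L₁ :=
  (RingQuot.mkAlgHom ℂ (Rel L₀ L₁)).toLinearMap ∘ₗ TensorAlgebra.ι ℂ

/-- The canonical map on `L₀`. -/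
def ι₀ : L₀ →ₗ[ℂ] SuperEnveloping L₀ L₁ := ι L₀ L₁ ∘ₗ LinearMap.inl ℂ L₀ L₁

/-- The canonical map on `L₁`. -/
def ι₁ : L₁ →ₗ[ℂ] SuperEnveloping L₀ L₁ := ι L₀ L₁ ∘ₗ LinearMap.inr ℂ L₀ L₁

variable {L₀ L₁}

theorem ι₀_lie (a b : L₀) :
    ι₀ L₀ L₁ a * ι₀ L₀ L₁ b - ι₀ L₀ L₁ b * ι₀ L₀ L₁ a = ι₀ L₀ L₁ ⁅a, b⁆ := by
  have := RingQuot.mkAlgHom_rel ℂ (Rel.even_even (L₁ := L₁) a b)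
  rw [map_sub, map_mul, map_mul] at this
  exact this

theorem ι₁_lie (a : L₀) (x : L₁) :
    ι₀ L₀ L₁ a * ι₁ L₀ L₁ x - ι₁ L₀ L₁ x * ι₀ L₀ L₁ a = ι₁ L₀ L₁ ⁅a, x⁆ := by
  have := RingQuot.mkAlgHom_rel ℂ (Rel.even_odd a x)
  rw [map_sub, map_mul, map_mul] at this
  exact this

theorem ι₁_oddBracket (x y : L₁) :
    ι₁ L₀ L₁ x * ι₁ L₀ L₁ y + ι₁ L₀ L₁ y * ι₁ L₀ L₁ x = ι₀ L₀ L₁ (oddBracket x y) := by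
  have := RingQuot.mkAlgHom_rel ℂ (Rel.odd_odd (L₀ := L₀) x y)
  rw [map_add, map_mul, map_mul] at this
  exact this

/-- The universal property of `U(L)`. -/
def lift {B : Type*} [Ring B] [Algebra ℂ B] (f : L₀ →ₗ[ℂ] B) (g : L₁ →ₗ[ℂ] B)
    (hff : ∀ a b, f a * f b - f b * f a = f ⁅a, b⁆)
    (hfg : ∀ a x, f a * g x - g x * f a = g ⁅a, x⁆)
    (hgg : ∀ x y, g x * g y + g y * g x = f (oddBracket x y)) :
    SuperEnveloping L₀ L₁ →ₐ[ℂ] B :=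
  RingQuot.liftAlgHom ℂ ⟨TensorAlgebra.lift ℂ (f.coprod g), by
    intro u v h
    induction h with
    | even_even a b => simpa using hff a b
    | even_odd a x => simpa using hfg a x
    | odd_odd x y => simpa using hgg x y⟩

section

variable {B : Type*} [Ring B] [Algebra ℂ B] (f : L₀ →ₗ[ℂ] B) (g : L₁ →ₗ[ℂ] B)
    (hff : ∀ a b, f a * f b - f b * f a = f ⁅a, b⁆)
    (hfg : ∀ a x, f a * g x - g x * f a = g ⁅a, x⁆)
    (hgg : ∀ x y, g x * g y + g y * g x = f (oddBracket x y))

theorem lift_ι₀ (a : L₀) : lift f g hff hfg hgg (ι₀ L₀ L₁ a) = f a := by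
  refine (RingQuot.liftAlgHom_mkAlgHom_apply _ _ _ _).trans ?_
  simp

theorem lift_ι₁ (x : L₁) : lift f g hff hfg hgg (ι₁ L₀ L₁ x) = g x := by
  refine (RingQuot.liftAlgHom_mkAlgHom_apply _ _ _ _).trans ?_
  simp

theorem algHom_ext {φ ψ : SuperEnveloping L₀ L₁ →ₐ[ℂ] B}
    (h₀ : ∀ a, φ (ι₀ L₀ L₁ a) = ψ (ι₀ L₀ L₁ a)) (h₁ : ∀ x, φ (ι₁ L₀ L₁ x) = ψ (ι₁ L₀ L₁ x)) :
    φ = ψ := by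
  refine RingQuot.ringQuot_ext' ℂ _ _ (TensorAlgebra.hom_ext ?_)
  exact LinearMap.prod_ext (LinearMap.ext h₀) (LinearMap.ext h₁)

end

variable (L₀ L₁)

/-- The parity automorphism of `U(L)`: the identity on `L₀`, minus the identity on `L₁`. -/
def parityHom : SuperEnveloping L₀ L₁ →ₐ[ℂ] SuperEnveloping L₀ L₁ :=
  lift (ι₀ L₀ L₁) (-ι₁ L₀ L₁) ι₀_lie
    (fun a x => by
      rw [LinearMap.neg_apply, LinearMap.neg_apply, ← ι₁_lie, mul_neg, neg_mul]; abel)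
    (fun x y => by
      rw [LinearMap.neg_apply, LinearMap.neg_apply, neg_mul_neg, neg_mul_neg, ι₁_oddBracket])

instance : SuperAlgebra (SuperEnveloping L₀ L₁) where
  parity := (parityHom L₀ L₁).toLinearMap
  parity_parity u := by
    have : (parityHom L₀ L₁).comp (parityHom L₀ L₁) = AlgHom.id ℂ _ :=
      algHom_ext (by simp [parityHom, lift_ι₀]) (by simp [parityHom, lift_ι₁])
    exact DFunLike.congr_fun this u
  parity_one := map_one (parityHom L₀ L₁)
  parity_mul := map_mul (parityHom L₀ L₁)

/-- The counit `ε : U(L) → ℂ`, vanishing on `L`. -/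
def counit : SuperEnveloping L₀ L₁ →ₐ[ℂ] ℂ :=
  lift 0 0 (by simp) (by simp) (by simp)

/-- The embedding `U(L₀) → U(L)`. -/
def ofEven : UniversalEnvelopingAlgebra ℂ L₀ →ₐ[ℂ] SuperEnveloping L₀ L₁ :=
  UniversalEnvelopingAlgebra.lift ℂ
    { ι₀ L₀ L₁ with
      map_lie' := fun {a b} => by
        rw [LieRing.of_associative_ring_bracket]
        exact (ι₀_lie a b).symm }

/-- The left ideal `J = U(L) L₀` of `U(L)`. -/
def evenLeftIdeal : Ideal (SuperEnveloping L₀ L₁) := Ideal.span (Set.range (ι₀ L₀ L₁))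

end SuperEnveloping

/-- `U(L₀)` is purely even. -/
instance : SuperAlgebra (UniversalEnvelopingAlgebra ℂ L₀) where
  parity := LinearMap.id
  parity_parity _ := rfl
  parity_one := rfl
  parity_mul _ _ := rfl

/-- The counit `U(L₀) → ℂ`, vanishing on `L₀`. -/
def envelopingCounit : UniversalEnvelopingAlgebra ℂ L₀ →ₐ[ℂ] ℂ :=
  UniversalEnvelopingAlgebra.lift ℂ 0

end Enveloping

/-! ### The Lie superalgebra `osp(3|2)` -/

namespace OSP32

/-- Matrices of linear maps of the superspace `ℂ^{3|2}`. -/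
abbrev Mat : Type := Matrix (Fin 3 ⊕ Fin 2) (Fin 3 ⊕ Fin 2) ℂ

/-- The parity `diag(1, 1, 1, -1, -1)` of `ℂ^{3|2}`. -/
def γ : Mat := Matrix.fromBlocks 1 0 0 (-1)

/-- The matrix of the form `b` on `ℂ^{3|2}`, which is symmetric on `ℂ³`, skew-symmetric on `ℂ²`, and
for which `ℂ³` and `ℂ²` are orthogonal. -/
def H : Mat := Matrix.fromBlocks 1 0 0 !![0, 1; -1, 0]

theorem γ_mul_γ : γ * γ = 1 := by simp [γ, Matrix.fromBlocks_multiply]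

theorem γ_mul_H : γ * H = H * γ := by simp [γ, H, Matrix.fromBlocks_multiply]

theorem H_mul_H : H * H = γ := by
  have : (!![0, 1; -1, 0] : Matrix (Fin 2) (Fin 2) ℂ) * !![0, 1; -1, 0] = -1 := by
    ext i j; fin_cases i <;> fin_cases j <;> simp
  simp [γ, H, Matrix.fromBlocks_multiply, this]

/-- The even part `so(3) ⊕ sp(2)` of `osp(3|2)`: the even `X` (commuting with the parity) with
`b(X v, w) + b(v, X w) = 0`. -/
def even : LieSubalgebra ℂ Mat where
  carrier := {X | γ * X = X * γ ∧ X.transpose * H + H * X = 0}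
  zero_mem' := by simp
  add_mem' := by
    rintro X Y ⟨h1, h2⟩ ⟨h3, h4⟩
    refine ⟨by rw [mul_add, add_mul, h1, h3], ?_⟩
    rw [Matrix.transpose_add, add_mul, mul_add, add_add_add_comm, h2, h4, add_zero]
  smul_mem' := by
    rintro c X ⟨h1, h2⟩
    refine ⟨by simp [h1], ?_⟩
    rw [Matrix.transpose_smul, Matrix.smul_mul, Matrix.mul_smul, ← smul_add, h2, smul_zero]
  lie_mem' := by
    rintro X Y ⟨h1, h2⟩ ⟨h3, h4⟩
    rw [add_eq_zero_iff_eq_neg] at h2 h4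
    refine ⟨?_, ?_⟩
    · rw [LieRing.of_associative_ring_bracket, mul_sub, sub_mul, ← mul_assoc, ← mul_assoc, h1, h3,
        mul_assoc, mul_assoc, h1, h3, mul_assoc, mul_assoc]
    · rw [LieRing.of_associative_ring_bracket, Matrix.transpose_sub, Matrix.transpose_mul,
        Matrix.transpose_mul, sub_mul, mul_assoc, mul_assoc, h2, h4, mul_neg, mul_neg, ← mul_assoc,
        ← mul_assoc, h2, h4]
      noncomm_ring

/-- The odd part of `osp(3|2)`: the odd `X` (anticommuting with the parity) with
`b(X v, w) + (-1)^[v] b(v, X w) = 0`. -/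
def odd : Submodule ℂ Mat where
  carrier := {X | γ * X = -(X * γ) ∧ X.transpose * H + γ * H * X = 0}
  zero_mem' := by simp
  add_mem' := by
    rintro X Y ⟨h1, h2⟩ ⟨h3, h4⟩
    refine ⟨by rw [mul_add, add_mul, h1, h3, neg_add], ?_⟩
    rw [Matrix.transpose_add, add_mul, mul_add, add_add_add_comm, h2, h4, add_zero]
  smul_mem' := by
    rintro c X ⟨h1, h2⟩
    refine ⟨by simp [h1], ?_⟩
    rw [Matrix.transpose_smul, Matrix.smul_mul, Matrix.mul_smul, ← smul_add, h2, smul_zero]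

theorem lie_mem_odd {X Y : Mat} (hX : X ∈ even) (hY : Y ∈ odd) : X * Y - Y * X ∈ odd := by
  obtain ⟨h1, h2⟩ := hX
  obtain ⟨h3, h4⟩ := hY
  rw [add_eq_zero_iff_eq_neg] at h2 h4
  refine ⟨?_, ?_⟩
  · rw [mul_sub, sub_mul, ← mul_assoc, ← mul_assoc, h1, h3, mul_assoc, neg_mul, mul_assoc, h1, h3]
    noncomm_ring
  · rw [Matrix.transpose_sub, Matrix.transpose_mul, Matrix.transpose_mul, sub_mul, mul_assoc,
      mul_assoc, h2, h4, mul_neg, mul_neg, ← mul_assoc, ← mul_assoc, h4]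
    have h5 : X.transpose * (γ * H) = -(γ * H * X) := by
      rw [γ_mul_H, ← mul_assoc, h2, neg_mul, mul_assoc, mul_assoc, h1]
    rw [h5]
    noncomm_ring

theorem anticomm_mem_even {X Y : Mat} (hX : X ∈ odd) (hY : Y ∈ odd) : X * Y + Y * X ∈ even := by
  obtain ⟨h1, h2⟩ := hX
  obtain ⟨h3, h4⟩ := hY
  rw [add_eq_zero_iff_eq_neg] at h2 h4
  have key : ∀ {X Y : Mat}, γ * Y = -(Y * γ) → X.transpose * H = -(γ * H * X) →
      Y.transpose * H = -(γ * H * Y) → Y.transpose * (X.transpose * H) = -(H * Y * X) := by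
    intro X Y h3 h2 h4
    rw [h2, γ_mul_H, mul_neg, ← mul_assoc, ← mul_assoc, h4]
    have h5 : γ * H * Y * γ = -(H * Y) := by
      rw [γ_mul_H, mul_assoc, mul_assoc, ← neg_eq_iff_eq_neg.2 h3, mul_neg, ← mul_assoc γ, γ_mul_γ,
        one_mul, mul_neg]
    rw [neg_mul, h5]
    noncomm_ring
  refine ⟨?_, ?_⟩
  · rw [mul_add, add_mul, ← mul_assoc, ← mul_assoc, h1, h3, neg_mul, mul_assoc, neg_mul, mul_assoc,
      h1, h3]
    noncomm_ring
  · rw [Matrix.transpose_add, Matrix.transpose_mul, Matrix.transpose_mul, add_mul, mul_assoc,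
      mul_assoc, key h3 h2 h4, key h1 h4 h2]
    noncomm_ring

/-- The even elements act on the odd ones by the commutator. -/
instance : LieRingModule even odd where
  bracket X Y := ⟨X.1 * Y.1 - Y.1 * X.1, lie_mem_odd X.2 Y.2⟩
  add_lie X Y Z := Subtype.ext (by
    change (X.1 + Y.1) * Z.1 - Z.1 * (X.1 + Y.1) = _ + _
    noncomm_ring)
  lie_add X Y Z := Subtype.ext (by
    change X.1 * (Y.1 + Z.1) - (Y.1 + Z.1) * X.1 = _ + _
    noncomm_ring)
  leibniz_lie X Y Z := Subtype.ext (by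
    change X.1 * (Y.1 * Z.1 - Z.1 * Y.1) - (Y.1 * Z.1 - Z.1 * Y.1) * X.1 =
      ((X.1 * Y.1 - Y.1 * X.1) * Z.1 - Z.1 * (X.1 * Y.1 - Y.1 * X.1)) +
        (Y.1 * (X.1 * Z.1 - Z.1 * X.1) - (X.1 * Z.1 - Z.1 * X.1) * Y.1)
    noncomm_ring)

instance : LieModule ℂ even odd where
  smul_lie c X Y := Subtype.ext (by
    change (c • X.1) * Y.1 - Y.1 * (c • X.1) = c • (X.1 * Y.1 - Y.1 * X.1)
    rw [smul_mul_assoc, mul_smul_comm, smul_sub])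
  lie_smul c X Y := Subtype.ext (by
    change X.1 * (c • Y.1) - (c • Y.1) * X.1 = c • (X.1 * Y.1 - Y.1 * X.1)
    rw [smul_mul_assoc, mul_smul_comm, smul_sub])

/-- The Lie superalgebra `osp(3|2)`; the bracket of two odd elements is the anticommutator. -/
instance : LieSuperalgebra even odd where
  oddBracket := LinearMap.mk₂ ℂ (fun X Y => ⟨X.1 * Y.1 + Y.1 * X.1, anticomm_mem_even X.2 Y.2⟩)
    (fun X Y Z => Subtype.ext (by
      change (X.1 + Y.1) * Z.1 + Z.1 * (X.1 + Y.1) = _ + _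
      noncomm_ring))
    (fun c X Y => Subtype.ext (by
      change (c • X.1) * Y.1 + Y.1 * (c • X.1) = c • (X.1 * Y.1 + Y.1 * X.1)
      rw [smul_mul_assoc, mul_smul_comm, smul_add]))
    (fun X Y Z => Subtype.ext (by
      change X.1 * (Y.1 + Z.1) + (Y.1 + Z.1) * X.1 = _ + _
      noncomm_ring))
    (fun c X Y => Subtype.ext (by
      change X.1 * (c • Y.1) + (c • Y.1) * X.1 = c • (X.1 * Y.1 + Y.1 * X.1)
      rw [smul_mul_assoc, mul_smul_comm, smul_add]))
  oddBracket_comm X Y := Subtype.ext (add_comm _ _)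
  lie_oddBracket X Y Z := Subtype.ext (by
    change X.1 * (Y.1 * Z.1 + Z.1 * Y.1) - (Y.1 * Z.1 + Z.1 * Y.1) * X.1 =
      ((X.1 * Y.1 - Y.1 * X.1) * Z.1 + Z.1 * (X.1 * Y.1 - Y.1 * X.1)) +
        (Y.1 * (X.1 * Z.1 - Z.1 * X.1) + (X.1 * Z.1 - Z.1 * X.1) * Y.1)
    noncomm_ring)
  jacobi X Y Z := Subtype.ext (by
    change ((X.1 * Y.1 + Y.1 * X.1) * Z.1 - Z.1 * (X.1 * Y.1 + Y.1 * X.1)) +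
      ((Y.1 * Z.1 + Z.1 * Y.1) * X.1 - X.1 * (Y.1 * Z.1 + Z.1 * Y.1)) +
      ((Z.1 * X.1 + X.1 * Z.1) * Y.1 - Y.1 * (Z.1 * X.1 + X.1 * Z.1)) = 0
    noncomm_ring)

/-- The enveloping algebra `U(osp(3|2))`. -/
abbrev U : Type := SuperEnveloping even odd

/-- The enveloping algebra of the even part of `osp(3|2)`. -/
abbrev U₀ : Type := UniversalEnvelopingAlgebra ℂ even

/-! #### The quadratic Casimir element -/

/-- The bilinear form `(X, Y) ↦ ½ str(X Y)`, where `str X = tr(γ X)`. -/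
def halfStr : LinearMap.BilinForm ℂ Mat :=
  LinearMap.mk₂ ℂ (fun X Y => 2⁻¹ * (γ * (X * Y)).trace)
    (fun X Y Z => by rw [add_mul, mul_add, Matrix.trace_add, mul_add])
    (fun c X Y => by simp; ring)
    (fun X Y Z => by rw [mul_add, mul_add, Matrix.trace_add, mul_add])
    (fun c X Y => by simp; ring)

/-- The restriction of `½ str(X Y)` to the even part of `osp(3|2)`. -/
def formEven : LinearMap.BilinForm ℂ even := halfStr.restrict even.toSubmodule

/-- The restriction of `½ str(X Y)` to the odd part of `osp(3|2)`. -/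
def formOdd : LinearMap.BilinForm ℂ odd := halfStr.restrict odd

theorem γ_conjTranspose : γ.conjTranspose = γ := by
  simp [γ, Matrix.fromBlocks_conjTranspose]

theorem γ_transpose : γ.transpose = γ := by
  simp [γ, Matrix.fromBlocks_transpose]

theorem H_conjTranspose : H.conjTranspose = γ * H := by
  ext i j
  rcases i with i | i <;> rcases j with j | j <;> fin_cases i <;> fin_cases j <;>
    simp [γ, H, Matrix.fromBlocks_multiply]

theorem H_mul_γ_mul_H_mul (Z : Mat) : H * (γ * H * Z) = Z := by
  rw [γ_mul_H, ← mul_assoc, ← mul_assoc, H_mul_H, γ_mul_γ, one_mul]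

theorem conjTranspose_mul_γ_mem_even {X : Mat} (hX : X ∈ even) : X.conjTranspose * γ ∈ even := by
  obtain ⟨h1, h2⟩ := hX
  have h3 : X.conjTranspose * γ = γ * X.conjTranspose := by
    have := congrArg Matrix.conjTranspose h1
    rwa [Matrix.conjTranspose_mul, Matrix.conjTranspose_mul, γ_conjTranspose] at this
  have h4 : γ * H * X.transpose.conjTranspose = -(X.conjTranspose * (γ * H)) := by
    have := congrArg Matrix.conjTranspose (add_eq_zero_iff_eq_neg.1 h2)
    rwa [Matrix.conjTranspose_mul, Matrix.conjTranspose_neg, Matrix.conjTranspose_mul,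
      H_conjTranspose] at this
  refine ⟨by rw [h3, mul_assoc, h3], ?_⟩
  rw [Matrix.transpose_mul, γ_transpose]
  change γ * X.transpose.conjTranspose * H + _ = 0
  rw [← H_mul_γ_mul_H_mul X.transpose.conjTranspose, h4, mul_assoc, mul_neg, neg_mul, mul_assoc H,
    mul_assoc X.conjTranspose, mul_assoc γ H H, H_mul_H, γ_mul_γ, mul_one, mul_neg, ← mul_assoc,
    γ_mul_H, mul_assoc, ← h3, neg_add_cancel]

theorem conjTranspose_mul_γ_mem_odd {X : Mat} (hX : X ∈ odd) : X.conjTranspose * γ ∈ odd := by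
  obtain ⟨h1, h2⟩ := hX
  have h3 : X.conjTranspose * γ = -(γ * X.conjTranspose) := by
    have := congrArg Matrix.conjTranspose h1
    rwa [Matrix.conjTranspose_mul, Matrix.conjTranspose_neg, Matrix.conjTranspose_mul,
      γ_conjTranspose] at this
  have h4 : γ * H * X.transpose.conjTranspose = -(X.conjTranspose * H) := by
    have := congrArg Matrix.conjTranspose (add_eq_zero_iff_eq_neg.1 h2)
    rwa [Matrix.conjTranspose_mul, Matrix.conjTranspose_neg, Matrix.conjTranspose_mul,
      Matrix.conjTranspose_mul, H_conjTranspose, γ_conjTranspose, γ_mul_H, mul_assoc H γ γ, γ_mul_γ,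
      mul_one, ← γ_mul_H] at this
  refine ⟨by rw [h3, neg_mul, neg_neg, mul_neg, mul_assoc, h3, mul_neg], ?_⟩
  rw [Matrix.transpose_mul, γ_transpose]
  change γ * X.transpose.conjTranspose * H + _ = 0
  rw [← H_mul_γ_mul_H_mul X.transpose.conjTranspose, h4, mul_assoc, mul_neg, neg_mul, mul_assoc H,
    mul_assoc X.conjTranspose, H_mul_H, mul_neg, ← mul_assoc, neg_add_cancel]

theorem trace_γ_mul_mul_γ (X : Mat) :
    (γ * (X * (X.conjTranspose * γ))).trace = (X * X.conjTranspose).trace := by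
  rw [Matrix.trace_mul_comm, ← mul_assoc, mul_assoc, γ_mul_γ, mul_one]

open scoped ComplexOrder in
theorem formEven_nondegenerate : formEven.Nondegenerate := by
  constructor
  · intro X hX
    have h : (2⁻¹ : ℂ) * (γ * (X.1 * (X.1.conjTranspose * γ))).trace = 0 :=
      hX ⟨_, conjTranspose_mul_γ_mem_even X.2⟩
    rw [trace_γ_mul_mul_γ] at h
    exact Subtype.ext (Matrix.trace_mul_conjTranspose_self_eq_zero_iff.1 (by simpa using h))
  · intro X hX
    have h : (2⁻¹ : ℂ) * (γ * (X.1.conjTranspose * γ * X.1)).trace = 0 :=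
      hX ⟨_, conjTranspose_mul_γ_mem_even X.2⟩
    have h1 : γ * X.1 = X.1 * γ := X.2.1
    rw [mul_assoc, h1, Matrix.trace_mul_comm, mul_assoc, mul_assoc, γ_mul_γ, mul_one] at h
    exact Subtype.ext (Matrix.trace_conjTranspose_mul_self_eq_zero_iff.1 (by simpa using h))

open scoped ComplexOrder in
theorem formOdd_nondegenerate : formOdd.Nondegenerate := by
  constructor
  · intro X hX
    have h : (2⁻¹ : ℂ) * (γ * (X.1 * (X.1.conjTranspose * γ))).trace = 0 :=
      hX ⟨_, conjTranspose_mul_γ_mem_odd X.2⟩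
    rw [trace_γ_mul_mul_γ] at h
    exact Subtype.ext (Matrix.trace_mul_conjTranspose_self_eq_zero_iff.1 (by simpa using h))
  · intro X hX
    have h : (2⁻¹ : ℂ) * (γ * (X.1.conjTranspose * γ * X.1)).trace = 0 :=
      hX ⟨_, conjTranspose_mul_γ_mem_odd X.2⟩
    have h1 : γ * X.1 = -(X.1 * γ) := X.2.1
    rw [mul_assoc, h1, Matrix.trace_mul_comm, mul_neg, neg_mul, mul_assoc, mul_assoc, γ_mul_γ,
      mul_one] at h
    exact Subtype.ext (Matrix.trace_conjTranspose_mul_self_eq_zero_iff.1 (by simpa using h))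

/-- The quadratic Casimir element `C = ∑ bᵢ bⁱ` of `U(osp(3|2))`, where `(bᵢ)` is a homogeneous basis
of `osp(3|2)` and `(bⁱ)` its dual basis, `½ str(bⁱ bⱼ) = δᵢⱼ`; it does not depend on the basis. -/
def casimir : U :=
  (∑ i, SuperEnveloping.ι₀ even odd (Module.finBasis ℂ even i) *
      SuperEnveloping.ι₀ even odd
        (formEven.dualBasis formEven_nondegenerate (Module.finBasis ℂ even) i)) +
    ∑ i, SuperEnveloping.ι₁ even odd (Module.finBasis ℂ odd i) *
      SuperEnveloping.ι₁ even odd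
        (formOdd.dualBasis formOdd_nondegenerate (Module.finBasis ℂ odd) i)

/-- The element `z = C (C - 2) (C + 6)`. -/
def z : U := casimir * (casimir - 2) * (casimir + 6)

/-- The left ideal `J = U(g) g₀`. -/
def J : Ideal U := SuperEnveloping.evenLeftIdeal even odd

/-- The left `U(g)`-module `W = U(g) / U(g) g₀`. -/
abbrev W : Type := U ⧸ J

/-- The counit of `U(g)`. -/
def ε : U →ₐ[ℂ] ℂ := SuperEnveloping.counit even odd

/-- The unit element of the Hopf superalgebra `U(g)°`, i.e. the counit of `U(g)`. -/
def unit : finiteDual U := finiteDual.ofChar ε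

/-- The unit element of the Hopf algebra `U(g₀)°`, i.e. the counit of `U(g₀)`. -/
def unit₀ : finiteDual U₀ := finiteDual.ofChar (envelopingCounit even)

/-- The restriction map `P : U(g)° → U(g₀)°`. -/
def P : finiteDual U →ₗ[ℂ] finiteDual U₀ := finiteDual.map (SuperEnveloping.ofEven even odd)

end OSP32

end

/-! The integral is an evaluation. An element `a` of the finite dual of U(g) vanishes on a two-sided
ideal I of finite codimension. As g₀ = so(3) ⊕ sp(2) consists of two commuting copies of sl₂, there
is an element p of U(g₀) with counit 1 such that g₀p and pg₀ lie in I: a product of polynomials in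
the two sl₂ Casimir elements (`exists_slTwo_projector`, `exists_projector`). What makes this work is
that sl₂ acts trivially on a finite-dimensional space on which its Casimir operator is nilpotent. A
normalized left integral on U(g₀)° has to be a ↦ a(p) on forms killing the corresponding ideal
(`integral_eq_apply`). One exists because the counit is not in the span of the translates by g₀
(`unit₀_notMem_translates`). Hence ∫ a = a(zp) (`exists_liftedIntegral_eq`).

Left invariance amounts to xzp ≡ ε(x)zp modulo I. It follows from xz - ε(x)z ∈ J = U(g)g₀
(`mul_z_sub_mem`) and Jp ⊆ I. Right invariance is the mirror image: an anti-automorphism fixes z and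
carries J to g₀U(g), so pzx ≡ ε(x)pz (`mul_z_mul_sub_mem`), and zp = pz since z is central.

That C is central and that the odd generators kill the class of z in W are checked by normally
ordering words in an integral basis, in the kernel. Only the soundness of the rewriting
(`evalList_act`) is used, not the linear independence of ordered words.

That z is non-zero modulo J is seen in a representation: U(g) acts by super commutators on the
endomorphisms of the adjoint representation. The g₀-invariant vector v = `isotypicEnd` satisfies Cv
= -48·id and C·id = 0. It is a generalized eigenvector of C for the eigenvalue 0 that C does not
kill, and z has only a simple zero there, so zv = 6·(-2)·(-48)·id = 576·id ≠ 0. Matrix coefficients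
of the same representation show that the integral is non-zero. -/

noncomputable section

open SuperSpace

/-! ### `sl₂`-triples acting on finite-dimensional spaces -/

section SlTwo

open Module Polynomial

/-- The minimal polynomial factors as `X ^ n * q` with `q(0) ≠ 0`. -/
theorem exists_minpoly_eq_X_pow_mul {V : Type*} [AddCommGroup V] [Module ℂ V]
    [FiniteDimensional ℂ V] (c : End ℂ V) :
    ∃ (n : ℕ) (q : ℂ[X]), minpoly ℂ c = X ^ n * q ∧ q.eval 0 ≠ 0 := by
  obtain ⟨q, hq, hq'⟩ := exists_eq_pow_rootMultiplicity_mul_and_not_dvd (minpoly ℂ c)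
    (minpoly.ne_zero (Algebra.IsIntegral.isIntegral c)) 0
  refine ⟨_, q, by simpa using hq, fun h => hq' ?_⟩
  rwa [dvd_iff_isRoot]

/-- The cofactor q of the power of X in the minimal polynomial can only have the root 0, which is
excluded, so q is a non-zero constant. -/
theorem isNilpotent_of_hasEigenvalue_eq_zero {V : Type*} [AddCommGroup V] [Module ℂ V]
    [FiniteDimensional ℂ V] (h : End ℂ V) (hh : ∀ μ, h.HasEigenvalue μ → μ = 0) :
    IsNilpotent h := by
  obtain ⟨n, q, hq, hq0⟩ := exists_minpoly_eq_X_pow_mul h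
  have hdeg : q.degree = 0 := by
    by_contra hd
    obtain ⟨μ, hμ⟩ := IsAlgClosed.exists_root q hd
    have : μ = 0 := hh μ (End.hasEigenvalue_iff_isRoot.2 (by
      rw [hq, IsRoot.def, eval_mul, hμ.eq_zero, mul_zero]))
    rw [this] at hμ
    exact hq0 hμ
  rw [eq_C_of_degree_eq_zero hdeg] at hq hq0
  have h0 : q.coeff 0 ≠ 0 := by simpa using hq0
  refine ⟨n, ?_⟩
  have := minpoly.aeval ℂ h
  rw [hq, map_mul, map_pow, aeval_X, aeval_C, ← Algebra.commutes, ← Algebra.smul_def] at this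
  exact (smul_eq_zero.1 this).resolve_left h0

/-- If `[h, e] = c e` with `c ≠ 0` and `h` is nilpotent, then `e = 0`. -/
theorem eq_zero_of_lie_eq_smul {A : Type*} [Ring A] [Algebra ℂ A] {h e : A} (hn : IsNilpotent h)
    {c : ℂ} (hc : c ≠ 0) (hhe : h * e - e * h = c • e) : e = 0 := by
  obtain ⟨k, hk⟩ := LieAlgebra.ad_nilpotent_of_nilpotent (R := ℂ) hn
  have h1 : ∀ k : ℕ, ((LieAlgebra.ad ℂ A h) ^ k) e = c ^ k • e := by
    intro k
    induction k with
    | zero => simp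
    | succ k ih =>
      rw [pow_succ, End.mul_apply, LieAlgebra.ad_apply, LieRing.of_associative_ring_bracket, hhe,
        map_smul, ih, smul_smul, pow_succ']
  have := h1 k
  rw [hk, LinearMap.zero_apply, eq_comm] at this
  exact (smul_eq_zero.1 this).resolve_left (pow_ne_zero _ hc)

/-- From an eigenvector of `h`, the operator `e` leads to a primitive vector. -/
theorem exists_primitive_of_hasEigenvalue {V : Type*} [AddCommGroup V] [Module ℂ V]
    [FiniteDimensional ℂ V] {h e : End ℂ V} (hhe : h * e - e * h = 2 • e) {μ : ℂ}
    (hμ : h.HasEigenvalue μ) :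
    ∃ (k : ℕ) (w : V), w ≠ 0 ∧ h w = (μ + 2 * k) • w ∧ e w = 0 := by
  obtain ⟨v, hv, hv0⟩ := hμ.exists_hasEigenvector
  rw [End.mem_eigenspace_iff] at hv
  have hk : ∀ k : ℕ, h ((e ^ k) v) = (μ + 2 * k) • (e ^ k) v := by
    intro k
    induction k with
    | zero => simp [hv]
    | succ k ih =>
      have := LinearMap.congr_fun hhe ((e ^ k) v)
      simp only [LinearMap.sub_apply, End.mul_apply, LinearMap.smul_apply, ih, map_smul,
        sub_eq_iff_eq_add] at this
      rw [pow_succ', End.mul_apply, this, ← Nat.cast_smul_eq_nsmul ℂ, ← add_smul]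
      congr 1
      push_cast
      ring
  -- Otherwise all the distinct numbers μ + 2k would be eigenvalues of `h`.
  have hex : ∃ k : ℕ, (e ^ k) v = 0 := by
    by_contra! hne
    refine Set.infinite_of_injective_forall_mem (f := fun k : ℕ => μ + 2 * (k : ℂ)) ?_ (fun k => ?_)
      (End.finite_hasEigenvalue h)
    · intro a b hab
      simpa using hab
    · exact End.hasEigenvalue_of_hasEigenvector ⟨End.mem_eigenspace_iff.2 (hk k), hne k⟩
  obtain ⟨k, hk1, hk2⟩ := Nat.exists_not_and_succ_of_not_zero_of_exists (by simpa using hv0) hex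
  exact ⟨k, (e ^ k) v, hk1, hk k, by rwa [pow_succ', End.mul_apply] at hk2⟩

/-- If the Casimir operator of an `sl₂`-triple acts nilpotently, all eigenvalues of `h` are
non-positive even integers. -/
theorem exists_eq_neg_of_hasEigenvalue {V : Type*} [AddCommGroup V] [Module ℂ V]
    [FiniteDimensional ℂ V] {h e f : End ℂ V} (hef : e * f - f * e = h)
    (hhe : h * e - e * h = 2 • e) (hhf : h * f - f * h = -(2 • f))
    (hc : IsNilpotent (h * h + 2 • h + 4 • (f * e))) {μ : ℂ} (hμ : h.HasEigenvalue μ) :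
    ∃ k : ℕ, μ = -(2 * (k : ℂ)) := by
  obtain ⟨k, w, hw, hhw, hew⟩ := exists_primitive_of_hasEigenvalue hhe hμ
  refine ⟨k, eq_neg_of_add_eq_zero_left ?_⟩
  -- `IsSl2Triple` includes the condition `h ≠ 0`, so the trivial case is treated separately.
  by_cases h0 : h = 0
  · rw [h0, LinearMap.zero_apply, eq_comm] at hhw
    exact (smul_eq_zero.1 hhw).resolve_right hw
  have t : IsSl2Triple h e f := ⟨h0, hef, hhe, hhf⟩
  have hp : t.HasPrimitiveVectorWith w (μ + 2 * k) := ⟨hw, hhw, hew⟩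
  obtain ⟨n, hn⟩ := hp.exists_nat
  rw [hn] at hhw ⊢
  -- On a primitive vector of weight n the Casimir operator is the scalar n(n + 2); nilpotency
  -- forces n = 0.
  obtain ⟨m, hm⟩ := hc
  have hcw : ∀ m : ℕ, ((h * h + 2 • h + 4 • (f * e)) ^ m) w = ((n : ℂ) * (n + 2)) ^ m • w := by
    intro m
    induction m with
    | zero => simp
    | succ m ih =>
      rw [pow_succ', End.mul_apply, ih]
      simp only [map_smul, LinearMap.add_apply, LinearMap.smul_apply, End.mul_apply, hhw, hew,
        map_zero, smul_zero, add_zero, ← Nat.cast_smul_eq_nsmul ℂ, smul_smul, ← add_smul]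
      congr 1
      push_cast
      ring
  have := hcw m
  rw [hm, LinearMap.zero_apply, eq_comm] at this
  have h1 := eq_zero_of_pow_eq_zero ((smul_eq_zero.1 this).resolve_right hw)
  rcases mul_eq_zero.1 h1 with h2 | h2
  · exact h2
  · exact absurd h2 (by exact_mod_cast Nat.succ_ne_zero (n + 1))

/-- An `sl₂`-triple whose Casimir operator is nilpotent acts trivially. -/
theorem slTwo_eq_zero_of_isNilpotent_casimir {V : Type*} [AddCommGroup V] [Module ℂ V]
    [FiniteDimensional ℂ V] {h e f : End ℂ V} (hef : e * f - f * e = h)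
    (hhe : h * e - e * h = 2 • e) (hhf : h * f - f * h = -(2 • f))
    (hc : IsNilpotent (h * h + 2 • h + 4 • (f * e))) : h = 0 ∧ e = 0 ∧ f = 0 := by
  have hn : IsNilpotent h := by
    refine isNilpotent_of_hasEigenvalue_eq_zero h fun μ hμ => ?_
    obtain ⟨k, hk⟩ := exists_eq_neg_of_hasEigenvalue hef hhe hhf hc hμ
    -- The triple (-h, f, e) has the same Casimir operator. Applying the previous result to both
    -- triples, μ and -μ are both non-positive, hence μ = 0.
    have hc' : (-h) * (-h) + 2 • (-h) + 4 • (e * f) = h * h + 2 • h + 4 • (f * e) := by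
      rw [sub_eq_iff_eq_add.1 hef]
      simp only [neg_mul_neg, smul_add, smul_neg]
      module
    obtain ⟨l, hl⟩ := exists_eq_neg_of_hasEigenvalue (h := -h) (e := f) (f := e) (μ := -μ)
      (by rw [← hef]; abel) (by rw [← neg_neg (2 • f), ← hhf, neg_mul, mul_neg]; abel)
      (by rw [neg_mul, mul_neg, ← hhe]; abel) (hc' ▸ hc) (by
        obtain ⟨v, hv, hv0⟩ := hμ.exists_hasEigenvector
        rw [End.mem_eigenspace_iff] at hv
        exact End.hasEigenvalue_of_hasEigenvector (x := v)
          ⟨End.mem_eigenspace_iff.2 (by rw [LinearMap.neg_apply, hv, neg_smul]), hv0⟩)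
    rw [hk, neg_neg] at hl
    have : (2 * k + 2 * l : ℕ) = 0 := by
      have : ((2 * k + 2 * l : ℕ) : ℂ) = 0 := by push_cast; rw [hl]; ring
      exact_mod_cast this
    have hk0 : k = 0 := by omega
    simpa [hk0] using hk
  have he : e = 0 := eq_zero_of_lie_eq_smul (c := 2) hn two_ne_zero (by
    rw [hhe, ← Nat.cast_smul_eq_nsmul ℂ]; rfl)
  refine ⟨?_, he, ?_⟩
  · rw [← hef, he]; simp
  · refine eq_zero_of_lie_eq_smul (c := -2) hn (by norm_num) ?_
    rw [hhf, neg_smul, ← Nat.cast_smul_eq_nsmul ℂ]; rfl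

variable {A : Type*} [Ring A] [Algebra ℂ A]

/-- The Casimir element of an `sl₂`-triple. -/
def slTwoCasimir {A : Type*} [Ring A] (h e f : A) : A := h * h + 2 • h + 4 • (f * e)

/-- All words are brought to the order f, e, h by the three relations; the primed versions apply
them in front of a further factor. -/
theorem slTwoCasimir_commute {A : Type*} [Ring A] {h e f : A} (hef : e * f - f * e = h)
    (hhe : h * e - e * h = 2 • e) (hhf : h * f - f * h = -(2 • f)) :
    Commute (slTwoCasimir h e f) h ∧ Commute (slTwoCasimir h e f) e ∧
      Commute (slTwoCasimir h e f) f := by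
  have h1 : h * e = e * h + 2 • e := by rw [← hhe]; abel
  have h2 : h * f = f * h - 2 • f := by rw [sub_eq_add_neg, ← hhf]; abel
  have h3 : e * f = f * e + h := by rw [← hef]; abel
  have h1' : ∀ x, h * (e * x) = e * (h * x) + 2 • (e * x) := fun x => by
    rw [← mul_assoc, h1]; noncomm_ring
  have h2' : ∀ x, h * (f * x) = f * (h * x) - 2 • (f * x) := fun x => by
    rw [← mul_assoc, h2]; noncomm_ring
  have h3' : ∀ x, e * (f * x) = f * (e * x) + h * x := fun x => by
    rw [← mul_assoc, h3]; noncomm_ring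
  refine ⟨?_, ?_, ?_⟩
  all_goals
    simp only [Commute, SemiconjBy, slTwoCasimir, mul_add, add_mul, mul_assoc, smul_mul_assoc,
      mul_smul_comm, h1, h2, h3, h1', h2', h3', mul_sub, smul_add, smul_sub]
    abel

theorem Commute.aeval_left {c y : A} (hy : Commute c y) (g : ℂ[X]) : Commute (aeval c g) y := by
  induction g using Polynomial.induction_on' with
  | add p q hp hq => rw [map_add]; exact hp.add_left hq
  | monomial n a =>
    rw [aeval_monomial]
    exact Commute.mul_left (Algebra.commutes a y) (hy.pow_left n)

/-- Modulo a two-sided ideal of finite codimension, there is a polynomial in the Casimir element of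
an `sl₂`-triple which projects onto the invariants. -/
theorem exists_slTwo_projector (I : Ideal A) [I.IsTwoSided] [FiniteDimensional ℂ (A ⧸ I)]
    {h e f : A} (hef : e * f - f * e = h) (hhe : h * e - e * h = 2 • e)
    (hhf : h * f - f * h = -(2 • f)) :
    ∃ g : ℂ[X], g.eval 0 = 1 ∧ h * aeval (slTwoCasimir h e f) g ∈ I ∧
      e * aeval (slTwoCasimir h e f) g ∈ I ∧ f * aeval (slTwoCasimir h e f) g ∈ I := by
  set c := slTwoCasimir h e f with hcdef
  obtain ⟨hch, hce, hcf⟩ := slTwoCasimir_commute hef hhe hhf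
  rw [← hcdef] at hch hce hcf
  -- The representation used is left multiplication on A/I. The generalized 0-eigenspace N of c is
  -- stable under the triple because c commutes with it, and the triple acts on N by zero.
  let ρ : A →ₐ[ℂ] End ℂ (A ⧸ I) := (Algebra.lmul ℂ (A ⧸ I)).comp (Ideal.Quotient.mkₐ ℂ I)
  have hρ : ∀ x y : A, ρ x (Ideal.Quotient.mk I y) = Ideal.Quotient.mk I (x * y) := fun x y => rfl
  obtain ⟨n, q, hq, hq0⟩ := exists_minpoly_eq_X_pow_mul (ρ c)
  let N := LinearMap.ker (ρ c ^ n)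
  have hN : ∀ x, Commute c x → ∀ v ∈ N, ρ x v ∈ N := by
    intro x hx v hv
    have : ρ c ^ n * ρ x = ρ x * ρ c ^ n := by
      rw [← map_pow, ← map_mul, ← map_mul, (hx.pow_left n).eq]
    rw [LinearMap.mem_ker] at hv ⊢
    rw [← End.mul_apply, this, End.mul_apply, hv, map_zero]
  let h' : End ℂ N := (ρ h).restrict (hN h hch)
  let e' : End ℂ N := (ρ e).restrict (hN e hce)
  let f' : End ℂ N := (ρ f).restrict (hN f hcf)
  have key : h' = 0 ∧ e' = 0 ∧ f' = 0 := by
    refine slTwo_eq_zero_of_isNilpotent_casimir ?_ ?_ ?_ ⟨n, ?_⟩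
    · ext v
      have := LinearMap.congr_fun (congrArg ρ hef) v.1
      rw [map_sub, map_mul, map_mul] at this
      exact this
    · ext v
      have := LinearMap.congr_fun (congrArg ρ hhe) v.1
      rw [map_sub, map_mul, map_mul, map_nsmul] at this
      exact this
    · ext v
      have := LinearMap.congr_fun (congrArg ρ hhf) v.1
      rw [map_sub, map_mul, map_mul, map_neg, map_nsmul] at this
      exact this
    · have h1 : ∀ v : N, ((h' * h' + 2 • h' + 4 • (f' * e')) v).1 = ρ c v.1 := by
        intro v
        have : ρ c = ρ h * ρ h + 2 • ρ h + 4 • (ρ f * ρ e) := by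
          simp only [hcdef, slTwoCasimir, map_add, map_mul, map_nsmul]
        rw [this]
        rfl
      have h2 : ∀ (k : ℕ) (v : N),
          (((h' * h' + 2 • h' + 4 • (f' * e')) ^ k) v).1 = (ρ c ^ k) v.1 := by
        intro k
        induction k with
        | zero => intro v; rfl
        | succ k ih => intro v; rw [pow_succ, End.mul_apply, ih, h1, pow_succ, End.mul_apply]
      ext v
      rw [h2]
      exact v.2
  -- With X ^ n * q the minimal polynomial of c on A/I, the element q(c) is mapped into N by
  -- construction; dividing by q(0) normalizes the value at 0.
  refine ⟨C (q.eval 0)⁻¹ * q, by rw [eval_mul, eval_C, inv_mul_cancel₀ hq0], ?_⟩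
  have hp : Ideal.Quotient.mk I (aeval c (C (q.eval 0)⁻¹ * q)) ∈ N := by
    rw [LinearMap.mem_ker, ← map_pow, hρ]
    have h1 : ρ (c ^ n * aeval c (C (q.eval 0)⁻¹ * q)) = 0 := by
      have : c ^ n * aeval c (C (q.eval 0)⁻¹ * q) = aeval c (C (q.eval 0)⁻¹ * (X ^ n * q)) := by
        rw [mul_left_comm, map_mul _ (X ^ n), map_pow, aeval_X]
      rw [this, ← hq, ← aeval_algHom_apply, map_mul, minpoly.aeval, mul_zero]
    have := LinearMap.congr_fun h1 (Ideal.Quotient.mk I 1)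
    rwa [hρ, mul_one] at this
  refine ⟨?_, ?_, ?_⟩
  · have := congrArg Subtype.val (LinearMap.congr_fun key.1 ⟨_, hp⟩)
    exact Ideal.Quotient.eq_zero_iff_mem.1 this
  · have := congrArg Subtype.val (LinearMap.congr_fun key.2.1 ⟨_, hp⟩)
    exact Ideal.Quotient.eq_zero_iff_mem.1 this
  · have := congrArg Subtype.val (LinearMap.congr_fun key.2.2 ⟨_, hp⟩)
    exact Ideal.Quotient.eq_zero_iff_mem.1 this

/-- For two commuting `sl₂`-triples there is, modulo a two-sided ideal of finite codimension, a
projector onto the invariants on which every character takes the value `1`. -/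
theorem exists_slTwo_sq_projector (ε : A →ₐ[ℂ] ℂ) (I : Ideal A) [I.IsTwoSided]
    [FiniteDimensional ℂ (A ⧸ I)] (t : Fin 2 → Fin 3 → A)
    (hef : ∀ i, t i 1 * t i 2 - t i 2 * t i 1 = t i 0)
    (hhe : ∀ i, t i 0 * t i 1 - t i 1 * t i 0 = 2 • t i 1)
    (hhf : ∀ i, t i 0 * t i 2 - t i 2 * t i 0 = -(2 • t i 2))
    (hcomm : ∀ a b, Commute (t 0 a) (t 1 b)) :
    ∃ p : A, ε p = 1 ∧ ∀ i a, t i a * p ∈ I ∧ p * t i a ∈ I := by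
  have hε : ∀ x y : A, ε (x * y - y * x) = 0 := fun x y => by
    rw [map_sub, map_mul, map_mul, mul_comm, sub_self]
  let c : Fin 2 → A := fun i => slTwoCasimir (t i 0) (t i 1) (t i 2)
  -- A character kills commutators, hence the triples and their Casimir elements; so it sends g(c)
  -- to g(0) = 1.
  have hεc : ∀ i, ε (c i) = 0 := by
    intro i
    have h0 : ε (t i 0) = 0 := by rw [← hef, hε]
    have h1 : ε (t i 1) = 0 := by
      have := hε (t i 0) (t i 1)
      rw [hhe, map_nsmul] at this
      simpa using this
    simp [c, slTwoCasimir, h0, h1]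
  have hc : ∀ i a, Commute (c i) (t i a) := by
    intro i a
    obtain ⟨h1, h2, h3⟩ := slTwoCasimir_commute (hef i) (hhe i) (hhf i)
    fin_cases a
    exacts [h1, h2, h3]
  have hcc : ∀ (i : Fin 2) x, (∀ a, Commute (t i a) x) → Commute (c i) x := fun i x hx =>
    (((hx 0).mul_left (hx 0)).add_left ((hx 0).smul_left 2)).add_left
      (((hx 2).mul_left (hx 1)).smul_left 4)
  have hg : ∀ i, ∃ g : ℂ[X], g.eval 0 = 1 ∧ ∀ a, t i a * aeval (c i) g ∈ I := by
    intro i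
    obtain ⟨g, hg0, h1, h2, h3⟩ := exists_slTwo_projector I (hef i) (hhe i) (hhf i)
    refine ⟨g, hg0, fun a => ?_⟩
    fin_cases a
    exacts [h1, h2, h3]
  choose g hg0 hg using hg
  have hpp : ∀ i j a, Commute (aeval (c i) (g i)) (t j a) := by
    intro i j a
    refine Commute.aeval_left ?_ _
    fin_cases i <;> fin_cases j
    · exact hc 0 a
    · exact hcc 0 _ fun b => hcomm b a
    · exact hcc 1 _ fun b => (hcomm a b).symm
    · exact hc 1 a
  refine ⟨aeval (c 0) (g 0) * aeval (c 1) (g 1), ?_, ?_⟩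
  · rw [map_mul, ← aeval_algHom_apply, ← aeval_algHom_apply, hεc, hεc]
    simp [aeval_def, hg0, eval₂_eq_eval_map]
  · intro i a
    have hcom : Commute (aeval (c 0) (g 0) * aeval (c 1) (g 1)) (t i a) :=
      (hpp 0 i a).mul_left (hpp 1 i a)
    have : t i a * (aeval (c 0) (g 0) * aeval (c 1) (g 1)) ∈ I := by
      fin_cases i
      · rw [← mul_assoc]
        exact Ideal.mul_mem_right _ _ (hg 0 a)
      · rw [← mul_assoc, ← (hpp 0 _ a).eq, mul_assoc]
        exact I.mul_mem_left _ (hg 1 a)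
    exact ⟨this, by rwa [hcom.eq]⟩

end SlTwo

/-! ### Translations on the finite dual and integrals -/

section Translations

variable {A : Type*} [Ring A] [Algebra ℂ A]

namespace finiteDual

/-- The translate `y ↦ a(xy)`. -/
def leftTranslate (x : A) : finiteDual A →ₗ[ℂ] finiteDual A :=
  (Module.Dual.transpose (LinearMap.mulLeft ℂ x)).restrict fun _ ⟨I, hI, hIf, hf⟩ =>
    ⟨I, hI, hIf, fun _ hy => hf _ (I.mul_mem_left x hy)⟩

/-- The translate `y ↦ a(yx)`. -/
def rightTranslate (x : A) : finiteDual A →ₗ[ℂ] finiteDual A :=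
  (Module.Dual.transpose (LinearMap.mulRight ℂ x)).restrict fun _ ⟨I, hI, hIf, hf⟩ =>
    ⟨I, hI, hIf, fun _ hy => hf _ (hI.mul_mem_of_left x hy)⟩

theorem leftTranslate_apply (x : A) (a : finiteDual A) (y : A) :
    (leftTranslate x a).1 y = a.1 (x * y) := rfl

theorem rightTranslate_apply (x : A) (a : finiteDual A) (y : A) :
    (rightTranslate x a).1 y = a.1 (y * x) := rfl

/-- The evaluation at `x` on `A°`. -/
def evalAt (x : A) : Module.Dual ℂ (finiteDual A) :=
  LinearMap.applyₗ x ∘ₗ (finiteDual A).subtype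

theorem comulAux_spec (a : finiteDual A) (x y : A) :
    finiteDual.pairing A (comulAux A a) (x ⊗ₜ y) = a.1 (x * y) :=
  (finiteDual.exists_coproduct a).choose_spec x y

theorem lid_evalAt_apply (t : finiteDual A ⊗[ℂ] finiteDual A) (x y : A) :
    (TensorProduct.lid ℂ _ (TensorProduct.map (evalAt x) LinearMap.id t)).1 y =
      finiteDual.pairing A t (x ⊗ₜ y) := by
  induction t with
  | zero => simp
  | add s t hs ht => simp only [map_add, LinearMap.add_apply, Submodule.coe_add, hs, ht]
  | tmul f g => simp [finiteDual.pairing, evalAt]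

theorem rid_evalAt_apply (t : finiteDual A ⊗[ℂ] finiteDual A) (x y : A) :
    (TensorProduct.rid ℂ _ (TensorProduct.map LinearMap.id (evalAt y) t)).1 x =
      finiteDual.pairing A t (x ⊗ₜ y) := by
  induction t with
  | zero => simp
  | add s t hs ht => simp only [map_add, LinearMap.add_apply, Submodule.coe_add, hs, ht]
  | tmul f g => simp [finiteDual.pairing, evalAt, mul_comm]

/-- Evaluating one tensor factor of the coproduct is a translation. This allows the coproduct to be
eliminated from the notion of an integral. -/
theorem lid_evalAt_comulAux (a : finiteDual A) (x : A) :
    TensorProduct.lid ℂ _ (TensorProduct.map (evalAt x) LinearMap.id (comulAux A a)) =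
      leftTranslate x a :=
  Subtype.ext (LinearMap.ext fun y => by rw [lid_evalAt_apply, comulAux_spec, leftTranslate_apply])

theorem rid_evalAt_comulAux (a : finiteDual A) (y : A) :
    TensorProduct.rid ℂ _ (TensorProduct.map LinearMap.id (evalAt y) (comulAux A a)) =
      rightTranslate y a :=
  Subtype.ext (LinearMap.ext fun x => by rw [rid_evalAt_apply, comulAux_spec, rightTranslate_apply])

theorem rid_map_comulAux_apply (s : Module.Dual ℂ (finiteDual A)) (a : finiteDual A) (x : A) :
    (TensorProduct.rid ℂ _ (TensorProduct.map LinearMap.id s (comulAux A a))).1 x =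
      s (leftTranslate x a) := by
  rw [← lid_evalAt_comulAux]
  generalize comulAux A a = t
  induction t with
  | zero => simp
  | add s t hs ht => simp only [map_add, LinearMap.add_apply, Submodule.coe_add, hs, ht]
  | tmul f g => simp [evalAt, mul_comm]

theorem lid_map_comulAux_apply (s : Module.Dual ℂ (finiteDual A)) (a : finiteDual A) (y : A) :
    (TensorProduct.lid ℂ _ (TensorProduct.map s LinearMap.id (comulAux A a))).1 y =
      s (rightTranslate y a) := by
  rw [← rid_evalAt_comulAux]
  generalize comulAux A a = t
  induction t with
  | zero => simp
  | add s t hs ht => simp only [map_add, LinearMap.add_apply, Submodule.coe_add, hs, ht]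
  | tmul f g => simp [evalAt, mul_comm]

variable [SuperAlgebra A]

theorem evenPart_add_oddPart {V : Type*} [AddCommGroup V] [Module ℂ V] [SuperSpace V] :
    evenPart V + oddPart V = LinearMap.id := by
  ext v
  simp only [evenPart, oddPart, LinearMap.add_apply, LinearMap.smul_apply, LinearMap.sub_apply,
    LinearMap.id_apply]
  module

/-- The sign in the graded coproduct applies `parity` to the second factor, where an even form `s`
does not see it. -/
theorem map_id_comul (s : Module.Dual ℂ (finiteDual A)) (hs : s ∘ₗ parity = s) (a : finiteDual A) :
    TensorProduct.map LinearMap.id s (comul A a) =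
      TensorProduct.map LinearMap.id s (comulAux A a) := by
  rw [comul, LinearMap.comp_apply, ← LinearMap.comp_apply (TensorProduct.map _ _),
    LinearMap.comp_add, ← TensorProduct.map_comp, ← TensorProduct.map_comp, hs, LinearMap.id_comp,
    LinearMap.id_comp, LinearMap.comp_id, ← TensorProduct.map_add_left, evenPart_add_oddPart]

theorem comp_oddPart_eq_zero {V W : Type*} [AddCommGroup V] [Module ℂ V] [SuperSpace V]
    [AddCommGroup W] [Module ℂ W] (s : V →ₗ[ℂ] W) (hs : s ∘ₗ parity = s) :
    s ∘ₗ oddPart V = 0 := by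
  rw [oddPart, LinearMap.comp_smul, LinearMap.comp_sub, hs, LinearMap.comp_id, sub_self, smul_zero]

theorem comp_evenPart_eq_self {V W : Type*} [AddCommGroup V] [Module ℂ V] [SuperSpace V]
    [AddCommGroup W] [Module ℂ W] (s : V →ₗ[ℂ] W) (hs : s ∘ₗ parity = s) :
    s ∘ₗ evenPart V = s := by
  rw [← add_zero (s ∘ₗ evenPart V), ← comp_oddPart_eq_zero s hs, ← LinearMap.comp_add,
    evenPart_add_oddPart, LinearMap.comp_id]

/-- The sign only affects terms with an odd first factor, and an even form `s` kills those. -/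
theorem map_comul_id (s : Module.Dual ℂ (finiteDual A)) (hs : s ∘ₗ parity = s) (a : finiteDual A) :
    TensorProduct.map s LinearMap.id (comul A a) =
      TensorProduct.map s LinearMap.id (comulAux A a) := by
  rw [comul, LinearMap.comp_apply, ← LinearMap.comp_apply (TensorProduct.map _ _),
    LinearMap.comp_add, ← TensorProduct.map_comp, ← TensorProduct.map_comp,
    comp_evenPart_eq_self s hs, comp_oddPart_eq_zero s hs, LinearMap.id_comp,
    TensorProduct.map_zero_left, add_zero]

end finiteDual

open finiteDual

variable [SuperAlgebra A]

/-- For an even form the graded condition becomes an invariance property under translations, free of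
signs. -/
theorem isLeftIntegral_iff (e : finiteDual A) (s : Module.Dual ℂ (finiteDual A))
    (hs : s ∘ₗ parity = s) :
    IsLeftIntegral e s ↔ ∀ a x, s (leftTranslate x a) = s a * e.1 x := by
  refine forall_congr' fun a => ?_
  rw [map_id_comul s hs, Subtype.ext_iff, LinearMap.ext_iff]
  exact forall_congr' fun x => by rw [rid_map_comulAux_apply]; rfl

theorem isRightIntegral_iff (e : finiteDual A) (s : Module.Dual ℂ (finiteDual A))
    (hs : s ∘ₗ parity = s) :
    IsRightIntegral e s ↔ ∀ a x, s (rightTranslate x a) = s a * e.1 x := by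
  refine forall_congr' fun a => ?_
  rw [map_comul_id s hs, Subtype.ext_iff, LinearMap.ext_iff]
  exact forall_congr' fun x => by rw [lid_map_comulAux_apply]; rfl

/-- For even z the form ν(z) is the evaluation at z, which contracts the first factor of the
coproduct; no sign survives. -/
theorem dualMul_toBidual_apply {z : A} (hz : parity z = z) (s : Module.Dual ℂ (finiteDual A))
    (a : finiteDual A) : dualMul (toBidual A z) s a = s (leftTranslate z a) := by
  have hodd : oddPart A z = 0 := by simp [oddPart, hz]
  have heven : evenPart A z = z := by
    have := LinearMap.congr_fun (evenPart_add_oddPart (V := A)) z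
    rwa [LinearMap.add_apply, hodd, add_zero] at this
  have h1 : toBidual A z = evalAt z := by
    ext a
    change a.1 (evenPart A z) + (parity a).1 (oddPart A z) = a.1 z
    rw [hodd, heven, map_zero, add_zero]
  have h2 : (evalAt z : Module.Dual ℂ (finiteDual A)) ∘ₗ parity = evalAt z := by
    ext a
    change a.1 (parity z) = a.1 z
    rw [hz]
  rw [dualMul, h1, superTensor, comp_oddPart_eq_zero _ h2, comp_evenPart_eq_self _ h2,
    TensorProduct.map_zero_left, add_zero, LinearMap.comp_apply, ← lid_evalAt_comulAux]
  have h3 : TensorProduct.map (evalAt z) s (comul A a) =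
      TensorProduct.map LinearMap.id s
        (TensorProduct.map (evalAt z) LinearMap.id (comul A a)) := by
    rw [← LinearMap.comp_apply (TensorProduct.map LinearMap.id s), ← TensorProduct.map_comp,
      LinearMap.id_comp, LinearMap.comp_id]
  rw [LinearMap.comp_apply, h3, map_comul_id _ h2]
  generalize TensorProduct.map (evalAt z) LinearMap.id (comulAux A a) = t
  induction t with
  | zero => simp
  | add s t hs ht => simp only [map_add, hs, ht]
  | tmul f g => simp

end Translations

/-! ### Generators of enveloping algebras -/

section Generators

/-- An induction principle: a subalgebra containing `L` is all of `U(L)`. -/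
theorem envelopingAlgebra_induction {L : Type*} [LieRing L] [LieAlgebra ℂ L]
    (S : Subalgebra ℂ (UniversalEnvelopingAlgebra ℂ L))
    (hS : ∀ a, UniversalEnvelopingAlgebra.ι ℂ a ∈ S) (x : UniversalEnvelopingAlgebra ℂ L) :
    x ∈ S := by
  let f : L →ₗ⁅ℂ⁆ S :=
    { toFun := fun a => ⟨UniversalEnvelopingAlgebra.ι ℂ a, hS a⟩
      map_add' := fun a b => Subtype.ext (map_add _ a b)
      map_smul' := fun c a => Subtype.ext (map_smul _ c a)
      map_lie' := fun {a b} => Subtype.ext (LieHom.map_lie _ a b) }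
  have : S.val.comp (UniversalEnvelopingAlgebra.lift ℂ f) = AlgHom.id ℂ _ := by
    ext a
    simp [f]
  rw [← AlgHom.id_apply (R := ℂ) x, ← this]
  exact (UniversalEnvelopingAlgebra.lift ℂ f x).2

/-- An induction principle: a subalgebra containing `L₀` and `L₁` is all of `U(L₀ ⊕ L₁)`. -/
theorem superEnveloping_induction {L₀ L₁ : Type*} [LieRing L₀] [LieAlgebra ℂ L₀]
    [AddCommGroup L₁] [Module ℂ L₁] [LieRingModule L₀ L₁] [LieModule ℂ L₀ L₁]
    [LieSuperalgebra L₀ L₁] (S : Subalgebra ℂ (SuperEnveloping L₀ L₁))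
    (h₀ : ∀ a, SuperEnveloping.ι₀ L₀ L₁ a ∈ S) (h₁ : ∀ x, SuperEnveloping.ι₁ L₀ L₁ x ∈ S)
    (x : SuperEnveloping L₀ L₁) : x ∈ S := by
  let f : L₀ →ₗ[ℂ] S := (SuperEnveloping.ι₀ L₀ L₁).codRestrict S.toSubmodule h₀
  let g : L₁ →ₗ[ℂ] S := (SuperEnveloping.ι₁ L₀ L₁).codRestrict S.toSubmodule h₁
  let φ : SuperEnveloping L₀ L₁ →ₐ[ℂ] S := SuperEnveloping.lift f g
    (fun a b => Subtype.ext (SuperEnveloping.ι₀_lie a b))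
    (fun a b => Subtype.ext (SuperEnveloping.ι₁_lie a b))
    (fun a b => Subtype.ext (SuperEnveloping.ι₁_oddBracket a b))
  have : S.val.comp φ = AlgHom.id ℂ _ :=
    SuperEnveloping.algHom_ext
      (fun a => congrArg Subtype.val (SuperEnveloping.lift_ι₀ f g _ _ _ a))
      (fun a => congrArg Subtype.val (SuperEnveloping.lift_ι₁ f g _ _ _ a))
  rw [← AlgHom.id_apply (R := ℂ) x, ← this]
  exact (φ x).2

end Generators

/-! ### An explicit basis of `osp(3|2)` -/

namespace OSP32

/-- Integral matrices of the format of `ℂ^{3|2}`. -/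
abbrev IntMat : Type := Matrix (Fin 3 ⊕ Fin 2) (Fin 3 ⊕ Fin 2) ℤ

/-- The base change of matrices. -/
def castMat : IntMat →+* Mat := (Int.castRingHom ℂ).mapMatrix

/-- The integral form of `γ`. -/
def γInt : IntMat := Matrix.fromBlocks 1 0 0 (-1)

/-- The integral form of `H`. -/
def HInt : IntMat := Matrix.fromBlocks 1 0 0 !![0, 1; -1, 0]

/-- The odd element of `osp(3|2)` with upper right block `A`. -/
def oddMat (A : Matrix (Fin 3) (Fin 2) ℤ) : IntMat :=
  Matrix.fromBlocks 0 A !![-A 0 1, -A 1 1, -A 2 1; A 0 0, A 1 0, A 2 0] 0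

/-- An integral basis of `osp(3|2)`. The elements `0, …, 5` are odd: `a₁, a₂, a₃, b₁, b₂, b₃` with
upper right block an elementary matrix; the elements `6, 7, 8` form the standard basis of `so(3)`,
and `9, 10, 11` are the elements `h, e, f` of `sp(2)`. -/
def intBasis : ℕ → IntMat
  | 0 => oddMat !![1, 0; 0, 0; 0, 0]
  | 1 => oddMat !![0, 0; 1, 0; 0, 0]
  | 2 => oddMat !![0, 0; 0, 0; 1, 0]
  | 3 => oddMat !![0, 1; 0, 0; 0, 0]
  | 4 => oddMat !![0, 0; 0, 1; 0, 0]
  | 5 => oddMat !![0, 0; 0, 0; 0, 1]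
  | 6 => Matrix.fromBlocks !![0, 0, 0; 0, 0, 1; 0, -1, 0] 0 0 0
  | 7 => Matrix.fromBlocks !![0, 0, -1; 0, 0, 0; 1, 0, 0] 0 0 0
  | 8 => Matrix.fromBlocks !![0, 1, 0; -1, 0, 0; 0, 0, 0] 0 0 0
  | 9 => Matrix.fromBlocks 0 0 0 !![1, 0; 0, -1]
  | 10 => Matrix.fromBlocks 0 0 0 !![0, 1; 0, 0]
  | 11 => Matrix.fromBlocks 0 0 0 !![0, 0; 1, 0]
  | _ => 0

/-- The structure constants of `osp(3|2)`: the bracket of the `i`-th and the `j`-th basis element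
is the sum of `c` times the `k`-th one over the `(c, k)` in the list. -/
def bracketTable : List (List (List (ℤ × ℕ))) :=
  [[[(2, 11)], [], [], [(-1, 9)], [(-1, 8)], [(1, 7)], [], [(-1, 2)], [(1, 1)], [(1, 0)],
    [(1, 3)], []],
   [[], [(2, 11)], [], [(1, 8)], [(-1, 9)], [(-1, 6)], [(1, 2)], [], [(-1, 0)], [(1, 1)],
    [(1, 4)], []],
   [[], [], [(2, 11)], [(-1, 7)], [(1, 6)], [(-1, 9)], [(-1, 1)], [(1, 0)], [], [(1, 2)],
    [(1, 5)], []],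
   [[(-1, 9)], [(1, 8)], [(-1, 7)], [(-2, 10)], [], [], [], [(-1, 5)], [(1, 4)], [(-1, 3)],
    [], [(1, 0)]],
   [[(-1, 8)], [(-1, 9)], [(1, 6)], [], [(-2, 10)], [], [(1, 5)], [], [(-1, 3)], [(-1, 4)],
    [], [(1, 1)]],
   [[(1, 7)], [(-1, 6)], [(-1, 9)], [], [], [(-2, 10)], [(-1, 4)], [(1, 3)], [], [(-1, 5)],
    [], [(1, 2)]],
   [[], [(-1, 2)], [(1, 1)], [], [(-1, 5)], [(1, 4)], [], [(-1, 8)], [(1, 7)], [], [], []],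
   [[(1, 2)], [], [(-1, 0)], [(1, 5)], [], [(-1, 3)], [(1, 8)], [], [(-1, 6)], [], [], []],
   [[(-1, 1)], [(1, 0)], [], [(-1, 4)], [(1, 3)], [], [(-1, 7)], [(1, 6)], [], [], [], []],
   [[(-1, 0)], [(-1, 1)], [(-1, 2)], [(1, 3)], [(1, 4)], [(1, 5)], [], [], [], [], [(2, 10)],
    [(-2, 11)]],
   [[(-1, 3)], [(-1, 4)], [(-1, 5)], [], [], [], [], [], [], [(-2, 10)], [], [(1, 9)]],
   [[], [], [], [(-1, 0)], [(-1, 1)], [(-1, 2)], [], [], [], [(2, 11)], [(-1, 9)], []]]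

/-- The bracket of two basis elements. -/
def bracketList (i j : ℕ) : List (ℤ × ℕ) := (bracketTable.getD i []).getD j []

/-- The sign `-(-1)^([i][j])` in the super bracket of two basis elements. -/
def superSign (i j : ℕ) : ℤ := if i < 6 ∧ j < 6 then 1 else -1

/-- The linear combination of a family described by a list of coefficients and indices. -/
def evalList {α M : Type*} [AddCommGroup M] (f : α → M) (l : List (ℤ × α)) : M :=
  (l.map fun p => p.1 • f p.2).sum

/-- The structure constants are certified by multiplying integer matrices; the base change to ℂ is
done afterwards. -/
theorem intBasis_bracket : ∀ i < 12, ∀ j < 12,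
    intBasis i * intBasis j + superSign i j • (intBasis j * intBasis i) =
      evalList intBasis (bracketList i j) := by
  decide +kernel

theorem intBasis_odd : ∀ i < 6, γInt * intBasis i = -(intBasis i * γInt) ∧
    (intBasis i).transpose * HInt + γInt * HInt * intBasis i = 0 := by
  decide +kernel

theorem intBasis_even : ∀ i < 12, 6 ≤ i → γInt * intBasis i = intBasis i * γInt ∧
    (intBasis i).transpose * HInt + HInt * intBasis i = 0 := by
  decide +kernel

end OSP32

/-! ### Linear combinations stored as lists. -/

section EvalList

variable {α M N : Type*} [AddCommGroup M] [AddCommGroup N]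

namespace OSP32

@[simp]
theorem evalList_nil (f : α → M) : evalList f [] = 0 := rfl

@[simp]
theorem evalList_cons (f : α → M) (p : ℤ × α) (l : List (ℤ × α)) :
    evalList f (p :: l) = p.1 • f p.2 + evalList f l := by
  simp [evalList]

theorem map_evalList {F : Type*} [FunLike F M N] [AddMonoidHomClass F M N] (φ : F) (f : α → M) (l : List (ℤ × α)) :
    φ (evalList f l) = evalList (fun a => φ (f a)) l := by
  induction l with
  | nil => simp
  | cons p l ih => rw [evalList_cons, map_add, map_zsmul, ih, evalList_cons]

theorem evalList_append (f : α → M) (l l' : List (ℤ × α)) :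
    evalList f (l ++ l') = evalList f l + evalList f l' := by
  simp [evalList]

theorem evalList_congr {f g : α → M} {l : List (ℤ × α)} (h : ∀ p ∈ l, f p.2 = g p.2) :
    evalList f l = evalList g l := by
  induction l with
  | nil => rfl
  | cons p l ih =>
    rw [evalList_cons, evalList_cons, h p List.mem_cons_self,
      ih fun q hq => h q (List.mem_cons_of_mem _ hq)]

theorem sum_evalList {ι : Type*} (s : Finset ι) (f : ι → α → M) (l : List (ℤ × α)) :
    ∑ i ∈ s, evalList (f i) l = evalList (fun a => ∑ i ∈ s, f i a) l := by
  induction l with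
  | nil => simp
  | cons p l ih => simp only [evalList_cons, Finset.sum_add_distrib, ih, Finset.smul_sum]

end OSP32

end EvalList

/-! ### The super bracket on `L₀ ⊕ L₁` -/

section SuperBracket

variable (L₀ L₁ : Type*) [LieRing L₀] [LieAlgebra ℂ L₀] [AddCommGroup L₁]
    [Module ℂ L₁] [LieRingModule L₀ L₁] [LieModule ℂ L₀ L₁]

open LieSuperalgebra

/-- The super bracket with an even element. -/
def evenAd : L₀ →ₗ[ℂ] Module.End ℂ (L₀ × L₁) :=
  LinearMap.mk₂ ℂ (fun a v => (⁅a, v.1⁆, ⁅a, v.2⁆))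
    (fun a b v => by simp) (fun c a v => by simp) (fun a v w => by simp) (fun c a v => by simp)

variable {L₀ L₁}

@[simp]
theorem evenAd_apply (a : L₀) (v : L₀ × L₁) : evenAd L₀ L₁ a v = (⁅a, v.1⁆, ⁅a, v.2⁆) := rfl

theorem evenAd_evenAd (a b : L₀) :
    evenAd L₀ L₁ a * evenAd L₀ L₁ b - evenAd L₀ L₁ b * evenAd L₀ L₁ a = evenAd L₀ L₁ ⁅a, b⁆ := by
  refine LinearMap.ext fun v => ?_
  simp [Module.End.mul_apply]

variable [LieSuperalgebra L₀ L₁]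

variable (L₀ L₁) in
/-- The super bracket with an odd element. -/
def oddAd : L₁ →ₗ[ℂ] Module.End ℂ (L₀ × L₁) :=
  LinearMap.mk₂ ℂ (fun x v => (oddBracket x v.2, -⁅v.1, x⁆))
    (fun a b v => by simp [add_comm]) (fun c a v => by simp)
    (fun a v w => by simp [add_comm]) (fun c a v => by simp)

@[simp]
theorem oddAd_apply (x : L₁) (v : L₀ × L₁) :
    oddAd L₀ L₁ x v = (oddBracket x v.2, -⁅v.1, x⁆) := rfl

theorem evenAd_oddAd (a : L₀) (x : L₁) :
    evenAd L₀ L₁ a * oddAd L₀ L₁ x - oddAd L₀ L₁ x * evenAd L₀ L₁ a = oddAd L₀ L₁ ⁅a, x⁆ := by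
  refine LinearMap.ext fun v => Prod.ext ?_ ?_
  · simp [Module.End.mul_apply, lie_oddBracket]
  · simp only [LinearMap.sub_apply, Module.End.mul_apply, evenAd_apply, oddAd_apply, Prod.snd_sub,
      lie_neg]
    rw [leibniz_lie a v.1 x]
    abel

/-- On the even summand this is the invariance of the odd bracket, on the odd summand the super
Jacobi identity. -/
theorem oddAd_oddAd (x y : L₁) :
    oddAd L₀ L₁ x * oddAd L₀ L₁ y + oddAd L₀ L₁ y * oddAd L₀ L₁ x =
      evenAd L₀ L₁ (oddBracket x y) := by
  refine LinearMap.ext fun v => Prod.ext ?_ ?_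
  · simp only [LinearMap.add_apply, Module.End.mul_apply, evenAd_apply, oddAd_apply, Prod.fst_add,
      map_neg]
    rw [← lie_skew, lie_oddBracket, oddBracket_comm ⁅v.1, x⁆ y]
    abel
  · have := jacobi (L₀ := L₀) x y v.2
    simp only [LinearMap.add_apply, Module.End.mul_apply, evenAd_apply, oddAd_apply, Prod.snd_add]
    rw [add_assoc, add_eq_zero_iff_eq_neg, oddBracket_comm v.2 x] at this
    rw [this]
    abel

end SuperBracket

/-! ### The integral basis inside the complex Lie superalgebra. -/

namespace OSP32

open LieSuperalgebra

theorem castMat_γInt : castMat γInt = γ := by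
  ext i j
  rcases i with i | i <;> rcases j with j | j <;> fin_cases i <;> fin_cases j <;>
    simp [castMat, γInt, γ]

theorem castMat_HInt : castMat HInt = H := by
  ext i j
  rcases i with i | i <;> rcases j with j | j <;> fin_cases i <;> fin_cases j <;>
    simp [castMat, HInt, H]

theorem castMat_transpose (X : IntMat) : castMat X.transpose = (castMat X).transpose := rfl

theorem castMat_intBasis_mem_odd {i : ℕ} (hi : i < 6) : castMat (intBasis i) ∈ odd := by
  obtain ⟨h1, h2⟩ := intBasis_odd i hi
  have h1 := congrArg castMat h1
  have h2 := congrArg castMat h2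
  simp only [map_mul, map_neg, map_add, map_zero, castMat_γInt, castMat_HInt,
    castMat_transpose] at h1 h2
  exact ⟨h1, h2⟩

theorem castMat_intBasis_mem_even {i : ℕ} (hi : 6 ≤ i) : castMat (intBasis i) ∈ even := by
  by_cases hi' : i < 12
  · obtain ⟨h1, h2⟩ := intBasis_even i hi' hi
    have h1 := congrArg castMat h1
    have h2 := congrArg castMat h2
    simp only [map_mul, map_add, map_zero, castMat_γInt, castMat_HInt,
      castMat_transpose] at h1 h2
    exact ⟨h1, h2⟩
  · have : intBasis i = 0 := by
      rw [intBasis] <;> omega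
    rw [this, map_zero]
    exact even.zero_mem

/-- The odd basis elements (zero for `i ≥ 6`). -/
def oddElt (i : ℕ) : odd := if h : i < 6 then ⟨castMat (intBasis i), castMat_intBasis_mem_odd h⟩ else 0

/-- The even basis elements (zero unless `6 ≤ i < 12`). -/
def evenElt (i : ℕ) : even :=
  if h : i < 6 then 0 else ⟨castMat (intBasis i), castMat_intBasis_mem_even (not_lt.1 h)⟩

theorem coe_oddElt {i : ℕ} (h : i < 6) : (oddElt i).1 = castMat (intBasis i) := by
  rw [oddElt, dif_pos h]

theorem coe_evenElt {i : ℕ} (h : 6 ≤ i) : (evenElt i).1 = castMat (intBasis i) := by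
  rw [evenElt, dif_neg (not_lt.2 h)]

/-- Pairs of even basis elements, with coefficients, such that the second elements are dual to the
first ones. -/
def evenDualList : List (ℤ × ℕ × ℕ) :=
  [(-1, 6, 6), (-1, 7, 7), (-1, 8, 8), (-1, 9, 9), (-2, 10, 11), (-2, 11, 10)]

/-- Pairs of odd basis elements, with signs, such that the second elements are dual to the
first ones. -/
def oddDualList : List (ℤ × ℕ × ℕ) :=
  [(1, 0, 3), (1, 1, 4), (1, 2, 5), (-1, 3, 0), (-1, 4, 1), (-1, 5, 2)]

theorem eq_zero_of_eq_neg_self {m n : Type*} {M : Matrix m n ℂ} (h : M = -M) : M = 0 := by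
  ext i j
  exact self_eq_neg.1 (congrFun (congrFun h i) j)

/-- Commuting with γ removes the off-diagonal blocks; preserving the form makes one diagonal block
skew-symmetric and the other one traceless. -/
theorem exists_eq_of_mem_even {X : Mat} (hX : X ∈ even) : ∃ a b c x y w : ℂ,
    X = Matrix.fromBlocks !![0, a, b; -a, 0, c; -b, -c, 0] 0 0 !![x, y; w, -x] := by
  obtain ⟨A, B, C, D, rfl⟩ : ∃ A B C D, X = Matrix.fromBlocks A B C D :=
    ⟨_, _, _, _, (Matrix.fromBlocks_toBlocks X).symm⟩
  obtain ⟨h1, h2⟩ := hX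
  simp only [γ, H, Matrix.fromBlocks_multiply, Matrix.fromBlocks_transpose, Matrix.fromBlocks_inj,
    Matrix.fromBlocks_add, ← Matrix.fromBlocks_zero, Matrix.one_mul, Matrix.mul_one, Matrix.zero_mul, Matrix.mul_zero,
    add_zero, zero_add, Matrix.neg_mul, Matrix.mul_neg, true_and, and_true] at h1 h2
  obtain rfl := eq_zero_of_eq_neg_self h1.1
  obtain rfl := eq_zero_of_eq_neg_self h1.2.symm
  obtain ⟨hA, -, -, hD⟩ := h2
  have hA' := fun i j => congrFun (congrFun hA i) j
  have hD' := fun i j => congrFun (congrFun hD i) j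
  simp [Fin.forall_fin_succ, Matrix.mul_apply, Matrix.vecMul, Fin.sum_univ_two,
    Matrix.vecHead, Matrix.vecTail] at hA' hD'
  refine ⟨A 0 1, A 0 2, A 1 2, D 0 0, D 0 1, D 1 0, ?_⟩
  rw [Matrix.fromBlocks_inj]
  refine ⟨?_, rfl, rfl, ?_⟩
  · ext i j
    fin_cases i <;> fin_cases j <;> simp <;> grind only
  · ext i j
    fin_cases i <;> fin_cases j <;> simp <;> grind only

/-- Anticommuting with γ removes the diagonal blocks, and the form determines the lower left block
from the upper right one. -/
theorem exists_eq_of_mem_odd {X : Mat} (hX : X ∈ odd) : ∃ a b c x y w : ℂ,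
    X = Matrix.fromBlocks 0 !![a, x; b, y; c, w] !![-x, -y, -w; a, b, c] 0 := by
  obtain ⟨A, B, C, D, rfl⟩ : ∃ A B C D, X = Matrix.fromBlocks A B C D :=
    ⟨_, _, _, _, (Matrix.fromBlocks_toBlocks X).symm⟩
  obtain ⟨h1, h2⟩ := hX
  simp only [γ, H, Matrix.fromBlocks_multiply, Matrix.fromBlocks_transpose, Matrix.fromBlocks_inj,
    Matrix.fromBlocks_add, Matrix.fromBlocks_neg, ← Matrix.fromBlocks_zero, Matrix.one_mul, Matrix.mul_one,
    Matrix.zero_mul, Matrix.mul_zero, add_zero, zero_add, Matrix.neg_mul, Matrix.mul_neg, neg_neg, true_and] at h1 h2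
  obtain rfl := eq_zero_of_eq_neg_self h1.1
  obtain rfl := eq_zero_of_eq_neg_self h1.2.symm
  have hC := fun i j => congrFun (congrFun h2.2.1 i) j
  simp [Fin.forall_fin_succ, Matrix.mul_apply, Fin.sum_univ_two] at hC
  refine ⟨B 0 0, B 1 0, B 2 0, B 0 1, B 1 1, B 2 1, ?_⟩
  rw [Matrix.fromBlocks_inj]
  refine ⟨rfl, ?_, ?_, rfl⟩
  · ext i j
    fin_cases i <;> fin_cases j <;> rfl
  · ext i j
    fin_cases i <;> fin_cases j <;> simp <;> grind only

/-- This identity is what makes `evenDualList` a list of dual pairs: X is recovered from its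
pairings with the second members. Both sides are compared entry by entry in the six parameters of X.
-/
theorem intBasis_even_expansion {X : Mat} (hX : X ∈ even) :
    X = evalList (fun p : ℕ × ℕ => (2⁻¹ * (γ * (castMat (intBasis p.2) * X)).trace) •
      castMat (intBasis p.1)) evenDualList := by
  obtain ⟨a, b, c, x, y, w, rfl⟩ := exists_eq_of_mem_even hX
  simp [evenDualList, γ, castMat, intBasis, Matrix.fromBlocks_map, Matrix.fromBlocks_multiply,
    Matrix.trace,
    Fintype.sum_sum_type, Fin.sum_univ_three, Matrix.fromBlocks_smul,
    Matrix.fromBlocks_add, Matrix.fromBlocks_neg]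
  refine ⟨?_, ?_⟩ <;> ext i j <;> fin_cases i <;> fin_cases j <;>
    simp [Matrix.mul_apply, Fin.sum_univ_succ, two_mul] <;> ring

theorem intBasis_odd_expansion {X : Mat} (hX : X ∈ odd) :
    X = evalList (fun p : ℕ × ℕ => (2⁻¹ * (γ * (castMat (intBasis p.2) * X)).trace) •
      castMat (intBasis p.1)) oddDualList := by
  obtain ⟨a, b, c, x, y, w, rfl⟩ := exists_eq_of_mem_odd hX
  simp [oddDualList, γ, castMat, intBasis, oddMat, Matrix.fromBlocks_map, Matrix.fromBlocks_multiply,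
    Matrix.trace,
    Fintype.sum_sum_type, Fin.sum_univ_three, Matrix.fromBlocks_smul,
    Matrix.fromBlocks_add, Matrix.fromBlocks_neg]
  simp [Matrix.mul_apply, Fin.sum_univ_two, Fin.sum_univ_three]
  refine ⟨?_, ?_⟩ <;> ext i j <;> fin_cases i <;> fin_cases j <;> simp <;> ring

/-! ### The Casimir element in the explicit basis -/

/-- The Casimir tensor `∑ bᵢ ⊗ bⁱ` can be computed from any pairs of vectors that are dual to each
other. -/
theorem sum_dualBasis_eq_evalList {ι κ V M : Type*} [Fintype κ] [DecidableEq κ] [AddCommGroup V]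
    [Module ℂ V] [AddCommGroup M] [Module ℂ M] {B : LinearMap.BilinForm ℂ V}
    [FiniteDimensional ℂ V] (hB : B.Nondegenerate)
    (b : Module.Basis κ ℂ V) (v : ι → V) (l : List (ℤ × ι × ι))
    (h : ∀ x, x = evalList (fun p : ι × ι => B (v p.2) x • v p.1) l) (f : V →ₗ[ℂ] V →ₗ[ℂ] M) :
    ∑ i, f (b i) (B.dualBasis hB b i) = evalList (fun p => f (v p.1) (v p.2)) l := by
  have h1 : ∀ i, f (b i) (B.dualBasis hB b i) =
      evalList (fun p : ι × ι => B (v p.2) (b i) • f (v p.1) (B.dualBasis hB b i)) l := by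
    intro i
    conv_lhs => rw [h (b i)]
    rw [← LinearMap.flip_apply]
    refine (map_evalList (f.flip (B.dualBasis hB b i)) _ _).trans ?_
    simp
  rw [Finset.sum_congr rfl fun i _ => h1 i, sum_evalList]
  refine evalList_congr fun p _ => ?_
  -- The coordinates of a vector in the dual basis are its pairings with the basis `b`, which turns
  -- the sum over `b` into the vector itself.
  conv_rhs => rw [← (B.dualBasis hB b).sum_repr (v p.2.2)]
  simp only [map_sum, map_smul, LinearMap.BilinForm.dualBasis_repr_apply]

theorem coe_evalList_even {α : Type*} (f : α → even) (l : List (ℤ × α)) :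
    (evalList f l).1 = evalList (fun a => (f a).1) l :=
  map_evalList even.toSubmodule.subtype f l

theorem coe_evalList_odd {α : Type*} (f : α → odd) (l : List (ℤ × α)) :
    (evalList f l).1 = evalList (fun a => (f a).1) l :=
  map_evalList odd.subtype f l

theorem formEven_expansion (X : even) :
    X = evalList (fun p : ℕ × ℕ => formEven (evenElt p.2) X • evenElt p.1) evenDualList := by
  refine Subtype.ext ((intBasis_even_expansion X.2).trans ?_)
  refine Eq.trans (evalList_congr fun p hp => ?_)
    (coe_evalList_even _ _).symm
  have h : 6 ≤ p.2.1 ∧ 6 ≤ p.2.2 := by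
    revert p
    decide
  change _ = (2⁻¹ * (γ * ((evenElt p.2.2).1 * X.1)).trace) • (evenElt p.2.1).1
  rw [coe_evenElt h.1, coe_evenElt h.2]

theorem formOdd_expansion (X : odd) :
    X = evalList (fun p : ℕ × ℕ => formOdd (oddElt p.2) X • oddElt p.1) oddDualList := by
  refine Subtype.ext ((intBasis_odd_expansion X.2).trans ?_)
  refine Eq.trans (evalList_congr fun p hp => ?_)
    (coe_evalList_odd _ _).symm
  have h : p.2.1 < 6 ∧ p.2.2 < 6 := by
    revert p
    decide
  change _ = (2⁻¹ * (γ * ((oddElt p.2.2).1 * X.1)).trace) • (oddElt p.2.1).1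
  rw [coe_oddElt h.1, coe_oddElt h.2]

/-- The images in `U(osp(3|2))` of the basis elements. -/
def gen (i : ℕ) : U :=
  SuperEnveloping.ι₀ even odd (evenElt i) + SuperEnveloping.ι₁ even odd (oddElt i)

theorem gen_of_lt {i : ℕ} (h : i < 6) : gen i = SuperEnveloping.ι₁ even odd (oddElt i) := by
  rw [gen, evenElt, dif_pos h, map_zero, zero_add]

theorem gen_of_le {i : ℕ} (h : 6 ≤ i) : gen i = SuperEnveloping.ι₀ even odd (evenElt i) := by
  rw [gen, oddElt, dif_neg (not_lt.2 h), map_zero, add_zero]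

/-- This replaces the unspecified basis in the definition of the Casimir element by the explicit
one, so that computations become possible. -/
theorem casimir_eq_evalList :
    casimir = evalList (fun p : ℕ × ℕ => gen p.1 * gen p.2) (evenDualList ++ oddDualList) := by
  have h0 := sum_dualBasis_eq_evalList formEven_nondegenerate (Module.finBasis ℂ even) evenElt
    evenDualList formEven_expansion
    ((LinearMap.mul ℂ U).compl₁₂ (SuperEnveloping.ι₀ even odd) (SuperEnveloping.ι₀ even odd))
  have h1 := sum_dualBasis_eq_evalList formOdd_nondegenerate (Module.finBasis ℂ odd) oddElt
    oddDualList formOdd_expansion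
    ((LinearMap.mul ℂ U).compl₁₂ (SuperEnveloping.ι₁ even odd) (SuperEnveloping.ι₁ even odd))
  simp only [LinearMap.compl₁₂_apply, LinearMap.mul_apply'] at h0 h1
  rw [casimir, h0, h1, evalList_append]
  congr 1
  · refine evalList_congr fun p hp => ?_
    have h : 6 ≤ p.2.1 ∧ 6 ≤ p.2.2 := by
      revert p
      decide
    rw [gen_of_le h.1, gen_of_le h.2]
  · refine evalList_congr fun p hp => ?_
    have h : p.2.1 < 6 ∧ p.2.2 < 6 := by
      revert p
      decide
    rw [gen_of_lt h.1, gen_of_lt h.2]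

/-! ### The brackets of the basis elements -/

/-- The bracket of two basis elements has the expected parity. -/
theorem bracketList_parity : ∀ i < 12, ∀ j < 12, ∀ p ∈ bracketList i j,
    p.2 < 12 ∧ (p.2 < 6 ↔ ¬ (i < 6 ↔ j < 6)) := by
  decide +kernel

theorem castMat_bracket {i j : ℕ} (hi : i < 12) (hj : j < 12) :
    castMat (intBasis i) * castMat (intBasis j) +
        superSign i j • (castMat (intBasis j) * castMat (intBasis i)) =
      evalList (fun k => castMat (intBasis k)) (bracketList i j) := by
  rw [← map_evalList castMat intBasis, ← intBasis_bracket i hi j hj]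
  simp

theorem lie_evenElt {i j : ℕ} (hi : 6 ≤ i) (hj : 6 ≤ j) (hi' : i < 12) (hj' : j < 12) :
    ⁅evenElt i, evenElt j⁆ = evalList evenElt (bracketList i j) := by
  refine Subtype.ext (Eq.trans ?_ (coe_evalList_even _ _).symm)
  have h := castMat_bracket hi' hj'
  rw [superSign, if_neg (by omega), neg_one_smul, ← sub_eq_add_neg] at h
  refine Eq.trans (b := _) ?_ (h.trans (evalList_congr fun p hp => ?_))
  · rw [← coe_evenElt hi, ← coe_evenElt hj]; rfl
  · have := bracketList_parity i hi' j hj' p hp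
    exact (coe_evenElt (by omega)).symm

theorem lie_oddElt {i j : ℕ} (hi : 6 ≤ i) (hj : j < 6) (hi' : i < 12) :
    ⁅evenElt i, oddElt j⁆ = evalList oddElt (bracketList i j) := by
  refine Subtype.ext (Eq.trans ?_ (coe_evalList_odd _ _).symm)
  have h := castMat_bracket hi' (hj.trans (by norm_num))
  rw [superSign, if_neg (by omega), neg_one_smul, ← sub_eq_add_neg] at h
  refine Eq.trans (b := _) ?_ (h.trans (evalList_congr fun p hp => ?_))
  · rw [← coe_evenElt hi, ← coe_oddElt hj]; rfl
  · have := bracketList_parity i hi' j (by omega) p hp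
    exact (coe_oddElt (by omega)).symm

theorem neg_lie_oddElt {i j : ℕ} (hi : i < 6) (hj : 6 ≤ j) (hj' : j < 12) :
    -⁅evenElt j, oddElt i⁆ = evalList oddElt (bracketList i j) := by
  refine Subtype.ext (Eq.trans ?_ (coe_evalList_odd _ _).symm)
  have h := castMat_bracket (hi.trans (by norm_num)) hj'
  rw [superSign, if_neg (by omega), neg_one_smul, ← sub_eq_add_neg] at h
  refine Eq.trans (b := _) ?_ (h.trans (evalList_congr fun p hp => ?_))
  · rw [← coe_evenElt hj, ← coe_oddElt hi, ← neg_sub]; rfl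
  · have := bracketList_parity i (by omega) j hj' p hp
    exact (coe_oddElt (by omega)).symm

theorem oddBracket_oddElt {i j : ℕ} (hi : i < 6) (hj : j < 6) :
    oddBracket (oddElt i) (oddElt j) = evalList evenElt (bracketList i j) := by
  refine Subtype.ext (Eq.trans ?_ (coe_evalList_even _ _).symm)
  have h := castMat_bracket (hi.trans (by norm_num)) (hj.trans (by norm_num : 6 < 12))
  rw [superSign, if_pos ⟨hi, hj⟩, one_smul] at h
  refine Eq.trans (b := _) ?_ (h.trans (evalList_congr fun p hp => ?_))
  · rw [← coe_oddElt hi, ← coe_oddElt hj]; rfl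
  · have := bracketList_parity i (by omega) j (by omega) p hp
    exact (coe_evenElt (by omega)).symm

/-- The relations between the generators of `U(osp(3|2))`. -/
theorem gen_mul_gen {i j : ℕ} (hi : i < 12) (hj : j < 12) :
    gen i * gen j + superSign i j • (gen j * gen i) = evalList gen (bracketList i j) := by
  have hev : (i < 6 ↔ j < 6) → evalList gen (bracketList i j) =
      SuperEnveloping.ι₀ even odd (evalList evenElt (bracketList i j)) := by
    intro hij
    refine Eq.trans (evalList_congr fun p hp => gen_of_le ?_)
      (map_evalList (SuperEnveloping.ι₀ even odd) _ _).symm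
    have := bracketList_parity i hi j hj p hp
    omega
  have hodd : ¬ (i < 6 ↔ j < 6) → evalList gen (bracketList i j) =
      SuperEnveloping.ι₁ even odd (evalList oddElt (bracketList i j)) := by
    intro hij
    refine Eq.trans (evalList_congr fun p hp => gen_of_lt ?_)
      (map_evalList (SuperEnveloping.ι₁ even odd) _ _).symm
    have := bracketList_parity i hi j hj p hp
    omega
  rcases lt_or_ge i 6 with h1 | h1 <;> rcases lt_or_ge j 6 with h2 | h2
  · rw [hev (by omega), superSign, if_pos ⟨h1, h2⟩, one_smul, gen_of_lt h1, gen_of_lt h2,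
      SuperEnveloping.ι₁_oddBracket, oddBracket_oddElt h1 h2]
  · rw [hodd (by omega), superSign, if_neg (by omega), neg_one_smul, gen_of_lt h1, gen_of_le h2,
      ← neg_lie_oddElt h1 h2 hj, map_neg, ← SuperEnveloping.ι₁_lie]
    abel
  · rw [hodd (by omega), superSign, if_neg (by omega), neg_one_smul, gen_of_le h1, gen_of_lt h2,
      ← lie_oddElt h1 h2 hi, ← SuperEnveloping.ι₁_lie]
    abel
  · rw [hev (by omega), superSign, if_neg (by omega), neg_one_smul, gen_of_le h1, gen_of_le h2,
      ← lie_evenElt h1 h2 hi hj, ← SuperEnveloping.ι₀_lie]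
    abel

theorem exists_evalList_even (X : even) :
    ∃ c : ℕ → ℂ, X = ∑ i ∈ Finset.Ico 6 12, c i • evenElt i := by
  have h := formEven_expansion X
  simp only [evenDualList, evalList_cons, evalList_nil, add_zero] at h
  -- The coefficients are read off from `evenDualList`, where 10 and 11 are dual to each other up to
  -- the factor -2 and the remaining elements are self-dual up to sign.
  refine ⟨fun i => if i = 10 then -2 * formEven (evenElt 11) X else
    if i = 11 then -2 * formEven (evenElt 10) X else -formEven (evenElt i) X, ?_⟩
  rw [Finset.sum_Ico_eq_sum_range]
  simp only [Finset.sum_range_succ, Finset.sum_range_zero]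
  norm_num
  conv_lhs => rw [h]
  module

theorem exists_evalList_odd (X : odd) :
    ∃ c : ℕ → ℂ, X = ∑ i ∈ Finset.range 6, c i • oddElt i := by
  have h := formOdd_expansion X
  simp only [oddDualList, evalList_cons, evalList_nil, add_zero] at h
  -- In `oddDualList` the elements i and i + 3 are paired, with a sign that depends on the order.
  refine ⟨fun i => if i < 3 then formOdd (oddElt (i + 3)) X else -formOdd (oddElt (i - 3)) X, ?_⟩
  simp only [Finset.sum_range_succ, Finset.sum_range_zero]
  norm_num
  conv_lhs => rw [h]
  module

/-! ### Normal ordering in modules over `U(osp(3|2))` -/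

section Combine

variable {α β M : Type*} [DecidableEq β] [AddCommGroup M]

/-- Add a term to a linear combination, collecting equal terms. -/
def addTerm (c : ℤ) (b : β) : List (ℤ × β) → List (ℤ × β)
  | [] => [(c, b)]
  | (d, b') :: l =>
    if b = b' then (if c + d = 0 then l else (c + d, b') :: l) else (d, b') :: addTerm c b l

/-- Add `c` times a linear combination to another one. -/
def addMul (c : ℤ) (l l' : List (ℤ × β)) : List (ℤ × β) :=
  l.foldr (fun p acc => addTerm (c * p.1) p.2 acc) l'

/-- Add the linear combination `∑ c • g a` to `l'`. -/
def combine (l' : List (ℤ × β)) (g : α → List (ℤ × β)) (l : List (ℤ × α)) : List (ℤ × β) :=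
  l.foldr (fun p acc => addMul p.1 (g p.2) acc) l'

theorem evalList_addTerm (f : β → M) (c : ℤ) (b : β) (l : List (ℤ × β)) :
    evalList f (addTerm c b l) = c • f b + evalList f l := by
  induction l with
  | nil => simp [addTerm]
  | cons p l ih =>
    obtain ⟨d, b'⟩ := p
    rw [addTerm]
    split_ifs with h1 h2
    · rw [evalList_cons, ← add_assoc, h1, ← add_smul, h2, zero_smul, zero_add]
    · rw [evalList_cons, evalList_cons, ← add_assoc, h1, ← add_smul]
    · rw [evalList_cons, evalList_cons, ih, add_left_comm]

theorem evalList_map_mul {α : Type*} (f : α → M) (c : ℤ) (l : List (ℤ × α)) :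
    evalList f (l.map fun p => (c * p.1, p.2)) = c • evalList f l := by
  induction l with
  | nil => simp
  | cons p l ih => rw [List.map_cons, evalList_cons, ih, evalList_cons, smul_add, mul_smul]

theorem evalList_addMul (f : β → M) (c : ℤ) (l l' : List (ℤ × β)) :
    evalList f (addMul c l l') = c • evalList f l + evalList f l' := by
  induction l with
  | nil => simp [addMul]
  | cons p l ih =>
    rw [addMul, List.foldr_cons, evalList_addTerm, ← addMul, ih, evalList_cons, smul_add, mul_smul,
      add_assoc]

theorem evalList_combine (f : β → M) (l' : List (ℤ × β)) (g : α → List (ℤ × β))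
    (l : List (ℤ × α)) :
    evalList f (combine l' g l) = evalList (fun a => evalList f (g a)) l + evalList f l' := by
  induction l with
  | nil => simp [combine]
  | cons p l ih =>
    rw [combine, List.foldr_cons, evalList_addMul, ← combine, ih, evalList_cons, add_assoc]

end Combine

/-- The squares of the odd basis elements. -/
def sqList (x : ℕ) : List (ℤ × ℕ) := (bracketList x x).map fun p => (p.1 / 2, p.2)

/-- The normally ordered form of the product of a letter and a word. If `kill` is set, even letters
at the end of a word are considered to be zero. The second argument bounds the recursion depth. -/
def act (kill : Bool) : ℕ → ℕ → List ℕ → List (ℤ × List ℕ)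
  -- When the depth is exhausted the word is left as it is. This is still correct, only possibly not
  -- ordered.
  | 0, x, w => [(1, x :: w)]
  -- Even letters have the larger indices, so ordering moves them to the right end, next to the
  -- vector on which the word acts.
  | _ + 1, x, [] => if kill = true ∧ 6 ≤ x then [] else [(1, [x])]
  | n + 1, x, y :: w =>
    if x < y then [(1, x :: y :: w)] else
    if x = y then
      -- Powers of an even letter are kept, while the square of an odd letter is half its bracket
      -- with itself and lies in g₀.
      if 6 ≤ x then [(1, x :: y :: w)] else combine [] (fun k => act kill n k w) (sqList x)
    else
      addMul (-superSign x y) (combine [] (act kill n y) (act kill n x w))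
        (combine [] (fun k => act kill n k w) (bracketList x y))

/-- The action of a letter on a linear combination of words. -/
def actList (kill : Bool) (x : ℕ) (l : List (ℤ × List ℕ)) : List (ℤ × List ℕ) :=
  -- The depth 40 plays no role for soundness; it only has to suffice for the computed identities to
  -- reduce to the empty list.
  combine [] (act kill 40 x) l

/-- The action of the Casimir element on a linear combination of words. -/
def casimirList (kill : Bool) (l : List (ℤ × List ℕ)) : List (ℤ × List ℕ) :=
  combine [] (fun p : ℕ × ℕ => actList kill p.1 (actList kill p.2 l)) (evenDualList ++ oddDualList)

theorem gen_eq_zero {i : ℕ} (hi : 12 ≤ i) : gen i = 0 := by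
  have : evenElt i = 0 := Subtype.ext (by
    rw [coe_evenElt (by omega), intBasis, map_zero]
    · rfl
    all_goals omega)
  rw [gen_of_le (by omega), this, map_zero]

theorem bracketList_eq_nil {i j : ℕ} (h : 12 ≤ i ∨ 12 ≤ j) : bracketList i j = [] := by
  have hlen : bracketTable.length = 12 := by decide
  have hlen' : ∀ l ∈ bracketTable, l.length = 12 := by decide
  rcases lt_or_ge i 12 with hi | hi
  · rw [bracketList, List.getD_eq_getElem bracketTable _ (hlen.symm ▸ hi)]
    refine List.getD_eq_default _ _ ?_
    rw [hlen' _ (List.getElem_mem _)]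
    omega
  · rw [bracketList, List.getD_eq_default bracketTable _ (hlen ▸ hi)]
    rfl

/-- Out of range, both the generators and the brackets vanish by convention, so the relation needs
no bounds and the rewriting need not keep track of them. -/
theorem gen_mul_gen' (i j : ℕ) :
    gen i * gen j = -superSign i j • (gen j * gen i) + evalList gen (bracketList i j) := by
  by_cases h : 12 ≤ i ∨ 12 ≤ j
  · rw [bracketList_eq_nil h, evalList_nil]
    rcases h with h | h <;> simp [gen_eq_zero h]
  · rw [← gen_mul_gen (by omega) (by omega), neg_smul]
    abel

/-- For odd x one has 2x² = [x, x]. The relevant coefficients in the table are ±2, so the integer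
division in `sqList` is exact, and 2 can be cancelled over ℂ. -/
theorem gen_mul_self {i : ℕ} (hi : i < 6) : gen i * gen i = evalList gen (sqList i) := by
  have h1 : ∀ i < 6, bracketList i i = (sqList i).map fun p => (2 * p.1, p.2) := by
    decide
  have h2 := gen_mul_gen (i := i) (j := i) (by omega) (by omega)
  rw [superSign, if_pos ⟨hi, hi⟩, one_smul, ← two_nsmul, h1 i hi] at h2
  rw [evalList_map_mul] at h2
  refine smul_right_injective U (two_ne_zero (α := ℂ)) ?_
  simpa only [ofNat_smul_eq_nsmul, ofNat_zsmul] using h2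

/-! ### Soundness of the normal ordering. -/

section Soundness

variable {N : Type*} [AddCommGroup N] [Module U N] (v : N)

/-- The action of a word on a vector. -/
def evalWord (w : List ℕ) : N := w.foldr (fun x u => gen x • u) v

theorem evalWord_cons (x : ℕ) (w : List ℕ) : evalWord v (x :: w) = gen x • evalWord v w := rfl

theorem evalList_smul (l : List (ℤ × ℕ)) (u : N) :
    evalList gen l • u = evalList (fun x => gen x • u) l :=
  map_evalList ((smulAddHom U N).flip u) gen l

theorem smul_evalList {α : Type*} (x : U) (f : α → N) (l : List (ℤ × α)) :
    x • evalList f l = evalList (fun a => x • f a) l :=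
  map_evalList (DistribSMul.toAddMonoidHom N x) f l

variable {v} {kill : Bool} (hv : kill = true → ∀ x, 6 ≤ x → gen x • v = 0)
include hv

/-- Each rewriting rule is an identity in U(g) applied to a vector. This holds for every depth `n`;
with `kill` set, it needs a vector annihilated by the even generators. -/
theorem evalList_act (n x : ℕ) (w : List ℕ) :
    evalList (evalWord v) (act kill n x w) = gen x • evalWord v w := by
  induction n generalizing x w with
  | zero => simp [act, evalWord_cons]
  | succ n ih =>
    cases w with
    | nil =>
      rw [act]
      split_ifs with h
      · exact (hv h.1 x h.2).symm
      · simp [evalWord_cons]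
    | cons y w =>
      rw [act]
      split_ifs with h1 h2 h3
      · simp [evalWord_cons]
      · simp [evalWord_cons]
      · rw [evalList_combine, evalList_nil, add_zero, evalWord_cons, ← h2, smul_smul,
          gen_mul_self (by omega), evalList_smul]
        exact evalList_congr fun p _ => ih _ _
      · rw [evalList_addMul, evalList_combine, evalList_combine, evalList_nil, add_zero, add_zero,
          evalWord_cons, smul_smul, gen_mul_gen', add_smul, evalList_smul]
        congr 1
        · rw [smul_assoc, mul_smul, ← ih, smul_evalList]
          congr 1
          exact evalList_congr fun p _ => ih _ _
        · exact evalList_congr fun p _ => ih _ _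

theorem evalList_actList (x : ℕ) (l : List (ℤ × List ℕ)) :
    evalList (evalWord v) (actList kill x l) = gen x • evalList (evalWord v) l := by
  rw [actList, evalList_combine, evalList_nil, add_zero, smul_evalList]
  exact evalList_congr fun p _ => evalList_act hv _ _ _

theorem evalList_casimirList (l : List (ℤ × List ℕ)) :
    evalList (evalWord v) (casimirList kill l) = casimir • evalList (evalWord v) l := by
  rw [casimirList, evalList_combine, evalList_nil, add_zero, casimir_eq_evalList]
  refine Eq.trans ?_ (map_evalList ((smulAddHom U N).flip (evalList (evalWord v) l)) _ _).symm
  refine evalList_congr fun p _ => ?_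
  rw [evalList_actList hv, evalList_actList hv]
  exact smul_smul _ _ _

end Soundness

/-! ### The two computations by normal ordering. -/

/-- The difference of `x C` and `C x` in normally ordered form. -/
theorem casimirList_comm : ∀ x < 12,
    addMul (-1) (casimirList false [(1, [x])]) (actList false x (casimirList false [(1, [])])) =
      [] := by
  decide +kernel

/-- The normally ordered form of `C (C - 2) (C + 6)` in `W`. -/
def zList : List (ℤ × List ℕ) :=
  let v := addMul 6 [(1, [])] (casimirList true [(1, [])])
  casimirList true (addMul (-2) v (casimirList true v))

/-- This is the computational core of the invariance of z: each odd generator, applied to the class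
of z in W, gives a combination of words that cancels completely. Even generators need no
computation, as z is central. -/
theorem actList_zList : ∀ x < 6, actList true x zList = [] := by
  decide +kernel

/-! ### The Casimir element is central and `z` is invariant modulo `J` -/

theorem ι₀_mem_of_gen_mem (S : Submodule ℂ U) (h : ∀ i, 6 ≤ i → i < 12 → gen i ∈ S) (a : even) :
    SuperEnveloping.ι₀ even odd a ∈ S := by
  obtain ⟨c, rfl⟩ := exists_evalList_even a
  rw [map_sum]
  refine S.sum_mem fun i hi => ?_
  rw [Finset.mem_Ico] at hi
  rw [map_smul, ← gen_of_le hi.1]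
  exact S.smul_mem _ (h i hi.1 hi.2)

theorem ι₁_mem_of_gen_mem (S : Submodule ℂ U) (h : ∀ i < 6, gen i ∈ S) (x : odd) :
    SuperEnveloping.ι₁ even odd x ∈ S := by
  obtain ⟨c, rfl⟩ := exists_evalList_odd x
  rw [map_sum]
  refine S.sum_mem fun i hi => ?_
  rw [Finset.mem_range] at hi
  rw [map_smul, ← gen_of_lt hi]
  exact S.smul_mem _ (h i hi)

/-- A subalgebra of `U(osp(3|2))` containing the basis elements is everything. -/
theorem induction_gen (S : Subalgebra ℂ U) (h : ∀ i < 12, gen i ∈ S) (u : U) : u ∈ S :=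
  superEnveloping_induction S
    (ι₀_mem_of_gen_mem (Subalgebra.toSubmodule S) fun i _ hi => h i hi)
    (ι₁_mem_of_gen_mem (Subalgebra.toSubmodule S) fun i hi => h i (by omega)) u

/-- The centralizer of C is a subalgebra, so the twelve generators suffice. For these the words of
xC and Cx, acting on 1 ∈ U(g), were seen to cancel. -/
theorem casimir_comm (u : U) : u * casimir = casimir * u := by
  have hv : (false = true) → ∀ x, 6 ≤ x → gen x • (1 : U) = 0 := by simp
  refine (Subalgebra.mem_centralizer_iff ℂ (s := {casimir})).1
    (induction_gen (Subalgebra.centralizer ℂ {casimir}) (fun x hx => ?_) u) casimir rfl |>.symm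
  rw [Subalgebra.mem_centralizer_iff]
  rintro _ rfl
  have h := congrArg (evalList (evalWord (1 : U))) (casimirList_comm x hx)
  rw [evalList_addMul, evalList_actList hv, evalList_casimirList hv, evalList_casimirList hv] at h
  simp only [evalList_cons, evalList_nil, evalWord, List.foldr, add_zero, one_smul,
    smul_eq_mul, mul_one, neg_smul, neg_add_eq_zero] at h
  exact h

theorem z_comm (u : U) : u * z = z * u := by
  have h : Commute u casimir := casimir_comm u
  have h2 : Commute u (2 : U) := Commute.ofNat_right u 2
  have h6 : Commute u (6 : U) := Commute.ofNat_right u 6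
  exact ((h.mul_right (h.sub_right h2)).mul_right (h.add_right h6)).eq

theorem ε_gen (i : ℕ) : ε (gen i) = 0 := by
  rw [gen, map_add, ε, SuperEnveloping.counit, SuperEnveloping.lift_ι₀, SuperEnveloping.lift_ι₁]
  simp

theorem ι₀_mem_J (a : even) : SuperEnveloping.ι₀ even odd a ∈ J :=
  Ideal.subset_span ⟨a, rfl⟩

theorem gen_mul_z_mem (i : ℕ) : gen i * z ∈ J := by
  rcases lt_or_ge i 6 with h | h
  -- The class of 1 in W = U(g)/U(g)g₀ is annihilated by g₀, which justifies dropping the trailing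
  -- even letters.
  · have hv : (true = true) → ∀ x, 6 ≤ x → gen x • (Submodule.Quotient.mk 1 : W) = 0 := by
      intro _ x hx
      rw [← Submodule.Quotient.mk_smul, Submodule.Quotient.mk_eq_zero, smul_eq_mul, mul_one,
        gen_of_le hx]
      exact ι₀_mem_J _
    have h1 := congrArg (evalList (evalWord (Submodule.Quotient.mk 1 : W))) (actList_zList i h)
    rw [evalList_actList hv, zList, evalList_casimirList hv, evalList_addMul,
      evalList_casimirList hv, evalList_addMul, evalList_casimirList hv] at h1
    simp only [evalList_cons, evalList_nil, evalWord, List.foldr, add_zero, one_smul] at h1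
    rw [← Submodule.Quotient.mk_eq_zero J, ← mul_one (gen i * z), ← smul_eq_mul (gen i * z),
      Submodule.Quotient.mk_smul, mul_smul, ← h1, z]
    have hz : casimir * (casimir - 2) * (casimir + 6) =
        casimir * ((-2 : ℤ) • (casimir + (6 : ℤ) • 1) + casimir * (casimir + (6 : ℤ) • 1)) := by
      noncomm_ring
    rw [hz]
    simp only [mul_smul, add_smul, smul_assoc, one_smul]
    rw [add_comm (casimir • _) ((6 : ℤ) • (Submodule.Quotient.mk 1 : W))]
  -- For an even generator a, az = za lies in U(g)g₀.
  · rw [z_comm, gen_of_le h]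
    exact J.mul_mem_left _ (ι₀_mem_J _)

/-- The class of `z` in `W` is invariant. -/
theorem mul_z_sub_mem (x : U) : x * z - ε x • z ∈ J := by
  let S : Subalgebra ℂ U :=
    { carrier := {x | x * z - ε x • z ∈ J}
      mul_mem' := by
        intro x y hx hy
        have : x * y * z - ε (x * y) • z = x * (y * z - ε y • z) + ε y • (x * z - ε x • z) := by
          rw [map_mul, mul_sub, smul_sub, mul_smul_comm, smul_smul, mul_comm (ε y), mul_assoc]
          abel
        change _ - _ ∈ J
        rw [this]
        exact J.add_mem (J.mul_mem_left _ hy) ((J.restrictScalars ℂ).smul_mem _ hx)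
      add_mem' := by
        intro x y hx hy
        change _ - _ ∈ J
        rw [map_add, add_mul, add_smul, add_sub_add_comm]
        exact J.add_mem hx hy
      algebraMap_mem' := by
        intro c
        change _ - _ ∈ J
        rw [AlgHom.commutes, Algebra.algebraMap_self, RingHom.id_apply, Algebra.smul_def, sub_self]
        exact J.zero_mem }
  refine induction_gen S (fun i _ => ?_) x
  change _ - _ ∈ J
  rw [ε_gen, zero_smul, sub_zero]
  exact gen_mul_z_mem i

/-! ### An anti-automorphism -/

open MulOpposite in
/-- The anti-automorphism of `U(osp(3|2))` given by `a ↦ -a` on the even part and `x ↦ i x` on the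
odd part. -/
def antiAut : U →ₐ[ℂ] Uᵐᵒᵖ :=
  SuperEnveloping.lift
    (-((opLinearEquiv ℂ).toLinearMap ∘ₗ SuperEnveloping.ι₀ even odd))
    -- The anticommutator of two odd elements acquires the factor i² = -1, in agreement with the
    -- sign on the even part. No super signs are needed.
    (Complex.I • ((opLinearEquiv ℂ).toLinearMap ∘ₗ SuperEnveloping.ι₁ even odd))
    (fun a b => unop_injective (by
      simp only [LinearMap.neg_apply, LinearMap.comp_apply, LinearEquiv.coe_coe,
        coe_opLinearEquiv, unop_sub, unop_mul, unop_neg, unop_op, ← SuperEnveloping.ι₀_lie]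
      noncomm_ring))
    (fun a x => unop_injective (by
      simp only [LinearMap.neg_apply, LinearMap.smul_apply, LinearMap.comp_apply,
        LinearEquiv.coe_coe, coe_opLinearEquiv, unop_sub, unop_mul, unop_neg, unop_smul, unop_op,
        ← SuperEnveloping.ι₁_lie, smul_mul_assoc, mul_smul_comm, smul_sub, mul_neg, neg_mul,
        smul_neg]
      abel))
    (fun x y => unop_injective (by
      simp only [LinearMap.neg_apply, LinearMap.smul_apply, LinearMap.comp_apply,
        LinearEquiv.coe_coe, coe_opLinearEquiv, unop_add, unop_mul, unop_neg, unop_op,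
        ← SuperEnveloping.ι₁_oddBracket, smul_mul_assoc, mul_smul_comm, smul_smul,
        Complex.I_mul_I, neg_smul, one_smul]
      abel))

open MulOpposite

theorem antiAut_ι₀ (a : even) :
    (antiAut (SuperEnveloping.ι₀ even odd a)).unop = -SuperEnveloping.ι₀ even odd a := by
  rw [antiAut, SuperEnveloping.lift_ι₀]
  rfl

theorem antiAut_gen_of_lt {i : ℕ} (h : i < 6) : (antiAut (gen i)).unop = Complex.I • gen i := by
  rw [gen_of_lt h, antiAut, SuperEnveloping.lift_ι₁]
  rfl

theorem antiAut_gen_of_le {i : ℕ} (h : 6 ≤ i) : (antiAut (gen i)).unop = -gen i := by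
  rw [gen_of_le h, antiAut_ι₀]

/-- Reversing products permutes the even terms, with signs cancelling in pairs. In the odd terms the
reversal exchanges dual partners, whose coefficients are opposite, and this is compensated by i² =
-1. -/
theorem antiAut_casimir : (antiAut casimir).unop = casimir := by
  let φ : U →+ U := (opAddEquiv (α := U)).symm.toAddMonoidHom.comp antiAut.toRingHom.toAddMonoidHom
  have hφ : ∀ u v, φ (u * v) = (antiAut v).unop * (antiAut u).unop := fun u v => by
    change (antiAut (u * v)).unop = _
    rw [map_mul, unop_mul]
  change φ casimir = casimir
  rw [casimir_eq_evalList, map_evalList, evalList_append, evalList_append]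
  simp only [hφ, evenDualList, oddDualList, evalList_cons, evalList_nil, antiAut_gen_of_lt,
    antiAut_gen_of_le, Nat.reduceLT, Nat.reduceLeDiff, le_refl, neg_mul_neg, smul_mul_assoc,
    mul_smul_comm, smul_smul, Complex.I_mul_I]
  module

theorem antiAut_z : (antiAut z).unop = z := by
  have h : (antiAut (casimir * (casimir - 2) * (casimir + 6))).unop =
      ((antiAut casimir).unop + 6) * (((antiAut casimir).unop - 2) * (antiAut casimir).unop) := by
    rw [map_mul, map_mul, map_add, map_sub, map_ofNat antiAut 2, map_ofNat antiAut 6]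
    rfl
  rw [z, h, antiAut_casimir]
  noncomm_ring

theorem parity_ι₀ (a : even) : parity (SuperEnveloping.ι₀ even odd a) =
    SuperEnveloping.ι₀ even odd a :=
  SuperEnveloping.lift_ι₀ _ _ _ _ _ a

theorem parity_ι₁ (x : odd) : parity (SuperEnveloping.ι₁ even odd x) =
    -SuperEnveloping.ι₁ even odd x :=
  SuperEnveloping.lift_ι₁ _ _ _ _ _ x

theorem parity_casimir : parity casimir = casimir := by
  simp only [casimir, map_add, map_sum, SuperAlgebra.parity_mul, parity_ι₀, parity_ι₁, neg_mul_neg]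

theorem parity_z : parity z = z := by
  have h : ∀ u : U, parity u = SuperAlgebra.parityHom U u := fun u => rfl
  have hc := parity_casimir
  rw [h] at hc ⊢
  rw [z, map_mul, map_mul, map_add, map_sub, hc, map_ofNat _ 2, map_ofNat _ 6]

/-- If `p ι₀(a)` lies in the two-sided ideal `I` for all even `a`, then `p` times the class of `z` is right
invariant. -/
theorem mul_z_mul_sub_mem (I : Ideal U) [I.IsTwoSided] {p : U}
    (hp : ∀ a, p * SuperEnveloping.ι₀ even odd a ∈ I) (x : U) : p * (z * x - ε x • z) ∈ I := by
  -- The anti-automorphism turns the left ideal U(g)g₀ into the right ideal g₀U(g), which p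
  -- multiplies into I.
  have hJ : ∀ j ∈ J, p * (antiAut j).unop ∈ I := by
    intro j hj
    induction hj using Submodule.span_induction with
    | mem j hj =>
      obtain ⟨a, rfl⟩ := hj
      rw [antiAut_ι₀, mul_neg]
      exact I.neg_mem (hp a)
    | zero => simp
    | add j k _ _ hj hk =>
      rw [map_add, unop_add, mul_add]
      exact I.add_mem hj hk
    | smul u j _ hj =>
      rw [smul_eq_mul, map_mul, unop_mul, ← mul_assoc]
      exact I.mul_mem_right _ hj
  have hgen : ∀ i, p * (z * gen i) ∈ I := by
    intro i
    have h := hJ _ (gen_mul_z_mem i)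
    rw [map_mul, unop_mul, antiAut_z] at h
    rcases lt_or_ge i 6 with h1 | h1
    · rw [antiAut_gen_of_lt h1, mul_smul_comm, mul_smul_comm] at h
      -- Multiplication by -i removes the factor i introduced by the anti-automorphism.
      have := (I.restrictScalars ℂ).smul_mem (-Complex.I) h
      rwa [smul_smul, neg_mul, Complex.I_mul_I, neg_neg, one_smul] at this
    · rw [antiAut_gen_of_le h1, mul_neg, mul_neg] at h
      exact neg_mem_iff.1 h
  let S : Subalgebra ℂ U :=
    { carrier := {x | p * (z * x - ε x • z) ∈ I}
      mul_mem' := by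
        intro x y hx hy
        have : p * (z * (x * y) - ε (x * y) • z) =
            p * (z * x - ε x • z) * y + ε x • (p * (z * y - ε y • z)) := by
          have h1 : ε x • (p * (z * y - ε y • z)) = p * (ε x • (z * y) - (ε x * ε y) • z) := by
            rw [← mul_smul_comm, smul_sub, smul_smul]
          rw [h1, map_mul, mul_assoc p, sub_mul, smul_mul_assoc, ← mul_add, mul_assoc z]
          congr 1
          abel
        change p * (_ - _) ∈ I
        rw [this]
        exact I.add_mem (I.mul_mem_right _ hx) ((I.restrictScalars ℂ).smul_mem _ hy)
      add_mem' := by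
        intro x y hx hy
        change p * (_ - _) ∈ I
        rw [map_add, mul_add, add_smul, add_sub_add_comm, mul_add]
        exact I.add_mem hx hy
      algebraMap_mem' := by
        intro c
        change p * (_ - _) ∈ I
        rw [AlgHom.commutes, Algebra.algebraMap_self, RingHom.id_apply, ← Algebra.commutes,
          Algebra.smul_def, sub_self, mul_zero]
        exact I.zero_mem }
  refine induction_gen S (fun i _ => ?_) x
  change p * (_ - _) ∈ I
  rw [ε_gen, zero_smul, sub_zero]
  exact hgen i

end OSP32

/-! ### The super commutator action of `U(L)` -/

section SuperCommutator

variable {L₀ L₁ : Type*} [LieRing L₀] [LieAlgebra ℂ L₀] [AddCommGroup L₁]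
    [Module ℂ L₁] [LieRingModule L₀ L₁] [LieModule ℂ L₀ L₁] [LieSuperalgebra L₀ L₁]
    {E : Type*} [Ring E] [Algebra ℂ E]

open SuperEnveloping

/-- The super commutator action of `U(L)` on an algebra `E`, the target of a homomorphism `φ` on
`U(L)`. The parity of `E` is the conjugation by the element `s` with `s² = 1`. -/
def superCommutator (φ : SuperEnveloping L₀ L₁ →ₐ[ℂ] E) {s : E} (hs : s * s = 1)
    (h₀ : ∀ a, s * φ (ι₀ L₀ L₁ a) = φ (ι₀ L₀ L₁ a) * s)
    (h₁ : ∀ x, s * φ (ι₁ L₀ L₁ x) = -(φ (ι₁ L₀ L₁ x) * s)) :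
    SuperEnveloping L₀ L₁ →ₐ[ℂ] Module.End ℂ E :=
  lift
    (LinearMap.mk₂ ℂ (fun a v => φ (ι₀ L₀ L₁ a) * v - v * φ (ι₀ L₀ L₁ a))
      (fun a b v => by simp only [map_add, add_mul, mul_add]; abel)
      (fun c a v => by simp only [map_smul, smul_mul_assoc, mul_smul_comm, smul_sub])
      (fun a v w => by simp only [add_mul, mul_add]; abel)
      (fun c a v => by simp only [smul_mul_assoc, mul_smul_comm, smul_sub]))
    (LinearMap.mk₂ ℂ (fun x v => φ (ι₁ L₀ L₁ x) * v - s * v * s * φ (ι₁ L₀ L₁ x))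
      (fun a b v => by simp only [map_add, add_mul, mul_add]; abel)
      (fun c a v => by simp only [map_smul, smul_mul_assoc, mul_smul_comm, smul_sub])
      (fun a v w => by simp only [add_mul, mul_add]; abel)
      (fun c a v => by simp only [smul_mul_assoc, mul_smul_comm, smul_sub]))
    (fun a b => LinearMap.ext fun v => by
      simp only [LinearMap.sub_apply, Module.End.mul_apply, LinearMap.mk₂_apply, ← ι₀_lie, map_sub,
        map_mul, mul_sub, sub_mul, mul_assoc]
      abel)
    (fun a x => LinearMap.ext fun v => by
      have h : s * (φ (ι₀ L₀ L₁ a) * (v * (s * φ (ι₁ L₀ L₁ x)))) =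
          φ (ι₀ L₀ L₁ a) * (s * (v * (s * φ (ι₁ L₀ L₁ x)))) := by
        rw [← mul_assoc, h₀, mul_assoc]
      have h' : φ (ι₀ L₀ L₁ a) * (s * φ (ι₁ L₀ L₁ x)) = s * (φ (ι₀ L₀ L₁ a) * φ (ι₁ L₀ L₁ x)) := by
        rw [← mul_assoc, ← h₀, mul_assoc]
      simp only [LinearMap.sub_apply, Module.End.mul_apply, LinearMap.mk₂_apply, ← ι₁_lie, map_sub,
        map_mul, mul_sub, sub_mul, mul_assoc, h, h']
      abel)
    -- Since s anticommutes with odd images, the mixed terms with v in the middle cancel on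
    -- symmetrizing; with s² = 1 the rest is the commutator with the anticommutator of x and y.
    (fun x y => LinearMap.ext fun v => by
      have h : ∀ x y, s * (φ (ι₁ L₀ L₁ x) * (v * (s * φ (ι₁ L₀ L₁ y)))) =
          -(φ (ι₁ L₀ L₁ x) * (s * (v * (s * φ (ι₁ L₀ L₁ y))))) := fun x y => by
        rw [← mul_assoc, h₁, neg_mul, mul_assoc]
      have h' : ∀ x y, s * (s * (v * (s * (φ (ι₁ L₀ L₁ x) * (s * φ (ι₁ L₀ L₁ y)))))) =
          -(v * (φ (ι₁ L₀ L₁ x) * φ (ι₁ L₀ L₁ y))) := fun x y => by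
        rw [← mul_assoc s s, hs, one_mul, ← mul_assoc s (φ _), h₁, neg_mul, mul_assoc, ← mul_assoc s s,
          hs, one_mul, mul_neg]
      simp only [LinearMap.add_apply, Module.End.mul_apply, LinearMap.mk₂_apply, ← ι₁_oddBracket,
        map_add, map_mul, mul_sub, sub_mul, mul_add, add_mul, mul_assoc, h, h']
      abel)

variable {φ : SuperEnveloping L₀ L₁ →ₐ[ℂ] E} {s : E} (hs : s * s = 1)
    (h₀ : ∀ a, s * φ (ι₀ L₀ L₁ a) = φ (ι₀ L₀ L₁ a) * s)
    (h₁ : ∀ x, s * φ (ι₁ L₀ L₁ x) = -(φ (ι₁ L₀ L₁ x) * s))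

theorem superCommutator_ι₀ (a : L₀) (v : E) :
    superCommutator φ hs h₀ h₁ (ι₀ L₀ L₁ a) v = φ (ι₀ L₀ L₁ a) * v - v * φ (ι₀ L₀ L₁ a) := by
  rw [superCommutator, lift_ι₀]
  rfl

theorem superCommutator_ι₁ (x : L₁) (v : E) :
    superCommutator φ hs h₀ h₁ (ι₁ L₀ L₁ x) v =
      φ (ι₁ L₀ L₁ x) * v - s * v * s * φ (ι₁ L₀ L₁ x) := by
  rw [superCommutator, lift_ι₁]
  rfl

theorem superCommutator_ι₀_one (a : L₀) :
    superCommutator φ hs h₀ h₁ (ι₀ L₀ L₁ a) 1 = 0 := by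
  rw [superCommutator_ι₀, mul_one, one_mul, sub_self]

theorem superCommutator_ι₁_one (x : L₁) :
    superCommutator φ hs h₀ h₁ (ι₁ L₀ L₁ x) 1 = 0 := by
  rw [superCommutator_ι₁, mul_one, mul_one, hs, one_mul, sub_self]

/-- The action of a product of two odd elements on an even element. -/
theorem superCommutator_ι₁_ι₁ (x y : L₁) {v : E} (hv : s * v = v * s) :
    superCommutator φ hs h₀ h₁ (ι₁ L₀ L₁ x * ι₁ L₀ L₁ y) v =
      φ (ι₁ L₀ L₁ x) * (φ (ι₁ L₀ L₁ y) * v - v * φ (ι₁ L₀ L₁ y)) +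
        (φ (ι₁ L₀ L₁ y) * v - v * φ (ι₁ L₀ L₁ y)) * φ (ι₁ L₀ L₁ x) := by
  have h : s * (φ (ι₁ L₀ L₁ y) * v - v * φ (ι₁ L₀ L₁ y)) * s =
      -(φ (ι₁ L₀ L₁ y) * v - v * φ (ι₁ L₀ L₁ y)) := by
    rw [mul_sub, ← mul_assoc, ← mul_assoc, h₁, hv, neg_mul, mul_assoc, mul_assoc, hv, h₁, mul_neg,
      ← mul_assoc, ← mul_assoc, sub_mul, neg_mul, neg_mul, mul_assoc, hs, mul_one,
      mul_assoc _ s s, hs, mul_one]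
    abel
  rw [map_mul, Module.End.mul_apply, superCommutator_ι₁, superCommutator_ι₁, hv, mul_assoc v s s,
    hs, mul_one, h, neg_mul, sub_neg_eq_add]

variable (L₀ L₁)

/-- The adjoint representation. -/
def adjoint : SuperEnveloping L₀ L₁ →ₐ[ℂ] Module.End ℂ (L₀ × L₁) :=
  lift (evenAd L₀ L₁) (oddAd L₀ L₁) evenAd_evenAd evenAd_oddAd oddAd_oddAd

variable {L₀ L₁}

theorem adjoint_ι₀ (a : L₀) : adjoint L₀ L₁ (ι₀ L₀ L₁ a) = evenAd L₀ L₁ a :=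
  lift_ι₀ _ _ _ _ _ a

theorem adjoint_ι₁ (x : L₁) : adjoint L₀ L₁ (ι₁ L₀ L₁ x) = oddAd L₀ L₁ x :=
  lift_ι₁ _ _ _ _ _ x

variable (L₀ L₁)

/-- The parity operator of `L₀ ⊕ L₁`. -/
def parityOp : Module.End ℂ (L₀ × L₁) := LinearMap.prodMap LinearMap.id (-LinearMap.id)

/-- The super commutator action of `U(L)` on the endomorphisms of the adjoint representation. -/
def adjointEnd : SuperEnveloping L₀ L₁ →ₐ[ℂ] Module.End ℂ (Module.End ℂ (L₀ × L₁)) :=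
  superCommutator (adjoint L₀ L₁) (s := parityOp L₀ L₁)
    (LinearMap.ext fun v => by simp [parityOp, Module.End.mul_apply])
    (fun a => LinearMap.ext fun v => by simp [adjoint_ι₀, parityOp, Module.End.mul_apply])
    (fun x => LinearMap.ext fun v => by
      rw [adjoint_ι₁]
      simp [parityOp, Module.End.mul_apply])

variable {L₀ L₁}

theorem adjointEnd_ι₀_eq_zero {a : L₀} {v : Module.End ℂ (L₀ × L₁)}
    (h : evenAd L₀ L₁ a * v = v * evenAd L₀ L₁ a) : adjointEnd L₀ L₁ (ι₀ L₀ L₁ a) v = 0 := by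
  rw [← adjoint_ι₀] at h
  exact (superCommutator_ι₀ _ _ _ a v).trans (by rw [h, sub_self])

theorem adjointEnd_ι₀_one (a : L₀) : adjointEnd L₀ L₁ (ι₀ L₀ L₁ a) 1 = 0 :=
  superCommutator_ι₀_one _ _ _ a

theorem adjointEnd_ι₁_one (x : L₁) : adjointEnd L₀ L₁ (ι₁ L₀ L₁ x) 1 = 0 :=
  superCommutator_ι₁_one _ _ _ x

theorem adjointEnd_ι₁_ι₁ (x y : L₁) {v : Module.End ℂ (L₀ × L₁)}
    (hv : parityOp L₀ L₁ * v = v * parityOp L₀ L₁) :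
    adjointEnd L₀ L₁ (ι₁ L₀ L₁ x * ι₁ L₀ L₁ y) v =
      oddAd L₀ L₁ x * (oddAd L₀ L₁ y * v - v * oddAd L₀ L₁ y) +
        (oddAd L₀ L₁ y * v - v * oddAd L₀ L₁ y) * oddAd L₀ L₁ x := by
  rw [← adjoint_ι₁, ← adjoint_ι₁]
  exact superCommutator_ι₁_ι₁ _ _ _ x y hv

end SuperCommutator

/-! ### A vector in the endomorphisms of the adjoint representation on which z does not vanish. -/

namespace OSP32

open LieSuperalgebra

theorem γ_mul_mem_even {X : Mat} (hX : X ∈ even) : γ * X ∈ even := by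
  obtain ⟨h1, h2⟩ := hX
  refine ⟨by rw [mul_assoc, ← h1], ?_⟩
  rw [Matrix.transpose_mul, γ_transpose, mul_assoc, γ_mul_H, ← mul_assoc, h1, ← mul_assoc,
    ← add_mul, h2, zero_mul]

/-- Left multiplication by `γ` on the even part: `1` on `so(3)` and `-1` on `sp(2)`. -/
def evenγ : even →ₗ[ℂ] even :=
  (LinearMap.mulLeft ℂ γ).restrict (p := even.toSubmodule) fun _ hX => γ_mul_mem_even hX

theorem coe_evenγ (X : even) : (evenγ X).1 = γ * X.1 := rfl

/-- The endomorphism of `osp(3|2)` which is `6` on `so(3)`, `-4` on `sp(2)` and `0` on the odd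
part. -/
def isotypicEnd : Module.End ℂ (even × odd) :=
  LinearMap.prodMap (LinearMap.id + (5 : ℂ) • evenγ) 0

theorem isotypicEnd_apply (v : even × odd) :
    isotypicEnd v = (v.1 + (5 : ℂ) • evenγ v.1, 0) := rfl

theorem parityOp_isotypicEnd :
    parityOp even odd * isotypicEnd = isotypicEnd * parityOp even odd := by
  refine LinearMap.ext fun v => ?_
  rw [Module.End.mul_apply, Module.End.mul_apply, isotypicEnd_apply, isotypicEnd_apply, parityOp,
    LinearMap.prodMap_apply, LinearMap.prodMap_apply]
  simp

/-- The scalars on so(3), sp(2) and the odd part do not matter here: left multiplication by γ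
commutes with the brackets with even elements. -/
theorem adjointEnd_ι₀_isotypicEnd (a : even) :
    adjointEnd even odd (SuperEnveloping.ι₀ even odd a) isotypicEnd = 0 := by
  have h : ∀ X, ⁅a, evenγ X⁆ = evenγ ⁅a, X⁆ := fun X => Subtype.ext (by
    change a.1 * (γ * X.1) - γ * X.1 * a.1 = γ * (a.1 * X.1 - X.1 * a.1)
    rw [mul_sub, ← mul_assoc, ← mul_assoc, ← mul_assoc, a.2.1])
  have h' : evenAd even odd a * isotypicEnd = isotypicEnd * evenAd even odd a := by
    refine LinearMap.ext fun v => ?_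
    simp only [Module.End.mul_apply, isotypicEnd_apply, evenAd_apply, lie_add, lie_smul, h,
      lie_zero]
  exact adjointEnd_ι₀_eq_zero h'

/-- The basis elements of `osp(3|2)`. -/
def basisElt (i : ℕ) : even × odd := (evenElt i, oddElt i)

theorem evenElt_of_lt {i : ℕ} (h : i < 6) : evenElt i = 0 := dif_pos h

theorem oddElt_of_le {i : ℕ} (h : 6 ≤ i) : oddElt i = 0 := dif_neg (not_lt.2 h)

theorem evenElt_of_ge {i : ℕ} (hi : 12 ≤ i) : evenElt i = 0 :=
  Subtype.ext (by
    rw [coe_evenElt (by omega), intBasis, map_zero]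
    · rfl
    all_goals omega)

theorem evalList_eq_zero {α M : Type*} [AddCommGroup M] {f : α → M} {l : List (ℤ × α)}
    (h : ∀ p ∈ l, f p.2 = 0) : evalList f l = 0 := by
  induction l with
  | nil => rfl
  | cons p l ih =>
    rw [evalList_cons, h p List.mem_cons_self, smul_zero, zero_add,
      ih fun q hq => h q (List.mem_cons_of_mem _ hq)]

theorem evalList_apply {α V : Type*} [AddCommGroup V] [Module ℂ V] (F : α → Module.End ℂ V)
    (l : List (ℤ × α)) (v : V) : evalList F l v = evalList (fun a => F a v) l := by
  induction l with
  | nil => rfl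
  | cons p l ih => rw [evalList_cons, evalList_cons, ← ih]; rfl

/-- The table gives one component of the bracket; the other one vanishes for reasons of parity. -/
theorem oddAd_basisElt {i : ℕ} (hi : i < 6) (j : ℕ) :
    oddAd even odd (oddElt i) (basisElt j) = evalList basisElt (bracketList i j) := by
  have h0 := map_evalList (AddMonoidHom.fst even odd) basisElt (bracketList i j)
  have h1 := map_evalList (AddMonoidHom.snd even odd) basisElt (bracketList i j)
  rw [oddAd_apply]
  rcases lt_or_ge j 12 with hj | hj
  · rcases lt_or_ge j 6 with h | h
    · refine Prod.ext ((oddBracket_oddElt hi h).trans h0.symm) (Eq.trans ?_ h1.symm)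
      have h2 : evenElt j = 0 := evenElt_of_lt h
      refine Eq.trans ?_ (evalList_eq_zero fun p hp => ?_).symm
      · change -⁅evenElt j, oddElt i⁆ = 0
        rw [h2, zero_lie, neg_zero]
      · have := bracketList_parity i (by omega) j hj p hp
        exact oddElt_of_le (by omega)
    · refine Prod.ext (Eq.trans ?_ h0.symm) ((neg_lie_oddElt hi h hj).trans h1.symm)
      have h2 : oddElt j = 0 := oddElt_of_le h
      refine Eq.trans ?_ (evalList_eq_zero fun p hp => ?_).symm
      · change oddBracket (oddElt i) (oddElt j) = 0
        rw [h2, map_zero]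
      · have := bracketList_parity i (by omega) j hj p hp
        exact evenElt_of_lt (by omega)
  · rw [bracketList_eq_nil (Or.inr hj), evalList_nil, basisElt, oddElt_of_le (i := j) (by omega),
      evenElt_of_ge hj, map_zero, zero_lie, neg_zero]
    rfl

/-- The eigenvalues of `isotypicEnd`. -/
def isotypicValue (l : ℕ) : ℤ := if l < 6 then 0 else if l < 9 then 6 else -4

theorem isotypicEnd_basisElt (l : ℕ) :
    isotypicEnd (basisElt l) = isotypicValue l • basisElt l := by
  rw [isotypicEnd_apply]
  rcases lt_or_ge l 6 with h | h
  · rw [isotypicValue, if_pos h, zero_smul, basisElt, evenElt_of_lt h]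
    simp
  rcases le_or_gt 12 l with h' | h'
  · rw [basisElt, evenElt_of_ge h', oddElt_of_le h]
    simp
  have h1 : ∀ l, 6 ≤ l → l < 12 → γInt * intBasis l = (if l < 9 then 1 else -1 : ℤ) • intBasis l := by
    decide +kernel
  have h2 : evenγ (evenElt l) = (if l < 9 then 1 else -1 : ℤ) • evenElt l := Subtype.ext (by
    rw [coe_evenγ]
    change _ = (if l < 9 then 1 else -1 : ℤ) • (evenElt l).1
    rw [coe_evenElt h, ← castMat_γInt, ← map_mul, h1 l h h', map_zsmul])
  rw [basisElt, oddElt_of_le h, h2, isotypicValue, if_neg (not_lt.2 h)]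
  refine Prod.ext ?_ (smul_zero _).symm
  change evenElt l + (5 : ℂ) • ((_ : ℤ) • evenElt l) = (_ : ℤ) • evenElt l
  split_ifs <;> module

/-- The commutator of `oddAd` with `isotypicEnd`. -/
def isotypicBracketList (j l : ℕ) : List (ℤ × ℕ) :=
  (bracketList j l).map fun p => (p.1 * (isotypicValue l - isotypicValue p.2), p.2)

/-- In a basis of eigenvectors of `isotypicEnd`, taking the commutator with it multiplies each
coefficient by a difference of eigenvalues. -/
theorem evalList_isotypicBracketList {j : ℕ} (hj : j < 6) (l : ℕ) :
    evalList basisElt (isotypicBracketList j l) =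
      (oddAd even odd (oddElt j) * isotypicEnd - isotypicEnd * oddAd even odd (oddElt j))
        (basisElt l) := by
  have h : ∀ L : List (ℤ × ℕ), evalList basisElt
      (L.map fun p => (p.1 * (isotypicValue l - isotypicValue p.2), p.2)) =
      isotypicValue l • evalList basisElt L - isotypicEnd (evalList basisElt L) := by
    intro L
    induction L with
    | nil => simp
    | cons p L ih =>
      rw [List.map_cons, evalList_cons, ih, evalList_cons, map_add, map_zsmul, isotypicEnd_basisElt]
      module
  rw [isotypicBracketList, h, LinearMap.sub_apply, Module.End.mul_apply, Module.End.mul_apply,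
    isotypicEnd_basisElt, map_zsmul, oddAd_basisElt hj]

/-- An odd element acts on the even `isotypicEnd` by a commutator and on the resulting odd
endomorphism by an anticommutator. The eigenvalues 6, -4, 0 have the property that the result is the
same scalar on every basis vector. -/
theorem casimir_isotypicEnd_table : ∀ l < 12,
    combine [] (fun p : ℕ × ℕ => addMul 1 (combine [] (bracketList p.1) (isotypicBracketList p.2 l))
      (combine [] (isotypicBracketList p.2) (bracketList p.1 l))) oddDualList = [(-48, l)] := by
  decide +kernel

theorem endomorphism_ext {f g : Module.End ℂ (even × odd)}
    (h : ∀ l < 12, f (basisElt l) = g (basisElt l)) : f = g := by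
  refine LinearMap.prod_ext (LinearMap.ext fun X => ?_) (LinearMap.ext fun X => ?_)
  · obtain ⟨c, rfl⟩ := exists_evalList_even X
    simp only [map_sum, map_smul]
    refine Finset.sum_congr rfl fun i hi => congrArg _ ?_
    rw [Finset.mem_Ico] at hi
    have := h i hi.2
    rwa [basisElt, oddElt_of_le hi.1] at this
  · obtain ⟨c, rfl⟩ := exists_evalList_odd X
    simp only [map_sum, map_smul]
    refine Finset.sum_congr rfl fun i hi => congrArg _ ?_
    rw [Finset.mem_range] at hi
    have := h i (by omega)
    rwa [basisElt, evenElt_of_lt hi] at this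

/-- On a g₀-invariant vector the even terms of C vanish, because their right factor already kills
it. -/
theorem adjointEnd_casimir (v : Module.End ℂ (even × odd))
    (hv : ∀ a, adjointEnd even odd (SuperEnveloping.ι₀ even odd a) v = 0) :
    adjointEnd even odd casimir v =
      evalList (fun p => adjointEnd even odd (gen p.1 * gen p.2) v) oddDualList := by
  have hl : ∀ p ∈ evenDualList, 6 ≤ p.2.2 := by decide
  have h := map_evalList ((LinearMap.applyₗ v ∘ₗ (adjointEnd even odd).toLinearMap :
    U →ₗ[ℂ] Module.End ℂ (even × odd))) (fun p => gen p.1 * gen p.2) (evenDualList ++ oddDualList)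
  rw [← casimir_eq_evalList, evalList_append] at h
  refine h.trans (Eq.trans (congrArg (· + _) (evalList_eq_zero fun p hp => ?_)) (zero_add _))
  change adjointEnd even odd (gen p.2.1 * gen p.2.2) v = 0
  rw [map_mul, Module.End.mul_apply, gen_of_le (hl p hp), hv, map_zero]

theorem adjointEnd_casimir_isotypicEnd :
    adjointEnd even odd casimir isotypicEnd = (-48 : ℂ) • 1 := by
  rw [adjointEnd_casimir _ adjointEnd_ι₀_isotypicEnd]
  refine endomorphism_ext fun l hl => ?_
  have h := congrArg (evalList basisElt) (casimir_isotypicEnd_table l hl)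
  have hlt : ∀ p ∈ oddDualList, p.2.1 < 6 ∧ p.2.2 < 6 := by decide
  rw [evalList_combine, evalList_nil, add_zero, evalList_cons, evalList_nil, add_zero] at h
  have h1 : ((-48 : ℂ) • (1 : Module.End ℂ (even × odd))) (basisElt l) =
      (-48 : ℤ) • basisElt l := by
    rw [LinearMap.smul_apply, Module.End.one_apply]
    module
  rw [h1]
  refine Eq.trans ?_ h
  refine (evalList_apply _ _ _).trans (evalList_congr fun p hp => ?_)
  obtain ⟨h2, h3⟩ := hlt p hp
  change adjointEnd even odd (gen p.2.1 * gen p.2.2) isotypicEnd (basisElt l) = _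
  rw [gen_of_lt h2, gen_of_lt h3, adjointEnd_ι₁_ι₁ _ _ parityOp_isotypicEnd,
    evalList_addMul, one_smul, evalList_combine, evalList_combine, evalList_nil, add_zero, add_zero,
    LinearMap.add_apply, Module.End.mul_apply, Module.End.mul_apply, oddAd_basisElt h2,
    ← evalList_isotypicBracketList h3, map_evalList _ basisElt, map_evalList _ basisElt]
  exact congrArg₂ _ (evalList_congr fun q _ => oddAd_basisElt h2 _)
    (evalList_congr fun q _ => (evalList_isotypicBracketList h3 _).symm)

theorem adjointEnd_casimir_one : adjointEnd even odd casimir 1 = 0 := by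
  rw [adjointEnd_casimir _ adjointEnd_ι₀_one]
  have hlt : ∀ p ∈ oddDualList, p.2.1 < 6 ∧ p.2.2 < 6 := by decide
  refine evalList_eq_zero fun p hp => ?_
  change adjointEnd even odd (gen p.2.1 * gen p.2.2) 1 = 0
  rw [map_mul, Module.End.mul_apply, gen_of_lt (hlt p hp).2, adjointEnd_ι₁_one, map_zero]

theorem algHom_add_smul_one_apply {A V : Type*} [Ring A] [Algebra ℂ A] [AddCommGroup V] [Module ℂ V]
    (θ : A →ₐ[ℂ] Module.End ℂ V) {x : A} {v : V} (h : θ x v = 0) (c d : ℂ) :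
    θ (x + d • 1) (c • v) = (d * c) • v := by
  rw [map_add, map_smul θ, map_one, LinearMap.add_apply, map_smul, h, smul_zero, zero_add,
    LinearMap.smul_apply, Module.End.one_apply, smul_smul]

theorem adjointEnd_z_isotypicEnd :
    adjointEnd even odd z isotypicEnd = (576 : ℂ) • 1 := by
  have hz : z = (casimir + (6 : ℂ) • 1) * ((casimir - (2 : ℂ) • 1) * casimir) := by
    have h2 : (2 : U) = (2 : ℂ) • 1 := by rw [← Algebra.algebraMap_eq_smul_one, map_ofNat]
    have h6 : (6 : U) = (6 : ℂ) • 1 := by rw [← Algebra.algebraMap_eq_smul_one, map_ofNat]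
    rw [z, h2, h6]
    simp only [mul_add, add_mul, mul_sub, sub_mul, smul_mul_assoc, mul_smul_comm, one_mul, mul_one,
      mul_assoc]
    module
  have h (c d : ℂ) : adjointEnd even odd (casimir + d • 1) (c • 1) = (d * c) • 1 :=
    algHom_add_smul_one_apply _ adjointEnd_casimir_one c d
  rw [hz, map_mul, map_mul, Module.End.mul_apply, Module.End.mul_apply,
    adjointEnd_casimir_isotypicEnd, sub_eq_add_neg, ← neg_smul, h, h]
  norm_num

open finiteDual

/-! ### Non-vanishing of `z` modulo `J` -/

/-- A g₀-invariant vector is annihilated by the left ideal generated by g₀, so the action on it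
factors through W and can detect z. -/
theorem adjointEnd_isotypicEnd_eq_zero {j : U} (hj : j ∈ J) :
    adjointEnd even odd j isotypicEnd = 0 := by
  induction hj using Submodule.span_induction with
  | mem j hj =>
    obtain ⟨a, rfl⟩ := hj
    exact adjointEnd_ι₀_isotypicEnd a
  | zero => rw [map_zero, LinearMap.zero_apply]
  | add j k _ _ hj hk => rw [map_add, LinearMap.add_apply, hj, hk, add_zero]
  | smul u j _ hj => rw [smul_eq_mul, map_mul, Module.End.mul_apply, hj, map_zero]

theorem exists_dual_one_ne_zero {V : Type*} [AddCommGroup V] [Module ℂ V] {v : V} (hv : v ≠ 0) :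
    ∃ f : Module.Dual ℂ (Module.End ℂ V), f 1 ≠ 0 := by
  by_contra! h
  exact hv ((Module.forall_dual_apply_eq_zero_iff ℂ v).1 fun g => h (g ∘ₗ LinearMap.applyₗ v))

theorem exists_dual_adjointEnd_z :
    ∃ f : Module.Dual ℂ (Module.End ℂ (even × odd)), f (adjointEnd even odd z isotypicEnd) ≠ 0 := by
  have hne : basisElt 6 ≠ 0 := by
    intro h
    have h1 := congrArg (fun v : even × odd => v.1.1) h
    change (evenElt 6).1 = 0 at h1
    rw [coe_evenElt (by omega)] at h1
    have h2 : intBasis 6 (Sum.inl 1) (Sum.inl 2) = 1 := rfl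
    have h3 := congrFun (congrFun h1 (Sum.inl 1)) (Sum.inl 2)
    change ((intBasis 6 (Sum.inl 1) (Sum.inl 2) : ℤ) : ℂ) = 0 at h3
    rw [h2, Int.cast_one] at h3
    exact one_ne_zero h3
  obtain ⟨f, hf⟩ := exists_dual_one_ne_zero hne
  refine ⟨f, ?_⟩
  rw [adjointEnd_z_isotypicEnd, map_smul]
  exact smul_ne_zero (by norm_num) hf

theorem z_notMem_J : z ∉ J := fun h => by
  obtain ⟨f, hf⟩ := exists_dual_adjointEnd_z
  exact hf (by rw [adjointEnd_isotypicEnd_eq_zero h, map_zero])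

theorem smul_mk_z (x : U) :
    x • (Submodule.Quotient.mk z : W) = ε x • (Submodule.Quotient.mk z : W) := by
  rw [← Submodule.Quotient.mk_smul, ← Submodule.Quotient.mk_smul]
  exact (Submodule.Quotient.eq J).2 (mul_z_sub_mem x)

/-! ### The projector onto the invariants of `U(g₀)` -/

/-- The standard triples of `so(3)` and `sp(2)`. -/
def triple : Fin 2 → Fin 3 → even :=
  -- Over ℂ, so(3) becomes sl₂ by means of ladder operators with respect to the rotation generator
  -- `evenElt 8`.
  ![![(-2 * Complex.I) • evenElt 8, evenElt 6 + Complex.I • evenElt 7,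
      -evenElt 6 + Complex.I • evenElt 7],
    ![evenElt 9, evenElt 10, evenElt 11]]

theorem lie_evenElt_table :
    ⁅evenElt 6, evenElt 7⁆ = -evenElt 8 ∧ ⁅evenElt 6, evenElt 8⁆ = evenElt 7 ∧
    ⁅evenElt 7, evenElt 8⁆ = -evenElt 6 ∧ ⁅evenElt 9, evenElt 10⁆ = (2 : ℂ) • evenElt 10 ∧
    ⁅evenElt 9, evenElt 11⁆ = -((2 : ℂ) • evenElt 11) ∧ ⁅evenElt 10, evenElt 11⁆ = evenElt 9 := by
  have h : bracketList 6 7 = [(-1, 8)] ∧ bracketList 6 8 = [(1, 7)] ∧ bracketList 7 8 = [(-1, 6)] ∧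
    bracketList 9 10 = [(2, 10)] ∧ bracketList 9 11 = [(-2, 11)] ∧
    bracketList 10 11 = [(1, 9)] := by decide
  obtain ⟨h1, h2, h3, h4, h5, h6⟩ := h
  refine ⟨?_, ?_, ?_, ?_, ?_, ?_⟩ <;>
    rw [lie_evenElt (by omega) (by omega) (by omega) (by omega)] <;>
    simp only [h1, h2, h3, h4, h5, h6, evalList_cons, evalList_nil] <;> module

theorem lie_evenElt_eq_zero {i j : ℕ} (hi : 6 ≤ i) (hi' : i < 9) (hj : 9 ≤ j) (hj' : j < 12) :
    ⁅evenElt i, evenElt j⁆ = 0 := by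
  have h : ∀ i < 9, 6 ≤ i → ∀ j < 12, 9 ≤ j → bracketList i j = [] := by decide
  rw [lie_evenElt hi (by omega) (by omega) hj', h i hi' hi j hj' hj, evalList_nil]

theorem lie_triple (i : Fin 2) :
    ⁅triple i 1, triple i 2⁆ = triple i 0 ∧ ⁅triple i 0, triple i 1⁆ = (2 : ℂ) • triple i 1 ∧
      ⁅triple i 0, triple i 2⁆ = -((2 : ℂ) • triple i 2) := by
  obtain ⟨h1, h2, h3, h4, h5, h6⟩ := lie_evenElt_table
  have h1' : ⁅evenElt 7, evenElt 6⁆ = evenElt 8 := by rw [← lie_skew, h1, neg_neg]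
  have h2' : ⁅evenElt 8, evenElt 6⁆ = -evenElt 7 := by rw [← lie_skew, h2]
  have h3' : ⁅evenElt 8, evenElt 7⁆ = evenElt 6 := by rw [← lie_skew, h3, neg_neg]
  fin_cases i
  · simp only [triple, Fin.zero_eta, Matrix.cons_val, lie_add, add_lie, lie_smul, smul_lie, lie_neg,
      lie_self, h1, h1', h2', h3']
    refine ⟨by module, ?_, ?_⟩ <;> match_scalars <;>
      first | ring1 | linear_combination (-2) * Complex.I_mul_I
  · exact ⟨h6, h4, h5⟩

theorem triple_commute (a b : Fin 3) : ⁅triple 0 a, triple 1 b⁆ = 0 := by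
  fin_cases a <;> fin_cases b <;> simp [triple, lie_evenElt_eq_zero]

/-- The span of the triples is the even part. -/
theorem mem_of_triple_mem (S : Submodule ℂ U₀)
    (h : ∀ i a, UniversalEnvelopingAlgebra.ι ℂ (triple i a) ∈ S) (X : even) :
    UniversalEnvelopingAlgebra.ι ℂ X ∈ S := by
  let T : Submodule ℂ even := S.comap (UniversalEnvelopingAlgebra.ι ℂ : even →ₗ⁅ℂ⁆ U₀).toLinearMap
  have h' : ∀ i a, triple i a ∈ T := h
  have h7 : evenElt 7 ∈ T := by
    have := T.smul_mem (-Complex.I / 2) (T.add_mem (h' 0 1) (h' 0 2))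
    have e : (-Complex.I / 2) • (triple 0 1 + triple 0 2) = evenElt 7 := by
      simp only [triple, Matrix.cons_val, smul_add, smul_smul, smul_neg, div_mul_eq_mul_div,
        neg_mul, Complex.I_mul_I]
      module
    rwa [e] at this
  have h6 : evenElt 6 ∈ T := by
    have := T.sub_mem (h' 0 1) (T.smul_mem Complex.I h7)
    have e : triple 0 1 - Complex.I • evenElt 7 = evenElt 6 := add_sub_cancel_right _ _
    rwa [e] at this
  have h8 : evenElt 8 ∈ T := by
    have := T.smul_mem (Complex.I / 2) (h' 0 0)
    have e : (Complex.I / 2) • triple 0 0 = evenElt 8 := by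
      have : (Complex.I / 2) * (-2 * Complex.I) = 1 := by
        linear_combination -Complex.I_mul_I
      simp only [triple, Matrix.cons_val, smul_smul, this, one_smul]
    rwa [e] at this
  change X ∈ T
  obtain ⟨c, rfl⟩ := exists_evalList_even X
  refine T.sum_mem fun i hi => T.smul_mem _ ?_
  rw [Finset.mem_Ico] at hi
  obtain ⟨hi, hi'⟩ := hi
  interval_cases i
  · exact h6
  · exact h7
  · exact h8
  · exact h' 1 0
  · exact h' 1 1
  · exact h' 1 2

/-- The elements annihilated by p modulo I form a subspace, so the projector for the two commuting
triples, which span g₀, works for all of g₀. -/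
theorem exists_projector (I : Ideal U₀) [I.IsTwoSided] [FiniteDimensional ℂ (U₀ ⧸ I)] :
    ∃ p, envelopingCounit even p = 1 ∧ (∀ a, UniversalEnvelopingAlgebra.ι ℂ a * p ∈ I) ∧
      ∀ a, p * UniversalEnvelopingAlgebra.ι ℂ a ∈ I := by
  have hι : ∀ a b : even, UniversalEnvelopingAlgebra.ι ℂ a * UniversalEnvelopingAlgebra.ι ℂ b -
      UniversalEnvelopingAlgebra.ι ℂ b * UniversalEnvelopingAlgebra.ι ℂ a =
      UniversalEnvelopingAlgebra.ι ℂ ⁅a, b⁆ := fun a b => by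
    rw [LieHom.map_lie, LieRing.of_associative_ring_bracket]
  obtain ⟨p, hp, h⟩ := exists_slTwo_sq_projector (envelopingCounit even) I
    (fun i a => UniversalEnvelopingAlgebra.ι ℂ (triple i a))
    (fun i => by rw [hι, (lie_triple i).1])
    (fun i => by rw [hι, (lie_triple i).2.1, map_smul, ofNat_smul_eq_nsmul])
    (fun i => by rw [hι, (lie_triple i).2.2, map_neg, map_smul, ofNat_smul_eq_nsmul])
    (fun a b => sub_eq_zero.1 (by rw [hι, triple_commute, map_zero]))
  refine ⟨p, hp, fun X => ?_, fun X => ?_⟩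
  · exact mem_of_triple_mem ((I.restrictScalars ℂ).comap (LinearMap.mulRight ℂ p))
      (fun i a => (h i a).1) X
  · exact mem_of_triple_mem ((I.restrictScalars ℂ).comap (LinearMap.mulLeft ℂ p))
      (fun i a => (h i a).2) X

open SuperEnveloping

/-! ### Integrals on `U(g₀)°` -/

/-- The x with this property form a subalgebra by multiplicativity of the counit; on g₀ it is the
hypothesis. -/
theorem mul_sub_smul_mem {I : Ideal U₀} [I.IsTwoSided] {p : U₀}
    (hp : ∀ a, p * UniversalEnvelopingAlgebra.ι ℂ a ∈ I) (x : U₀) :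
    p * x - envelopingCounit even x • p ∈ I := by
  let S : Subalgebra ℂ U₀ :=
    { carrier := {x | p * x - envelopingCounit even x • p ∈ I}
      mul_mem' := by
        intro x y hx hy
        have : p * (x * y) - envelopingCounit even (x * y) • p =
            (p * x - envelopingCounit even x • p) * y +
              envelopingCounit even x • (p * y - envelopingCounit even y • p) := by
          rw [map_mul, sub_mul, smul_sub, smul_smul, smul_mul_assoc, mul_assoc]
          abel
        change _ - _ ∈ I
        rw [this]
        exact I.add_mem (I.mul_mem_right _ hx) ((I.restrictScalars ℂ).smul_mem _ hy)
      add_mem' := by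
        intro x y hx hy
        change _ - _ ∈ I
        rw [map_add, mul_add, add_smul, add_sub_add_comm]
        exact I.add_mem hx hy
      algebraMap_mem' := by
        intro c
        change _ - _ ∈ I
        rw [AlgHom.commutes, Algebra.algebraMap_self, RingHom.id_apply, ← Algebra.commutes,
          Algebra.smul_def, sub_self]
        exact I.zero_mem }
  refine envelopingAlgebra_induction S (fun a => ?_) x
  have h : envelopingCounit even (UniversalEnvelopingAlgebra.ι ℂ a) = 0 := by
    rw [envelopingCounit, UniversalEnvelopingAlgebra.lift_ι_apply]
    rfl
  change _ - _ ∈ I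
  rw [h, zero_smul, sub_zero]
  exact hp a

theorem isLeftIntegral_unit₀_iff (s : Module.Dual ℂ (finiteDual U₀)) :
    IsLeftIntegral unit₀ s ↔ ∀ a x, s (leftTranslate x a) = s a * envelopingCounit even x :=
  isLeftIntegral_iff unit₀ s rfl

/-- The value of a normalized left integral. -/
theorem integral_eq_apply {s : Module.Dual ℂ (finiteDual U₀)} (hs : IsLeftIntegral unit₀ s)
    (h1 : s unit₀ = 1) {I : Ideal U₀} [I.IsTwoSided] {p : U₀} (hp : envelopingCounit even p = 1)
    (hpI : ∀ a, p * UniversalEnvelopingAlgebra.ι ℂ a ∈ I) {a : finiteDual U₀}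
    (ha : ∀ x ∈ I, a.1 x = 0) : s a = a.1 p := by
  rw [isLeftIntegral_unit₀_iff] at hs
  -- As px ≡ ε(x)p modulo I, translating by p turns a into a multiple of the counit, on which the
  -- normalized integral is known. Invariance compares this with s(a).
  have h : leftTranslate p a = a.1 p • unit₀ := Subtype.ext (LinearMap.ext fun x => by
    have := ha _ (mul_sub_smul_mem hpI x)
    rw [map_sub, map_smul, sub_eq_zero] at this
    exact this.trans (mul_comm _ _))
  have := hs a p
  rw [h, map_smul, h1, hp, mul_one, smul_eq_mul, mul_one] at this
  exact this.symm

theorem leftTranslate_mul {A : Type*} [Ring A] [Algebra ℂ A] (x y : A) (a : finiteDual A) :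
    leftTranslate (x * y) a = leftTranslate y (leftTranslate x a) :=
  Subtype.ext (LinearMap.ext fun z => by
    rw [leftTranslate_apply, leftTranslate_apply, leftTranslate_apply, mul_assoc])

theorem isLeftIntegral_of_ι {s : Module.Dual ℂ (finiteDual U₀)}
    (hs : ∀ a b, s (leftTranslate (UniversalEnvelopingAlgebra.ι ℂ a) b) = 0) :
    IsLeftIntegral unit₀ s := by
  rw [isLeftIntegral_unit₀_iff]
  let S : Subalgebra ℂ U₀ :=
    { carrier := {x | ∀ a, s (leftTranslate x a) = s a * envelopingCounit even x}
      mul_mem' := by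
        intro x y hx hy a
        rw [leftTranslate_mul, hy, hx, map_mul, mul_assoc]
      add_mem' := by
        intro x y hx hy a
        have : leftTranslate (x + y) a = leftTranslate x a + leftTranslate y a :=
          Subtype.ext (LinearMap.ext fun z => by
            change a.1 ((x + y) * z) = a.1 (x * z) + a.1 (y * z)
            rw [add_mul, map_add])
        rw [this, map_add, hx, hy, map_add, mul_add]
      algebraMap_mem' := by
        intro c a
        have : leftTranslate (algebraMap ℂ U₀ c) a = c • a :=
          Subtype.ext (LinearMap.ext fun z => by
            change a.1 (algebraMap ℂ U₀ c * z) = c • a.1 z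
            rw [← Algebra.smul_def, map_smul])
        rw [this, map_smul, AlgHom.commutes, Algebra.algebraMap_self, RingHom.id_apply,
          smul_eq_mul, mul_comm] }
  refine fun a x => envelopingAlgebra_induction S (fun b a => ?_) x a
  have h : envelopingCounit even (UniversalEnvelopingAlgebra.ι ℂ b) = 0 := by
    rw [envelopingCounit, UniversalEnvelopingAlgebra.lift_ι_apply]
    rfl
  rw [hs, h, mul_zero]

/-- The span of the translates by elements of `g₀`. -/
def translates : Submodule ℂ (finiteDual U₀) :=
  Submodule.span ℂ {b | ∃ a c, leftTranslate (UniversalEnvelopingAlgebra.ι ℂ a) c = b}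

theorem finiteDimensional_quotient_inf {A : Type*} [Ring A] [Algebra ℂ A] (I J : Ideal A)
    [FiniteDimensional ℂ (A ⧸ I)] [FiniteDimensional ℂ (A ⧸ J)] :
    FiniteDimensional ℂ (A ⧸ (I ⊓ J)) := by
  let e : (A ⧸ (I ⊓ J)) →ₗ[ℂ] (A ⧸ I) × (A ⧸ J) :=
    (((I ⊓ J).liftQ (Submodule.mkQ I) (by simp)).restrictScalars ℂ).prod
      (((I ⊓ J).liftQ (Submodule.mkQ J) (by simp)).restrictScalars ℂ)
  refine FiniteDimensional.of_injective e ((injective_iff_map_eq_zero e).2 fun x hx => ?_)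
  obtain ⟨x, rfl⟩ := Submodule.Quotient.mk_surjective _ x
  obtain ⟨h1, h2⟩ := Prod.mk.inj hx
  exact (Submodule.Quotient.mk_eq_zero _).2
    ⟨(Submodule.Quotient.mk_eq_zero I).1 h1, (Submodule.Quotient.mk_eq_zero J).1 h2⟩

theorem finiteDimensional_quotient_of_ker_le {A V : Type*} [Ring A] [Algebra ℂ A] [AddCommGroup V]
    [Module ℂ V] [FiniteDimensional ℂ V] (I : Ideal A) (ψ : A →ₗ[ℂ] V)
    (h : ∀ x, ψ x = 0 ↔ x ∈ I) : FiniteDimensional ℂ (A ⧸ I) := by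
  have hk : LinearMap.ker ψ = I.restrictScalars ℂ := Submodule.ext h
  have : FiniteDimensional ℂ (A ⧸ LinearMap.ker ψ) :=
    FiniteDimensional.of_injective ((LinearMap.ker ψ).liftQ ψ le_rfl)
      (LinearMap.ker_eq_bot.1 (Submodule.ker_liftQ_eq_bot _ _ _ le_rfl))
  rw [hk] at this
  exact Module.Finite.equiv (Submodule.Quotient.restrictScalarsEquiv ℂ I)

/-- A translate by g₀ vanishes on any p with g₀p ⊆ I for a suitable I, whereas the counit takes the
value 1 on a projector. For sums of translates the ideals are intersected. -/
theorem unit₀_notMem_translates : unit₀ ∉ translates := by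
  intro h
  have key : ∀ b ∈ translates, ∃ I : Ideal U₀, I.IsTwoSided ∧ FiniteDimensional ℂ (U₀ ⧸ I) ∧
      ∀ p, (∀ a, UniversalEnvelopingAlgebra.ι ℂ a * p ∈ I) → b.1 p = 0 := by
    intro b hb
    induction hb using Submodule.span_induction with
    | mem b hb =>
      obtain ⟨a, ⟨c, I, hI, hIf, hc⟩, rfl⟩ := hb
      exact ⟨I, hI, hIf, fun p hp => hc _ (hp a)⟩
    | zero => exact ⟨⊤, inferInstance, by infer_instance, fun _ _ => rfl⟩
    | add b c _ _ hb hc =>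
      obtain ⟨I, hI, hIf, hb⟩ := hb
      obtain ⟨K, hK, hKf, hc⟩ := hc
      refine ⟨I ⊓ K, ⟨fun b ha => ⟨hI.mul_mem_of_left b ha.1, hK.mul_mem_of_left b ha.2⟩⟩,
        finiteDimensional_quotient_inf I K, fun p hp => ?_⟩
      change b.1 p + c.1 p = 0
      rw [hb p fun a => (hp a).1, hc p fun a => (hp a).2, add_zero]
    | smul r b _ hb =>
      obtain ⟨I, hI, hIf, hb⟩ := hb
      refine ⟨I, hI, hIf, fun p hp => ?_⟩
      change r • b.1 p = 0
      rw [hb p hp, smul_zero]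
  obtain ⟨I, hI, hIf, hb⟩ := key _ h
  obtain ⟨p, hp, hp', -⟩ := exists_projector I
  exact one_ne_zero (hp.symm.trans (hb p hp'))

/-- Any linear form that vanishes on the translates by g₀ but not at the counit is, after rescaling,
a normalized left integral. -/
theorem exists_integral :
    ∃ s₀ : Module.Dual ℂ (finiteDual U₀), IsLeftIntegral unit₀ s₀ ∧ s₀ unit₀ = 1 := by
  obtain ⟨f, hf, hle⟩ := Submodule.exists_le_ker_of_notMem unit₀_notMem_translates
  refine ⟨(f unit₀)⁻¹ • f, isLeftIntegral_of_ι fun a b => ?_, inv_mul_cancel₀ hf⟩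
  have : f (leftTranslate (UniversalEnvelopingAlgebra.ι ℂ a) b) = 0 :=
    hle (Submodule.subset_span ⟨a, b, rfl⟩)
  rw [LinearMap.smul_apply, this, smul_zero]

/-! ### The integral on `U(g)°` -/

theorem ofEven_ι (a : even) :
    ofEven even odd (UniversalEnvelopingAlgebra.ι ℂ a) = ι₀ even odd a := by
  rw [ofEven, UniversalEnvelopingAlgebra.lift_ι_apply]
  rfl

/-- The linear form `ν(z) · s₀ P` on `U(g)°`. -/
def liftedIntegral (s₀ : Module.Dual ℂ (finiteDual U₀)) : Module.Dual ℂ (finiteDual U) :=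
  dualMul (toBidual U z) (s₀ ∘ₗ P)

theorem liftedIntegral_apply (s₀ : Module.Dual ℂ (finiteDual U₀)) (a : finiteDual U) :
    liftedIntegral s₀ a = s₀ (P (leftTranslate z a)) :=
  dualMul_toBidual_apply parity_z _ a

/-- The image of U(g₀) in U(g) is even; this is what makes the lifted integral an even form. -/
theorem P_parity (a : finiteDual U) : P (parity a) = P a := by
  have h : (SuperAlgebra.parityHom U).comp (ofEven even odd) = ofEven even odd := by
    apply UniversalEnvelopingAlgebra.hom_ext
    refine LieHom.ext fun a => ?_
    change parity (ofEven even odd (UniversalEnvelopingAlgebra.ι ℂ a)) =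
      ofEven even odd (UniversalEnvelopingAlgebra.ι ℂ a)
    rw [ofEven_ι, parity_ι₀]
  exact Subtype.ext (LinearMap.ext fun x => congrArg a.1 (AlgHom.congr_fun h x))

theorem liftedIntegral_parity (s₀ : Module.Dual ℂ (finiteDual U₀)) :
    liftedIntegral s₀ ∘ₗ parity = liftedIntegral s₀ := by
  refine LinearMap.ext fun a => ?_
  have h : leftTranslate z (parity a) = parity (leftTranslate z a) :=
    Subtype.ext (LinearMap.ext fun x => by
      rw [leftTranslate_apply, finiteDual.parity_apply, finiteDual.parity_apply,
        leftTranslate_apply, SuperAlgebra.parity_mul, parity_z])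
  rw [LinearMap.comp_apply, liftedIntegral_apply, liftedIntegral_apply, h, P_parity]

/-- On the linear forms vanishing on a given ideal, the lifted integral is the evaluation at the
product of `z` and a projector. -/
theorem exists_liftedIntegral_eq (I : Ideal U) [I.IsTwoSided] [FiniteDimensional ℂ (U ⧸ I)] :
    ∃ p : U₀, envelopingCounit even p = 1 ∧ (∀ a, ι₀ even odd a * ofEven even odd p ∈ I) ∧
      (∀ a, ofEven even odd p * ι₀ even odd a ∈ I) ∧
      ∀ s₀, IsLeftIntegral unit₀ s₀ → s₀ unit₀ = 1 → ∀ b : finiteDual U, (∀ x ∈ I, b.1 x = 0) →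
        liftedIntegral s₀ b = b.1 (z * ofEven even odd p) := by
  -- The projector is taken modulo the preimage of I in U(g₀). The restriction to U(g₀) of the
  -- translate y ↦ b(zy) vanishes on this preimage.
  have : FiniteDimensional ℂ (U₀ ⧸ I.comap (ofEven even odd)) :=
    finiteDimensional_quotient_of_ker_le _
      ((Submodule.mkQ I).restrictScalars ℂ ∘ₗ (ofEven even odd).toLinearMap)
      fun x => Submodule.Quotient.mk_eq_zero I
  obtain ⟨p, hp, hl, hr⟩ := exists_projector (I.comap (ofEven even odd))
  refine ⟨p, hp, fun a => ?_, fun a => ?_, fun s₀ hs h1 b hb => ?_⟩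
  · rw [← ofEven_ι, ← map_mul]
    exact hl a
  · rw [← ofEven_ι, ← map_mul]
    exact hr a
  · rw [liftedIntegral_apply]
    exact integral_eq_apply hs h1 hp hr fun x hx => hb _ (I.mul_mem_left z hx)

theorem isLeftIntegral_liftedIntegral {s₀ : Module.Dual ℂ (finiteDual U₀)}
    (hs : IsLeftIntegral unit₀ s₀) (h1 : s₀ unit₀ = 1) : IsLeftIntegral unit (liftedIntegral s₀) := by
  rw [isLeftIntegral_iff _ _ (liftedIntegral_parity s₀)]
  intro a x
  obtain ⟨I, hI, hIf, ha⟩ := a.2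
  obtain ⟨p, -, hl, -, h⟩ := exists_liftedIntegral_eq I
  rw [h s₀ hs h1 a ha, h s₀ hs h1 (leftTranslate x a) fun y hy => ha _ (I.mul_mem_left x hy)]
  -- Since g₀p ⊆ I, the whole left ideal U(g)g₀ is multiplied into I by p from the right; it then
  -- remains to use xz - ε(x)z ∈ J.
  have hJ : ∀ j ∈ J, j * ofEven even odd p ∈ I := by
    intro j hj
    induction hj using Submodule.span_induction with
    | mem j hj =>
      obtain ⟨b, rfl⟩ := hj
      exact hl b
    | zero => rw [zero_mul]; exact I.zero_mem
    | add j k _ _ hj hk => rw [add_mul]; exact I.add_mem hj hk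
    | smul u j _ hj => rw [smul_eq_mul, mul_assoc]; exact I.mul_mem_left u hj
  have h2 := ha _ (hJ _ (mul_z_sub_mem x))
  rw [sub_mul, map_sub, smul_mul_assoc, map_smul, sub_eq_zero, mul_assoc] at h2
  exact h2.trans (mul_comm _ _)

theorem isRightIntegral_liftedIntegral {s₀ : Module.Dual ℂ (finiteDual U₀)}
    (hs : IsLeftIntegral unit₀ s₀) (h1 : s₀ unit₀ = 1) :
    IsRightIntegral unit (liftedIntegral s₀) := by
  rw [isRightIntegral_iff _ _ (liftedIntegral_parity s₀)]
  intro a x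
  obtain ⟨I, hI, hIf, ha⟩ := a.2
  obtain ⟨p, -, -, hr, h⟩ := exists_liftedIntegral_eq I
  rw [h s₀ hs h1 a ha, h s₀ hs h1 (rightTranslate x a) fun y hy => ha _ (I.mul_mem_right x hy),
    rightTranslate_apply]
  have h2 := ha _ (mul_z_mul_sub_mem I hr x)
  -- Centrality of z reconciles pz, for which right invariance is known, with zp, at which the
  -- integral evaluates.
  rw [mul_sub, map_sub, mul_smul_comm, map_smul, sub_eq_zero, ← mul_assoc, z_comm] at h2
  exact h2.trans (mul_comm _ _)

theorem algHom_apply_eq_smul {A E : Type*} [Ring A] [Algebra ℂ A] [Ring E] [Algebra ℂ E]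
    {θ : A →ₐ[ℂ] Module.End ℂ E} {x : A} {c : ℂ} {v : E} (h : θ (x - c • 1) v = 0) :
    θ x v = c • v := by
  rw [map_sub, map_smul θ, map_one, LinearMap.sub_apply, sub_eq_zero] at h
  exact h

theorem finiteDimensional_quotient_ker {A E : Type*} [Ring A] [Algebra ℂ A] [Ring E] [Algebra ℂ E]
    [FiniteDimensional ℂ E] (θ : A →ₐ[ℂ] Module.End ℂ E) :
    FiniteDimensional ℂ (A ⧸ RingHom.ker θ) :=
  finiteDimensional_quotient_of_ker_le _ θ.toLinearMap fun _ => Iff.rfl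

/-- Modulo J every element of U(g₀) is its counit, and J annihilates `isotypicEnd`. -/
theorem adjointEnd_ofEven_isotypicEnd (x : U₀) :
    adjointEnd even odd (ofEven even odd x) isotypicEnd =
      envelopingCounit even x • isotypicEnd := by
  let S : Subalgebra ℂ U₀ :=
    { carrier := {x | ofEven even odd x - envelopingCounit even x • 1 ∈ J}
      mul_mem' := by
        intro x y hx hy
        have : ofEven even odd (x * y) - envelopingCounit even (x * y) • (1 : U) =
            ofEven even odd x * (ofEven even odd y - envelopingCounit even y • 1) +
              envelopingCounit even y • (ofEven even odd x - envelopingCounit even x • 1) := by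
          rw [map_mul, map_mul, mul_sub, smul_sub, smul_smul, mul_smul_comm, mul_one,
            mul_comm (envelopingCounit even y)]
          abel
        change _ - _ ∈ J
        rw [this]
        exact J.add_mem (J.mul_mem_left _ hy) ((J.restrictScalars ℂ).smul_mem _ hx)
      add_mem' := by
        intro x y hx hy
        change _ - _ ∈ J
        rw [map_add, map_add, add_smul, add_sub_add_comm]
        exact J.add_mem hx hy
      algebraMap_mem' := by
        intro c
        change _ - _ ∈ J
        rw [AlgHom.commutes, AlgHom.commutes, Algebra.algebraMap_self, RingHom.id_apply,
          Algebra.algebraMap_eq_smul_one, sub_self]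
        exact J.zero_mem }
  have hS : ofEven even odd x - envelopingCounit even x • 1 ∈ J := by
    refine envelopingAlgebra_induction S (fun a => ?_) x
    have h : envelopingCounit even (UniversalEnvelopingAlgebra.ι ℂ a) = 0 := by
      rw [envelopingCounit, UniversalEnvelopingAlgebra.lift_ι_apply]
      rfl
    change _ - _ ∈ J
    rw [h, zero_smul, sub_zero, ofEven_ι]
    exact ι₀_mem_J a
  exact algHom_apply_eq_smul (adjointEnd_isotypicEnd_eq_zero hS)

theorem liftedIntegral_ne_zero {s₀ : Module.Dual ℂ (finiteDual U₀)}
    (hs : IsLeftIntegral unit₀ s₀) (h1 : s₀ unit₀ = 1) : liftedIntegral s₀ ≠ 0 := by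
  obtain ⟨f, hf⟩ := exists_dual_adjointEnd_z
  have hfin : FiniteDimensional ℂ (U ⧸ RingHom.ker (adjointEnd even odd)) :=
    finiteDimensional_quotient_ker _
  -- The witness is the matrix coefficient x ↦ f(x · `isotypicEnd`). The projector fixes
  -- `isotypicEnd`, so the integral of a is f(z · `isotypicEnd`) ≠ 0.
  let a : finiteDual U :=
    ⟨f ∘ₗ LinearMap.applyₗ isotypicEnd ∘ₗ (adjointEnd even odd).toLinearMap,
      RingHom.ker (adjointEnd even odd), inferInstance, hfin, fun x hx => by
        change f (adjointEnd even odd x isotypicEnd) = 0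
        rw [(RingHom.mem_ker).1 hx, LinearMap.zero_apply, map_zero]⟩
  obtain ⟨p, hp, -, -, h⟩ := exists_liftedIntegral_eq (RingHom.ker (adjointEnd even odd))
  intro h0
  have h2 := h s₀ hs h1 a fun x hx => by
    change f (adjointEnd even odd x isotypicEnd) = 0
    rw [(RingHom.mem_ker).1 hx, LinearMap.zero_apply, map_zero]
  rw [h0] at h2
  refine hf (Eq.trans ?_ h2.symm)
  change _ = f (adjointEnd even odd (z * ofEven even odd p) isotypicEnd)
  rw [map_mul, Module.End.mul_apply, adjointEnd_ofEven_isotypicEnd, hp, one_smul]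

end OSP32

end

theorem mainTheorem8 :
    OSP32.z ∉ OSP32.J ∧
    ((Submodule.Quotient.mk OSP32.z : OSP32.W) ≠ 0 ∧
      ∀ x : OSP32.U, x • (Submodule.Quotient.mk OSP32.z : OSP32.W) =
        OSP32.ε x • (Submodule.Quotient.mk OSP32.z : OSP32.W)) ∧
    (∃ s₀ : Module.Dual ℂ (finiteDual OSP32.U₀),
      IsLeftIntegral OSP32.unit₀ s₀ ∧ s₀ OSP32.unit₀ = 1) ∧
    ∀ s₀ : Module.Dual ℂ (finiteDual OSP32.U₀),
      IsLeftIntegral OSP32.unit₀ s₀ → s₀ OSP32.unit₀ = 1 →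
      dualMul (toBidual OSP32.U OSP32.z) (s₀ ∘ₗ OSP32.P) ≠ 0 ∧
      IsLeftIntegral OSP32.unit (dualMul (toBidual OSP32.U OSP32.z) (s₀ ∘ₗ OSP32.P)) ∧
      IsRightIntegral OSP32.unit (dualMul (toBidual OSP32.U OSP32.z) (s₀ ∘ₗ OSP32.P)) :=
  ⟨OSP32.z_notMem_J,
    ⟨fun h => OSP32.z_notMem_J ((Submodule.Quotient.mk_eq_zero _).1 h), OSP32.smul_mk_z⟩,
    OSP32.exists_integral, fun _ hs h1 => ⟨OSP32.liftedIntegral_ne_zero hs h1,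
      OSP32.isLeftIntegral_liftedIntegral hs h1, OSP32.isRightIntegral_liftedIntegral hs h1⟩⟩
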